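/- Let $d\ge 1$. A function $K:\mathbb R^d\times\mathbb R^d\to\mathbb C$ (only its values for $x\ne y$ matter) is called a non-degenerate Calderón–Zygmund kernel if at least one of the following holds. (i) There are constants $c_K,c_0>0$ and an increasing (i.e. non-decreasing) function $\omega:[0,1)\to[0,\infty)$ with $\omega(t)\to0$ as $t\to0$ such that $|K(x,y)|\le c_K|x-y|^{-d}$ for all $x\neq y$; $$|K(x,y)-K(x',y)|+|K(y,x)-K(y,x')|\le \frac1{|x-y|^d}\,\omega\Big(\frac{|x-x'|}{|x-y|}\Big)\quad\text{whenever } |x-x'|<\tfrac12|x-y|;$$ and for every $y\in\mathbb R^d$ and $r>0$ there is $x\notin B(y,r)$ with $|K(x,y)|\ge 1/(c_0r^d)$. (ii) $K(x,y)=\Omega(x-y)/|x-y|^d$ for $x\ne y$, where $\Omega(tx)=\Omega(x)$ for all $t>0$, $x\in\mathbb R^d$, and $\Omega|_{S^{d-1}}\in L^1(S^{d-1})\setminus\{0\}$. **Theorem.** Let $K$ be a non-degenerate Calderón–Zygmund kernel on $\mathbb R^d$, let $k\in\{1,2,\dots\}$, $1<q<p<\infty$, $r=\frac{pq}{p-q}$,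 $q'=\frac{q}{q-1}$, and let $\gamma>0$. There is a constant $C$, depending only on $d,K,k,p,q,\gamma$, with the following property. Let $b\in L^k_{\rm loc}(\mathbb R^d;\mathbb R)$ and $\Theta\ge0$, and for bounded measurable $f,g:\mathbb R^d\to\mathbb C$ with bounded supports at a positive distance from each other write $$\langle T_b^kf,g\rangle=\iint (b(x)-b(y))^kK(x,y)f(y)g(x)\,dy\,dx .$$ Suppose that $$\sum_{i=1}^N|\langle T_b^kf_i,g_i\rangle|\le\Theta\,\Big\|\sum_{i=1}^N\|f_i\|_\infty1_{Q_i}\Big\|_{L^p(\mathbb R^d)}\Big\|\sum_{i=1}^N\|g_i\|_\infty1_{\tilde Q_i}\Big\|_{L^{q'}(\mathbb R^d)}$$ for all $N$, all cubes $Q_i,\tilde Q_i$ (sides parallel to the axes) with $\operatorname{dist}(Q_i,\tilde Q_i)\ge\gamma\operatorname{diam}(Q_i)=\gamma\operatorname{diam}(\tilde Q_i)$, and all $f_i\in L^\infty(Q_i)$, $g_i\in L^\infty(\tilde Q_i)$ (extended by zero), $i=1,\dots,N$. Then $b=a+c$ for some real-valued $a\in L^{rk}(\mathbb R^d)$ and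 some constant $c\in\mathbb R$, where $$\|a\|_{L^{rk}(\mathbb R^d)}\le C\,\Theta^{1/k}.$$ -/

import Mathlib

open MeasureTheory Set Filter Topology

/-- `ℝ^d` with the Euclidean norm and Lebesgue measure. -/
abbrev RSpace (d : ℕ) : Type := EuclideanSpace ℝ (Fin d)

/-- `K` is an `ω`-Calderón–Zygmund kernel on `ℝ^d`, with size constant `cK` and an increasing
modulus of continuity `ω : [0,1) → [0,∞)`. Only values of `K` off the diagonal, and values of `ω`
on `[0,1)`, play a role. -/
structure IsOmegaCZKernel {d : ℕ} (K : RSpace d → RSpace d → ℂ) (cK : ℝ) (ω : ℝ → ℝ) : Prop where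
  omega_nonneg : ∀ t ∈ Ico (0 : ℝ) 1, 0 ≤ ω t
  omega_mono : MonotoneOn ω (Ico (0 : ℝ) 1)
  size : ∀ x y, x ≠ y → ‖K x y‖ ≤ cK / ‖x - y‖ ^ d
  smooth : ∀ x x' y, ‖x - x'‖ < 1 / 2 * ‖x - y‖ →
    ‖K x y - K x' y‖ + ‖K y x - K y x'‖ ≤ 1 / ‖x - y‖ ^ d * ω (‖x - x'‖ / ‖x - y‖)

/-- `K` is a two-variable non-degenerate kernel: an `ω`-Calderón–Zygmund kernel with
`ω(t) → 0` as `t → 0` such that for every `y` and every `r > 0` there is `x ∉ B(y,r)` with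
`|K(x,y)| ≥ 1 / (c₀ r^d)`. -/
def IsNondegenerateOmegaCZ {d : ℕ} (K : RSpace d → RSpace d → ℂ) : Prop :=
  (∃ (cK : ℝ) (ω : ℝ → ℝ), IsOmegaCZKernel K cK ω ∧ Tendsto ω (𝓝[>] 0) (𝓝 0)) ∧
  ∃ c₀ : ℝ, 0 < c₀ ∧ ∀ (y : RSpace d) (r : ℝ), 0 < r →
    ∃ x, x ∉ Metric.ball y r ∧ 1 / (c₀ * r ^ d) ≤ ‖K x y‖

/-- `K` is a non-zero rough homogeneous kernel: `K(x,y) = Ω(x-y) / |x-y|^d` off the diagonal, where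
`Ω` is positively homogeneous of degree `0` and its restriction to the unit sphere is a non-zero
element of `L¹(S^{d-1})` with respect to surface measure. -/
def IsNonzeroRoughHomogeneous {d : ℕ} (K : RSpace d → RSpace d → ℂ) : Prop :=
  ∃ Ω : RSpace d → ℂ,
    (∀ (t : ℝ) (x : RSpace d), 0 < t → Ω (t • x) = Ω x) ∧
    Integrable (fun θ : Metric.sphere (0 : RSpace d) 1 => Ω θ)
      (volume : Measure (RSpace d)).toSphere ∧
    ¬ (fun θ : Metric.sphere (0 : RSpace d) 1 => Ω θ)
        =ᵐ[(volume : Measure (RSpace d)).toSphere] 0 ∧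
    ∀ x y, x ≠ y → K x y = Ω (x - y) / (‖x - y‖ : ℂ) ^ d

/-- Non-degenerate Calderón–Zygmund kernels, of either of the two types. -/
def IsNondegenerateCZKernel {d : ℕ} (K : RSpace d → RSpace d → ℂ) : Prop :=
  IsNondegenerateOmegaCZ K ∨ IsNonzeroRoughHomogeneous K

/-- `b ∈ L^k_loc(ℝ^d; ℝ)`. -/
def MemLkLoc {d : ℕ} (b : RSpace d → ℝ) (k : ℕ) : Prop :=
  ∀ s : Set (RSpace d), IsCompact s → MemLp b k (volume.restrict s)

/-- Cubes in `ℝ^d` with sides parallel to the coordinate axes and positive side length. -/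
def IsCube {d : ℕ} (Q : Set (RSpace d)) : Prop :=
  ∃ (z : RSpace d) (l : ℝ), 0 < l ∧ Q = {x | ∀ i, z i ≤ x i ∧ x i ≤ z i + l}

/-- `Q` and `Q'` are cubes with `dist(Q, Q') ≥ γ diam(Q)` and `diam(Q) = diam(Q')`. -/
def IsSeparatedCubePair {d : ℕ} (γ : ℝ) (Q Q' : Set (RSpace d)) : Prop :=
  IsCube Q ∧ IsCube Q' ∧ Metric.diam Q = Metric.diam Q' ∧
    ∀ x ∈ Q, ∀ y ∈ Q', γ * Metric.diam Q ≤ dist x y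

/-- `f ∈ L^∞(Q)`, as a function on `ℝ^d` extended by zero. -/
def MemLinftyOn {d : ℕ} (f : RSpace d → ℂ) (Q : Set (RSpace d)) : Prop :=
  MemLp f ⊤ volume ∧ ∀ x, x ∉ Q → f x = 0

/-- The bilinear form `⟨T_b^k f, g⟩ = ∬ (b(x)-b(y))^k K(x,y) f(y) g(x) dy dx` of the `k`-th iterated
commutator. For `f`, `g` bounded with bounded supports at a positive distance, `b ∈ L^k_loc` and
`K` a non-degenerate Calderón–Zygmund kernel the integral converges absolutely. -/
noncomputable def commutatorForm {d : ℕ} (K : RSpace d → RSpace d → ℂ) (b : RSpace d → ℝ) (k : ℕ)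
    (f g : RSpace d → ℂ) : ℂ :=
  ∫ x, ∫ y, ((b x - b y : ℝ) : ℂ) ^ k * K x y * f y * g x

/-- The function `∑ᵢ ‖fᵢ‖_∞ 1_{Qᵢ}`. -/
noncomputable def supNormSum {d N : ℕ} (f : Fin N → RSpace d → ℂ) (Q : Fin N → Set (RSpace d)) :
    RSpace d → ℝ :=
  fun x => ∑ i, (Q i).indicator (fun _ => (eLpNorm (f i) ⊤ volume).toReal) x

/-- The off-support, summed weak form of `L^p → L^q` boundedness of `T_b^k` with constant `Θ`,
tested on pairs of cubes of equal size with `dist(Qᵢ, Q'ᵢ) ≥ γ diam(Qᵢ)`. -/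
def OffSupportSummedBound {d : ℕ} (K : RSpace d → RSpace d → ℂ) (b : RSpace d → ℝ) (k : ℕ)
    (p q γ Θ : ℝ) : Prop :=
  ∀ (N : ℕ) (Q Q' : Fin N → Set (RSpace d)) (f g : Fin N → RSpace d → ℂ),
    (∀ i, IsSeparatedCubePair γ (Q i) (Q' i)) →
    (∀ i, MemLinftyOn (f i) (Q i)) → (∀ i, MemLinftyOn (g i) (Q' i)) →
    ENNReal.ofReal (∑ i, ‖commutatorForm K b k (f i) (g i)‖) ≤
      ENNReal.ofReal Θ * eLpNorm (supNormSum f Q) (ENNReal.ofReal p) volume *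
        eLpNorm (supNormSum g Q') (ENNReal.ofReal q.conjExponent) volume

/-! The hypothesis only tests `T_b^k` on separated pairs of cubes. It is converted into a bound for
mean oscillations of `b` over sparse families, and sparse oscillations control `b` itself modulo a
constant.

Each cube `Q` has a companion `Q'` of equal size, at comparable distance, on which `K(x,y)` is close
to a constant `κ` with `|κ| |Q|` bounded below (`HasNearlyConstantPairs`). For a regular kernel
non-degeneracy supplies the centre and smoothness the closeness, once the distance is large relative
to the side. For a rough kernel homogeneity rescales the pair to a small neighbourhood of a Lebesgue
point of `Ω(w)/|w|^d`. Closeness is needed only in `L¹` of each slice, since `|b(x)-b(y)|^k` is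
dominated by a function of `x` plus a function of `y`.

On such a pair, cut `Q` and `Q'` at a median. On the right pieces `b(x)-b(y)` has one sign, so
replacing `K` by `κ` leaves no cancellation, and the replacement error is absorbed. This bounds `|κ|
|Q| ∫_Q |b-α|^k` by four admissible pairings (`exists_oscillation_le`).

Let `a_Q` be the mean of `|b-α_Q|^k` over `Q`, for `Q` in a finite sparse family, and `S = ∑ a_Q^r
|Q|`. Test with heights `a_Q^{r/p}` on `Q` and `a_Q^{r/q'}` on `Q'`. As `1/p + 1/q' = 1 - 1/r`, the
pairings add up to at least a multiple of `S`, while sparseness bounds the right side by a multiple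
of `Θ S^{1/p} S^{1/q'} = Θ S^{1-1/r}`. Hence `S ≤ (CΘ)^r`
(`HasNearlyConstantPairs.exists_sum_meanOsc_rpow_le`).

Finally, a stopping time on dyadic cubes bounds the differences of dyadic medians of `b` by `∑
a_Q^{1/k} 1_Q` over a sparse family (`exists_sparse_domination`). The `L^{rk}` norm of that sum is
again governed by `S`. Medians converge to `b` almost everywhere, so Fatou gives the bound on each
cube with a constant independent of the cube, and a compactness argument for the subtracted
constants passes to the whole space. -/

/-- The closed cube with lower corner `z`, side length `l` and sides parallel to the axes. -/
def axisCube {d : ℕ} (z : RSpace d) (l : ℝ) : Set (RSpace d) :=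
  {x | ∀ i, z i ≤ x i ∧ x i ≤ z i + l}

/-- The half-open cube with lower corner `z` and side length `l`. -/
def halfOpenCube {d : ℕ} (z : RSpace d) (l : ℝ) : Set (RSpace d) :=
  {x | ∀ i, z i ≤ x i ∧ x i < z i + l}

/-! ### Elementary geometry of axis-parallel cubes -/

section Cubes

variable {d : ℕ}

lemma isCube_axisCube (z : RSpace d) {l : ℝ} (hl : 0 < l) : IsCube (axisCube z l) :=
  ⟨z, l, hl, rfl⟩

lemma axisCube_eq_preimage (z : RSpace d) (l : ℝ) :
    axisCube z l = WithLp.ofLp ⁻¹' Icc (fun i => z i) (fun i => z i + l) := by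
  ext x
  simp [axisCube, Pi.le_def, forall_and]

lemma halfOpenCube_eq_preimage (z : RSpace d) (l : ℝ) :
    halfOpenCube z l =
      WithLp.ofLp ⁻¹' (univ.pi fun i => Ico (z i) (z i + l)) := by
  ext x
  simp [halfOpenCube]

lemma measurableSet_axisCube (z : RSpace d) (l : ℝ) : MeasurableSet (axisCube z l) := by
  rw [axisCube_eq_preimage]
  exact (PiLp.volume_preserving_ofLp (Fin d)).measurable measurableSet_Icc

lemma measurableSet_halfOpenCube (z : RSpace d) (l : ℝ) : MeasurableSet (halfOpenCube z l) := by
  rw [halfOpenCube_eq_preimage]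
  exact (PiLp.volume_preserving_ofLp (Fin d)).measurable
    (MeasurableSet.univ_pi fun _ => measurableSet_Ico)

lemma volume_axisCube (z : RSpace d) {l : ℝ} (hl : 0 ≤ l) :
    volume (axisCube z l) = ENNReal.ofReal (l ^ d) := by
  rw [axisCube_eq_preimage,
    (PiLp.volume_preserving_ofLp (Fin d)).measure_preimage measurableSet_Icc.nullMeasurableSet,
    Real.volume_Icc_pi]
  simp [ENNReal.ofReal_pow hl]

lemma halfOpenCube_ae_eq (z : RSpace d) (l : ℝ) :
    halfOpenCube z l =ᵐ[volume] axisCube z l := by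
  rw [axisCube_eq_preimage, halfOpenCube_eq_preimage]
  exact (PiLp.volume_preserving_ofLp (Fin d)).quasiMeasurePreserving.preimage_ae_eq
    Measure.univ_pi_Ico_ae_eq_Icc

lemma halfOpenCube_subset (z : RSpace d) (l : ℝ) : halfOpenCube z l ⊆ axisCube z l :=
  fun _ hx i => ⟨(hx i).1, (hx i).2.le⟩

lemma volume_halfOpenCube (z : RSpace d) {l : ℝ} (hl : 0 ≤ l) :
    volume (halfOpenCube z l) = ENNReal.ofReal (l ^ d) := by
  rw [measure_congr (halfOpenCube_ae_eq z l), volume_axisCube z hl]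

/-- The crude factor `d` in place of `√d` is harmless and is used as the diameter bound for cubes
throughout. -/
lemma norm_le_of_coord_le {x : RSpace d} {l : ℝ} (hx : ∀ i, |x i| ≤ l) : ‖x‖ ≤ d * l := by
  have h : x = ∑ i, x i • EuclideanSpace.basisFun (Fin d) ℝ i :=
    ((EuclideanSpace.basisFun (Fin d) ℝ).sum_repr x).symm
  rw [h]
  refine (norm_sum_le _ _).trans ?_
  calc ∑ i, ‖x i • EuclideanSpace.basisFun (Fin d) ℝ i‖ ≤ ∑ _i : Fin d, l := by
        refine Finset.sum_le_sum fun i _ => ?_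
        simpa [norm_smul] using hx i
    _ = d * l := by simp

lemma norm_sub_le_of_mem_axisCube {z x y : RSpace d} {l : ℝ} (hx : x ∈ axisCube z l)
    (hy : y ∈ axisCube z l) : ‖x - y‖ ≤ d * l := by
  refine norm_le_of_coord_le fun i => ?_
  have h1 := hx i
  have h2 := hy i
  rw [PiLp.sub_apply, abs_le]
  constructor <;> linarith

lemma corner_mem_axisCube (z : RSpace d) {l : ℝ} (hl : 0 ≤ l) : z ∈ axisCube z l :=
  fun _ => ⟨le_rfl, by linarith⟩

lemma axisCube_subset_closedBall (z : RSpace d) {l : ℝ} (hl : 0 ≤ l) :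
    axisCube z l ⊆ Metric.closedBall z (d * l) := fun x hx => by
  rw [Metric.mem_closedBall, dist_eq_norm]
  exact norm_sub_le_of_mem_axisCube hx (corner_mem_axisCube z hl)

lemma isCompact_axisCube (z : RSpace d) (l : ℝ) : IsCompact (axisCube z l) := by
  rw [axisCube_eq_preimage]
  exact (PiLp.homeomorph 2 (fun _ : Fin d => ℝ)).isCompact_preimage.2 isCompact_Icc

lemma diam_axisCube_le (z : RSpace d) {l : ℝ} (hl : 0 ≤ l) :
    Metric.diam (axisCube z l) ≤ d * l :=
  Metric.diam_le_of_forall_dist_le (by positivity) fun x hx y hy => by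
    rw [dist_eq_norm]; exact norm_sub_le_of_mem_axisCube hx hy

lemma diam_axisCube_congr (z z' : RSpace d) (l : ℝ) :
    Metric.diam (axisCube z l) = Metric.diam (axisCube z' l) := by
  have h : axisCube z' l = (fun x => x + (z' - z)) '' axisCube z l := by
    ext x
    simp only [mem_image]
    constructor
    · intro hx
      refine ⟨x - (z' - z), fun i => ?_, by abel⟩
      have := hx i
      simp only [PiLp.sub_apply]
      constructor <;> linarith
    · rintro ⟨y, hy, rfl⟩ i
      have := hy i
      simp only [PiLp.add_apply, PiLp.sub_apply]
      constructor <;> linarith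
  rw [h]
  exact ((IsometryEquiv.addRight (z' - z)).isometry.diam_image _).symm

lemma le_norm_sub_of_mem_axisCube {l : ℝ} (hl : 0 ≤ l) {z z' x y : RSpace d}
    (hx : x ∈ axisCube z l) (hy : y ∈ axisCube z' l) : ‖z' - z‖ - 2 * d * l ≤ ‖x - y‖ := by
  have h1 := norm_sub_le_of_mem_axisCube hx (corner_mem_axisCube z hl)
  have h2 := norm_sub_le_of_mem_axisCube hy (corner_mem_axisCube z' hl)
  have : z' - z = (x - z) - (x - y) - (y - z') := by abel
  rw [this]
  linarith [norm_sub_le ((x - z) - (x - y)) (y - z'), norm_sub_le (x - z) (x - y)]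

/-- Passing from corners to arbitrary points costs two diameters, each at most `d * l`; the
remaining `d * γ * l` is at least `γ` times the diameter. -/
lemma isSeparatedCubePair_axisCube {γ l : ℝ} (hγ : 0 < γ) (hl : 0 < l) {z z' : RSpace d}
    (h : (d * γ + 2 * d) * l ≤ ‖z' - z‖) :
    IsSeparatedCubePair γ (axisCube z l) (axisCube z' l) := by
  refine ⟨isCube_axisCube z hl, isCube_axisCube z' hl, diam_axisCube_congr z z' l, ?_⟩
  intro x hx y hy
  have h3 := le_norm_sub_of_mem_axisCube hl.le hx hy
  rw [dist_eq_norm]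
  have h4 : γ * Metric.diam (axisCube z l) ≤ γ * (d * l) := by
    gcongr; exact diam_axisCube_le z hl.le
  linarith

lemma disjoint_axisCube (hd : 1 ≤ d) {γ l : ℝ} (hγ : 0 < γ) (hl : 0 < l) {z z' x y : RSpace d}
    (h : (d * γ + 2 * d) * l ≤ ‖z' - z‖) (hx : x ∈ axisCube z l) (hy : y ∈ axisCube z' l) :
    x ≠ y := by
  rintro rfl
  have h3 := le_norm_sub_of_mem_axisCube hl.le hx hy
  have h4 : (0 : ℝ) < d * γ * l := by positivity
  rw [sub_self, norm_zero] at h3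
  linarith

end Cubes

/-- Every cube `Q` has a companion cube `Q'` of the same size, separated from `Q` but at comparable
distance, such that `K` is nearly constant on `Q' × Q` in an `L^1` sense. -/
def HasNearlyConstantPairs {d : ℕ} (K : RSpace d → RSpace d → ℂ) : Prop :=
  ∀ ε γ : ℝ, 0 < ε → 0 < γ → ∃ A c : ℝ, 0 < A ∧ 0 < c ∧ ∀ (z : RSpace d) (l : ℝ), 0 < l →
    ∃ (z' : RSpace d) (κ : ℂ),
      IsSeparatedCubePair γ (axisCube z l) (axisCube z' l) ∧
      ‖z' - z‖ ≤ A * l ∧ c ≤ ‖κ‖ * l ^ d ∧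
      AEStronglyMeasurable (fun w : RSpace d × RSpace d => K w.1 w.2)
        (volume.restrict (axisCube z' l ×ˢ axisCube z l)) ∧
      (∀ x ∈ axisCube z' l,
        ∫⁻ y in axisCube z l, ‖K x y - κ‖ₑ ≤ ENNReal.ofReal (ε * ‖κ‖ * l ^ d)) ∧
      (∀ y ∈ axisCube z l,
        ∫⁻ x in axisCube z' l, ‖K x y - κ‖ₑ ≤ ENNReal.ofReal (ε * ‖κ‖ * l ^ d))

/-! ### Companion cubes for regular non-degenerate kernels -/

section Regular

variable {d : ℕ} {K : RSpace d → RSpace d → ℂ} {cK : ℝ} {ω : ℝ → ℝ}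

/-- Move one variable at a time, through `K x y'`. After `y` has moved, the distance may have
halved; this is the source of both the argument `2 * t` and the factor `2 ^ d`. -/
lemma IsOmegaCZKernel.norm_sub_le (hK : IsOmegaCZKernel K cK ω) {x y x' y' : RSpace d} {t : ℝ}
    (hxy : x ≠ y) (ht0 : 0 < t) (ht : t ≤ 1 / 8) (hx : ‖x - x'‖ ≤ t * ‖x - y‖)
    (hy : ‖y - y'‖ ≤ t * ‖x - y‖) :
    ‖K x' y' - K x y‖ ≤ 2 ^ (d + 1) / ‖x - y‖ ^ d * ω (2 * t) := by
  set D := ‖x - y‖ with hD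
  have hD0 : 0 < D := norm_pos_iff.2 (sub_ne_zero.2 hxy)
  have htD : t * D ≤ 1 / 8 * D := by gcongr
  have hy' : D / 2 ≤ ‖x - y'‖ := by
    have h1 : x - y = (x - y') - (y - y') := by abel
    have h3 : D ≤ ‖x - y'‖ + ‖y - y'‖ := by rw [hD, h1]; exact _root_.norm_sub_le _ _
    linarith
  have hy0 : 0 < ‖x - y'‖ := by linarith
  have hω : ∀ s, 0 ≤ s → s ≤ 2 * t → ω s ≤ ω (2 * t) := fun s hs hst =>
    hK.omega_mono ⟨hs, by linarith⟩ ⟨by linarith, by linarith⟩ hst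
  have hω0 : 0 ≤ ω (2 * t) := hK.omega_nonneg _ ⟨by linarith, by linarith⟩
  have e1 : ‖K x y' - K x' y'‖ ≤ 2 ^ d / D ^ d * ω (2 * t) := by
    have h := hK.smooth x x' y' (by linarith)
    have h2 : ω (‖x - x'‖ / ‖x - y'‖) ≤ ω (2 * t) := by
      refine hω _ (by positivity) ?_
      rw [div_le_iff₀ hy0]
      nlinarith
    have h3 : 1 / ‖x - y'‖ ^ d ≤ 2 ^ d / D ^ d := by
      rw [← div_pow, ← one_div_pow]
      refine pow_le_pow_left₀ (by positivity) ?_ d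
      rw [div_le_div_iff₀ hy0 hD0]
      linarith
    calc ‖K x y' - K x' y'‖ ≤ 1 / ‖x - y'‖ ^ d * ω (‖x - x'‖ / ‖x - y'‖) := by
          linarith [norm_nonneg (K y' x - K y' x')]
      _ ≤ 1 / ‖x - y'‖ ^ d * ω (2 * t) := by gcongr
      _ ≤ _ := by gcongr
  have e2 : ‖K x y - K x y'‖ ≤ 2 ^ d / D ^ d * ω (2 * t) := by
    have hDs : ‖y - x‖ = D := by rw [hD, norm_sub_rev]
    have h := hK.smooth y y' x (by rw [hDs]; linarith)
    rw [hDs] at h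
    have h2 : ω (‖y - y'‖ / D) ≤ ω (2 * t) := by
      refine hω _ (by positivity) ?_
      rw [div_le_iff₀ hD0]
      nlinarith
    have h3 : 1 / D ^ d ≤ 2 ^ d / D ^ d := by
      gcongr
      exact one_le_pow₀ one_le_two
    calc ‖K x y - K x y'‖ ≤ 1 / D ^ d * ω (‖y - y'‖ / D) := by
          linarith [norm_nonneg (K y x - K y' x)]
      _ ≤ 1 / D ^ d * ω (2 * t) := by gcongr
      _ ≤ _ := by gcongr
  have e3 : K x' y' - K x y = -(K x y' - K x' y') - (K x y - K x y') := by ring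
  rw [e3]
  refine (_root_.norm_sub_le _ _).trans ?_
  rw [norm_neg]
  have : 2 ^ (d + 1) / D ^ d * ω (2 * t)
      = 2 ^ d / D ^ d * ω (2 * t) + 2 ^ d / D ^ d * ω (2 * t) := by ring
  linarith

/-- Serves to make `K` jointly measurable on a product of separated cubes. -/
lemma IsOmegaCZKernel.continuousOn (hK : IsOmegaCZKernel K cK ω)
    (hω : Tendsto ω (𝓝[>] 0) (𝓝 0)) :
    ContinuousOn (fun w : RSpace d × RSpace d => K w.1 w.2) {w | w.1 ≠ w.2} := by
  rintro ⟨x, y⟩ hxy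
  refine ContinuousAt.continuousWithinAt ?_
  have hD0 : 0 < ‖x - y‖ := norm_pos_iff.2 (sub_ne_zero.2 hxy)
  rw [Metric.continuousAt_iff']
  intro ε hε
  have h1 : Tendsto (fun t : ℝ => 2 ^ (d + 1) / ‖x - y‖ ^ d * ω (2 * t)) (𝓝[>] 0) (𝓝 0) := by
    have h2 : Tendsto (fun t : ℝ => 2 * t) (𝓝[>] 0) (𝓝[>] 0) := by
      refine tendsto_nhdsWithin_iff.2 ⟨?_, ?_⟩
      · have : Tendsto (fun t : ℝ => 2 * t) (𝓝 0) (𝓝 (2 * 0)) := tendsto_id.const_mul 2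
        rw [mul_zero] at this
        exact this.mono_left nhdsWithin_le_nhds
      · filter_upwards [self_mem_nhdsWithin] with t ht
        simpa using ht
    simpa using (hω.comp h2).const_mul (2 ^ (d + 1) / ‖x - y‖ ^ d)
  obtain ⟨t, ht1, ht0, ht8⟩ :=
    ((h1.eventually_lt_const hε).and (Ioo_mem_nhdsGT (show (0 : ℝ) < 1 / 8 by norm_num))).exists
  have hpos : 0 < t * ‖x - y‖ := by positivity
  filter_upwards [Metric.ball_mem_nhds (x, y) hpos] with w hw
  rw [Metric.mem_ball, Prod.dist_eq, max_lt_iff, dist_eq_norm, dist_eq_norm] at hw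
  rw [dist_eq_norm]
  refine (hK.norm_sub_le hxy ht0 ht8.le ?_ ?_).trans_lt ht1
  · rw [norm_sub_rev]; exact hw.1.le
  · rw [norm_sub_rev]; exact hw.2.le

lemma setLIntegral_axisCube_le {g : RSpace d → ENNReal} {z : RSpace d} {l M : ℝ} (hl : 0 ≤ l)
    (hM : 0 ≤ M) (h : ∀ x ∈ axisCube z l, g x ≤ ENNReal.ofReal M) :
    ∫⁻ x in axisCube z l, g x ≤ ENNReal.ofReal (M * l ^ d) := by
  calc ∫⁻ x in axisCube z l, g x ≤ ∫⁻ _ in axisCube z l, ENNReal.ofReal M :=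
        setLIntegral_mono' (measurableSet_axisCube z l) h
    _ = ENNReal.ofReal (M * l ^ d) := by
        rw [setLIntegral_const, volume_axisCube z hl, ENNReal.ofReal_mul hM]

lemma IsNondegenerateOmegaCZ.hasNearlyConstantPairs (hd : 1 ≤ d)
    (hK : IsNondegenerateOmegaCZ K) : HasNearlyConstantPairs K := by
  obtain ⟨⟨cK, ω, hCZ, hω⟩, c₀, hc₀, hnd⟩ := hK
  intro ε γ hε hγ
  have hdpos : (0 : ℝ) < d := by exact_mod_cast hd
  have h1 : Tendsto (fun A : ℝ => 2 ^ (d + 1) * c₀ * ω (2 * (d / A))) atTop (𝓝 0) := by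
    have h2 : Tendsto (fun A : ℝ => 2 * (d / A)) atTop (𝓝[>] 0) := by
      refine tendsto_nhdsWithin_iff.2 ⟨?_, ?_⟩
      · simpa using (tendsto_const_nhds.div_atTop tendsto_id : Tendsto (fun A : ℝ => (d : ℝ) / A)
          atTop (𝓝 0)).const_mul 2
      · filter_upwards [eventually_gt_atTop 0] with A hA
        simp only [mem_Ioi]
        positivity
    simpa using (hω.comp h2).const_mul (2 ^ (d + 1) * c₀)
  -- `A` is the distance to the companion in units of the side: so large that the relative
  -- displacement `d / A` makes the modulus beat `ε`, that the cubes are `γ`-separated, and that `d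
  -- / A ≤ 1 / 8`.
  obtain ⟨A, hA1, hA2⟩ := ((h1.eventually_lt_const hε).and
    (eventually_ge_atTop (d * γ + 8 * d))).exists
  have hA8 : 8 * (d : ℝ) ≤ A := by nlinarith
  have hA0 : 0 < A := by nlinarith
  -- Non-degeneracy gives no upper bound on the distance of `x₀`. Comparing its lower bound for `K
  -- x₀ z` with the size estimate does; the maximum with `1` allows `B ≤ B ^ d`.
  set B : ℝ := max 1 (cK * c₀) with hB
  have hB1 : 1 ≤ B := le_max_left _ _
  refine ⟨B * A, 1 / (c₀ * A ^ d), by positivity, by positivity, fun z l hl => ?_⟩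
  obtain ⟨x₀, hx₀, hKx⟩ := hnd z (A * l) (by positivity)
  rw [Metric.mem_ball, dist_eq_norm, not_lt] at hx₀
  have hD0 : 0 < ‖x₀ - z‖ := lt_of_lt_of_le (by positivity) hx₀
  have hne : x₀ ≠ z := sub_ne_zero.1 (norm_pos_iff.1 hD0)
  have hsep : (d * γ + 2 * d) * l ≤ ‖x₀ - z‖ := by
    refine le_trans ?_ hx₀
    gcongr
    linarith
  have hnear : ∀ x ∈ axisCube x₀ l, ∀ y ∈ axisCube z l,
      ‖K x y - K x₀ z‖ₑ ≤ ENNReal.ofReal (ε * ‖K x₀ z‖) := by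
    intro x hx y hy
    have hdl : d * l ≤ d / A * ‖x₀ - z‖ := by
      calc d * l = d / A * (A * l) := by field_simp
        _ ≤ _ := by gcongr
    have hx1 := norm_sub_le_of_mem_axisCube (corner_mem_axisCube x₀ hl.le) hx
    have hy1 := norm_sub_le_of_mem_axisCube (corner_mem_axisCube z hl.le) hy
    have ht8 : (d : ℝ) / A ≤ 1 / 8 := by
      rw [div_le_div_iff₀ hA0 (by norm_num)]; linarith
    have h3 := hCZ.norm_sub_le hne (by positivity : (0 : ℝ) < d / A) ht8
      (hx1.trans hdl) (hy1.trans hdl)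
    rw [← ofReal_norm]
    refine ENNReal.ofReal_le_ofReal (h3.trans ?_)
    have hω0 : 0 ≤ ω (2 * (d / A)) := hCZ.omega_nonneg _ ⟨by positivity, by linarith⟩
    calc 2 ^ (d + 1) / ‖x₀ - z‖ ^ d * ω (2 * (d / A))
        ≤ 2 ^ (d + 1) / (A * l) ^ d * ω (2 * (d / A)) := by gcongr
      _ = 2 ^ (d + 1) * c₀ * ω (2 * (d / A)) * (1 / (c₀ * (A * l) ^ d)) := by field_simp
      _ ≤ ε * ‖K x₀ z‖ := by gcongr
  refine ⟨x₀, K x₀ z, isSeparatedCubePair_axisCube hγ hl hsep, ?_, ?_, ?_, ?_, ?_⟩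
  · have h4 := hKx.trans (hCZ.size x₀ z hne)
    rw [div_le_div_iff₀ (by positivity) (by positivity), one_mul] at h4
    have h5 : ‖x₀ - z‖ ^ d ≤ (B * (A * l)) ^ d := by
      calc ‖x₀ - z‖ ^ d ≤ cK * c₀ * (A * l) ^ d := by linarith
        _ ≤ B * (A * l) ^ d := by gcongr; exact le_max_right _ _
        _ ≤ B ^ d * (A * l) ^ d := by gcongr; exact le_self_pow₀ hB1 (by omega)
        _ = _ := by rw [mul_pow B]
    rw [mul_assoc]
    exact (pow_le_pow_iff_left₀ hD0.le (by positivity) (by omega)).1 h5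
  · calc 1 / (c₀ * A ^ d) = 1 / (c₀ * (A * l) ^ d) * l ^ d := by rw [mul_pow]; field_simp
      _ ≤ _ := by gcongr
  · refine (ContinuousOn.mono (hCZ.continuousOn hω) ?_).aestronglyMeasurable
      ((measurableSet_axisCube _ _).prod (measurableSet_axisCube _ _))
    rintro ⟨x, y⟩ ⟨hx, hy⟩
    exact (disjoint_axisCube hd hγ hl hsep hy hx).symm
  · exact fun x hx => setLIntegral_axisCube_le hl.le (by positivity) fun y hy => hnear x hx y hy
  · exact fun y hy => setLIntegral_axisCube_le hl.le (by positivity) fun x hx => hnear x hx y hy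

end Regular

/-! ### Polar coordinates on the Euclidean space -/

section Polar

variable {d : ℕ}

/-- Polar coordinates `(θ, t) ↦ t θ`. -/
noncomputable def polarMap (d : ℕ) (w : Metric.sphere (0 : RSpace d) 1 × Ioi (0 : ℝ)) : RSpace d :=
  w.2.1 • w.1.1

lemma polarMap_eq : polarMap d = Subtype.val ∘ (homeomorphUnitSphereProd (RSpace d)).symm := by
  ext1 w
  simp [polarMap, homeomorphUnitSphereProd]

lemma measurableEmbedding_polarMap : MeasurableEmbedding (polarMap d) := by
  rw [polarMap_eq]
  exact (MeasurableEmbedding.subtype_coe (measurableSet_singleton _).compl).comp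
    (Homeomorph.measurableEmbedding _)

lemma measurePreserving_polarMap (hd : 1 ≤ d) : MeasurePreserving (polarMap d)
    ((volume : Measure (RSpace d)).toSphere.prod (Measure.volumeIoiPow (d - 1))) volume := by
  have : Nonempty (Fin d) := ⟨⟨0, hd⟩⟩
  have h1 := (volume : Measure (RSpace d)).measurePreserving_homeomorphUnitSphereProd
  rw [finrank_euclideanSpace_fin] at h1
  have h2 : MeasurePreserving (homeomorphUnitSphereProd (RSpace d)).toMeasurableEquiv
    (Measure.comap Subtype.val volume)
    ((volume : Measure (RSpace d)).toSphere.prod (Measure.volumeIoiPow (d - 1))) := h1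
  have h3 : MeasurePreserving (Subtype.val : ({0}ᶜ : Set (RSpace d)) → RSpace d)
      (Measure.comap Subtype.val volume) volume := by
    refine ⟨measurable_subtype_coe, ?_⟩
    rw [map_comap_subtype_coe (measurableSet_singleton _).compl]
    refine Measure.restrict_eq_self_of_ae_mem ?_
    rw [ae_iff]
    simp
  rw [polarMap_eq]
  exact h3.comp h2.symm

end Polar

/-! ### Companion cubes for rough homogeneous kernels -/

section Rough

variable {d : ℕ} {Ω : RSpace d → ℂ}

/-- The convolution kernel `Ω(w) / |w|^d`. -/
noncomputable def homogeneousKernel (Ω : RSpace d → ℂ) (w : RSpace d) : ℂ :=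
  Ω w / (‖w‖ : ℂ) ^ d

lemma homogeneousKernel_smul (hΩ : ∀ (t : ℝ) (x : RSpace d), 0 < t → Ω (t • x) = Ω x)
    {t : ℝ} (ht : 0 < t) (w : RSpace d) :
    homogeneousKernel Ω w = (t : ℂ) ^ d * homogeneousKernel Ω (t • w) := by
  have h0 : (t : ℂ) ≠ 0 := by exact_mod_cast ht.ne'
  rw [homogeneousKernel, homogeneousKernel, hΩ t w ht, norm_smul, Real.norm_of_nonneg ht.le,
    Complex.ofReal_mul, mul_pow]
  field_simp

lemma homogeneousKernel_polarMap
    (hΩ : ∀ (t : ℝ) (x : RSpace d), 0 < t → Ω (t • x) = Ω x)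
    (w : Metric.sphere (0 : RSpace d) 1 × Ioi (0 : ℝ)) :
    homogeneousKernel Ω (polarMap d w) = Ω w.1 * ((w.2.1 : ℂ) ^ d)⁻¹ := by
  have h1 : ‖w.1.1‖ = 1 := by simp
  have h2 : (0 : ℝ) < w.2.1 := w.2.2
  rw [homogeneousKernel, polarMap, hΩ _ _ h2, norm_smul, h1, Real.norm_of_nonneg h2.le, mul_one,
    div_eq_mul_inv]

lemma aestronglyMeasurable_homogeneousKernel (hd : 1 ≤ d)
    (hΩ : ∀ (t : ℝ) (x : RSpace d), 0 < t → Ω (t • x) = Ω x)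
    (hint : Integrable (fun θ : Metric.sphere (0 : RSpace d) 1 => Ω θ)
      (volume : Measure (RSpace d)).toSphere) :
    AEStronglyMeasurable (homogeneousKernel Ω) volume := by
  rw [← (measurePreserving_polarMap hd).aestronglyMeasurable_comp_iff
    measurableEmbedding_polarMap]
  have : homogeneousKernel Ω ∘ polarMap d =
      fun w => Ω w.1 * ((w.2.1 : ℂ) ^ d)⁻¹ := funext fun w => homogeneousKernel_polarMap hΩ w
  rw [this]
  refine hint.aestronglyMeasurable.comp_fst.mul (Measurable.aestronglyMeasurable ?_)
  fun_prop

/-- The open annulus `1 < |w| < 2`. -/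
def unitAnnulus (d : ℕ) : Set (RSpace d) := {w | 1 < ‖w‖ ∧ ‖w‖ < 2}

lemma isOpen_unitAnnulus : IsOpen (unitAnnulus d) :=
  (isOpen_lt continuous_const continuous_norm).inter (isOpen_lt continuous_norm continuous_const)

lemma indicator_unitAnnulus_polarMap
    (hΩ : ∀ (t : ℝ) (x : RSpace d), 0 < t → Ω (t • x) = Ω x)
    (w : Metric.sphere (0 : RSpace d) 1 × Ioi (0 : ℝ)) :
    (unitAnnulus d).indicator (homogeneousKernel Ω) (polarMap d w) =
      Ω w.1 * ({t : Ioi (0 : ℝ) | 1 < t.1 ∧ t.1 < 2}.indicator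
        (fun t => ((t.1 : ℂ) ^ d)⁻¹) w.2) := by
  have h1 : ‖w.1.1‖ = 1 := by simp
  have h2 : (0 : ℝ) < w.2.1 := w.2.2
  have h3 : polarMap d w ∈ unitAnnulus d ↔ w.2 ∈ {t : Ioi (0 : ℝ) | 1 < t.1 ∧ t.1 < 2} := by
    simp [unitAnnulus, polarMap, norm_smul, h1, abs_of_pos h2]
  by_cases h : w.2 ∈ {t : Ioi (0 : ℝ) | 1 < t.1 ∧ t.1 < 2}
  · rw [indicator_of_mem h, indicator_of_mem (h3.2 h), homogeneousKernel_polarMap hΩ]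
  · rw [indicator_of_notMem h, indicator_of_notMem (mt h3.1 h), mul_zero]

lemma measurableSet_Ioi_Ioo : MeasurableSet {t : Ioi (0 : ℝ) | 1 < t.1 ∧ t.1 < 2} :=
  measurable_subtype_coe measurableSet_Ioo

/-- Restricting to an annulus avoids the singularities at the origin and at infinity, where the
kernel need not be integrable; in polar coordinates it is a product of integrable factors. -/
lemma integrable_indicator_unitAnnulus (hd : 1 ≤ d)
    (hΩ : ∀ (t : ℝ) (x : RSpace d), 0 < t → Ω (t • x) = Ω x)
    (hint : Integrable (fun θ : Metric.sphere (0 : RSpace d) 1 => Ω θ)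
      (volume : Measure (RSpace d)).toSphere) :
    Integrable ((unitAnnulus d).indicator (homogeneousKernel Ω)) volume := by
  rw [← (measurePreserving_polarMap hd).integrable_comp_emb measurableEmbedding_polarMap]
  have : (unitAnnulus d).indicator (homogeneousKernel Ω) ∘ polarMap d = _ :=
    funext fun w => indicator_unitAnnulus_polarMap hΩ w
  rw [this]
  refine hint.mul_prod ((integrable_indicator_iff measurableSet_Ioi_Ioo).2 ?_)
  refine IntegrableOn.of_bound ?_ (Measurable.aestronglyMeasurable (by fun_prop)) 1 ?_
  · refine (measure_mono (t := Iio ⟨2, by simp⟩) fun t ht => ?_).trans_lt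
      (by rw [Measure.volumeIoiPow_apply_Iio]; exact ENNReal.ofReal_lt_top)
    exact ht.2
  · filter_upwards [ae_restrict_mem measurableSet_Ioi_Ioo] with t ht
    rw [norm_inv, norm_pow, Complex.norm_real, Real.norm_of_nonneg (by linarith [ht.1])]
    exact inv_le_one_of_one_le₀ (one_le_pow₀ ht.1.le)

lemma not_indicator_unitAnnulus_ae_zero (hd : 1 ≤ d)
    (hΩ : ∀ (t : ℝ) (x : RSpace d), 0 < t → Ω (t • x) = Ω x)
    (hne : ¬ (fun θ : Metric.sphere (0 : RSpace d) 1 => Ω θ)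
      =ᵐ[(volume : Measure (RSpace d)).toSphere] 0) :
    ¬ (unitAnnulus d).indicator (homogeneousKernel Ω) =ᵐ[volume] 0 := by
  intro h
  apply hne
  have h1 := (measurePreserving_polarMap hd).quasiMeasurePreserving.ae h
  have h2 := Measure.ae_ae_of_ae_prod h1
  filter_upwards [h2] with θ hθ
  by_contra hΩθ
  have h3 : ∀ᵐ t ∂(Measure.volumeIoiPow (d - 1)), ¬ (1 < t.1 ∧ t.1 < 2) := by
    filter_upwards [hθ] with t ht hmem
    have h4 := indicator_unitAnnulus_polarMap hΩ (θ, t)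
    rw [indicator_of_mem (show t ∈ {t : Ioi (0 : ℝ) | 1 < t.1 ∧ t.1 < 2} from hmem)] at h4
    simp only [Pi.zero_apply] at ht
    rw [ht] at h4
    have h5 : ((t.1 : ℂ) ^ d)⁻¹ ≠ 0 :=
      inv_ne_zero (pow_ne_zero _ (by exact_mod_cast (lt_trans one_pos hmem.1).ne'))
    exact (mul_ne_zero hΩθ h5) h4.symm
  -- If the interval `(1,2)` were null for the radial measure, `(0,2)` would have no more mass than
  -- `(0,3/2)`, contradicting the explicit formula `t ^ d / d`.
  have h6 : Measure.volumeIoiPow (d - 1) (Iio ⟨2, by simp⟩) ≤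
      Measure.volumeIoiPow (d - 1) (Iio ⟨3 / 2, by simp⟩) := by
    refine measure_mono_ae ?_
    filter_upwards [h3] with t ht (ht2 : t < _)
    refine Subtype.mk_lt_mk.2 ?_
    have h7 : t.1 < 2 := ht2
    have h8 : ¬ 1 < t.1 := fun h => ht ⟨h, h7⟩
    linarith
  rw [Measure.volumeIoiPow_apply_Iio, Measure.volumeIoiPow_apply_Iio,
    ENNReal.ofReal_le_ofReal_iff (by positivity), div_le_div_iff_of_pos_right (by positivity),
    pow_le_pow_iff_left₀ (by norm_num) (by norm_num) (by omega)] at h6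
  norm_num at h6

/-- The restriction to the annulus is integrable and not almost everywhere zero, so some Lebesgue
point has a non-zero value. Since the annulus is open, small balls there see only the untruncated
kernel. -/
lemma exists_lebesguePoint_homogeneousKernel (hd : 1 ≤ d)
    (hΩ : ∀ (t : ℝ) (x : RSpace d), 0 < t → Ω (t • x) = Ω x)
    (hint : Integrable (fun θ : Metric.sphere (0 : RSpace d) 1 => Ω θ)
      (volume : Measure (RSpace d)).toSphere)
    (hne : ¬ (fun θ : Metric.sphere (0 : RSpace d) 1 => Ω θ)
      =ᵐ[(volume : Measure (RSpace d)).toSphere] 0) :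
    ∃ ζ : RSpace d, 1 < ‖ζ‖ ∧ homogeneousKernel Ω ζ ≠ 0 ∧ ∀ ε > 0, ∀ᶠ ρ in 𝓝[>] (0 : ℝ),
      ∫⁻ w in Metric.closedBall ζ ρ, ‖homogeneousKernel Ω w - homogeneousKernel Ω ζ‖ₑ ≤
        ENNReal.ofReal (ε * ρ ^ d) := by
  set h := (unitAnnulus d).indicator (homogeneousKernel Ω) with hh
  have hi := integrable_indicator_unitAnnulus hd hΩ hint
  have hL := IsUnifLocDoublingMeasure.ae_tendsto_average_norm_sub
    (volume : Measure (RSpace d)) hi.locallyIntegrable 1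
  have hex : ∃ ζ, h ζ ≠ 0 ∧ Tendsto (fun ρ : ℝ => ⨍ y in Metric.closedBall ζ ρ, ‖h y - h ζ‖)
      (𝓝[>] 0) (𝓝 0) := by
    by_contra hcon
    push Not at hcon
    refine not_indicator_unitAnnulus_ae_zero hd hΩ hne ?_
    filter_upwards [hL] with ζ hζ
    by_contra hz
    refine hcon ζ hz (hζ (fun _ => ζ) (fun ρ => ρ) tendsto_id ?_)
    filter_upwards [self_mem_nhdsWithin] with ρ hρ
    simpa using le_of_lt (show (0 : ℝ) < ρ from hρ)
  obtain ⟨ζ, hζ0, hζ⟩ := hex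
  have hmem : ζ ∈ unitAnnulus d := mem_of_indicator_ne_zero hζ0
  have hζeq : h ζ = homogeneousKernel Ω ζ := indicator_of_mem hmem _
  refine ⟨ζ, hmem.1, hζeq ▸ hζ0, fun ε hε => ?_⟩
  set v := (volume : Measure (RSpace d)).real (Metric.ball 0 1) with hv
  have hv0 : 0 < v := ENNReal.toReal_pos (Metric.measure_ball_pos _ _ one_pos).ne'
    measure_ball_lt_top.ne
  obtain ⟨δ, hδ, hball⟩ := Metric.isOpen_iff.1 isOpen_unitAnnulus ζ hmem
  filter_upwards [hζ.eventually_lt_const (show 0 < ε / v by positivity), self_mem_nhdsWithin,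
    Ioo_mem_nhdsGT hδ] with ρ h1 hρ h2
  have hρ0 : (0 : ℝ) < ρ := hρ
  have hsub : Metric.closedBall ζ ρ ⊆ unitAnnulus d :=
    (Metric.closedBall_subset_ball h2.2).trans hball
  have hvol : (volume : Measure (RSpace d)).real (Metric.closedBall ζ ρ) = ρ ^ d * v := by
    rw [measureReal_def, Measure.addHaar_closedBall _ _ hρ0.le, finrank_euclideanSpace_fin,
      ENNReal.toReal_mul, ENNReal.toReal_ofReal (by positivity), hv, measureReal_def]
  have hint' : IntegrableOn (fun y => ‖h y - h ζ‖) (Metric.closedBall ζ ρ) volume :=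
    (hi.integrableOn.sub (integrableOn_const measure_closedBall_lt_top.ne)).norm
  have h3 : ∫ y in Metric.closedBall ζ ρ, ‖h y - h ζ‖ ≤ ε * ρ ^ d := by
    rw [setAverage_eq, hvol, smul_eq_mul, inv_mul_lt_iff₀ (by positivity)] at h1
    calc _ ≤ ρ ^ d * v * (ε / v) := h1.le
      _ = _ := by field_simp
  calc ∫⁻ w in Metric.closedBall ζ ρ, ‖homogeneousKernel Ω w - homogeneousKernel Ω ζ‖ₑ
      = ∫⁻ w in Metric.closedBall ζ ρ, ENNReal.ofReal ‖h w - h ζ‖ := by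
        refine setLIntegral_congr_fun Metric.isClosed_closedBall.measurableSet fun w hw => ?_
        rw [hζeq, hh]
        simp only [indicator_of_mem (hsub hw), ofReal_norm]
    _ = ENNReal.ofReal (∫ y in Metric.closedBall ζ ρ, ‖h y - h ζ‖) :=
        (ofReal_integral_eq_lintegral_ofReal hint' (ae_of_all _ fun _ => norm_nonneg _)).symm
    _ ≤ _ := ENNReal.ofReal_le_ofReal h3

lemma lintegral_comp_smul_eq (f : RSpace d → ENNReal) {t : ℝ} (ht : 0 < t) :
    ENNReal.ofReal (t ^ d) * ∫⁻ x, f (t • x) = ∫⁻ x, f x := by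
  have h1 : MeasurableEmbedding (fun x : RSpace d => t • x) :=
    (Homeomorph.smulOfNeZero t ht.ne').measurableEmbedding
  have h2 := h1.lintegral_map (μ := volume) f
  rw [← h2, Measure.map_addHaar_smul _ ht.ne', lintegral_smul_measure, smul_eq_mul, ← mul_assoc,
    finrank_euclideanSpace_fin, ← ENNReal.ofReal_mul (by positivity), abs_of_pos (by positivity),
    mul_inv_cancel₀ (by positivity), ENNReal.ofReal_one, one_mul]

/-- The two forms of `φ` correspond to the two kinds of slices of `K (x - y)`: freezing `x` or
freezing `y`. -/
lemma lintegral_closedBall_comp_le {f : RSpace d → ENNReal} {ζ v : RSpace d} {R t : ℝ}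
    (ht : 0 < t) {s : Set (RSpace d)} {φ : RSpace d → RSpace d}
    (hφ : φ = (fun x => v - x) ∨ φ = fun x => x - v)
    (hs : MeasurableSet s) (h : ∀ x ∈ s, t • φ x ∈ Metric.closedBall ζ R) :
    ENNReal.ofReal (t ^ d) * ∫⁻ x in s, f (t • φ x) ≤ ∫⁻ w in Metric.closedBall ζ R, f w := by
  set H := (Metric.closedBall ζ R).indicator f with hH
  have h1 : ∫⁻ x in s, f (t • φ x) ≤ ∫⁻ x, H (t • φ x) := by
    calc ∫⁻ x in s, f (t • φ x) = ∫⁻ x in s, H (t • φ x) :=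
          setLIntegral_congr_fun hs fun x hx => by simp only [hH, indicator_of_mem (h x hx)]
      _ ≤ _ := setLIntegral_le_lintegral _ _
  have h2 : ∫⁻ x, H (t • φ x) = ∫⁻ x, H (t • x) := by
    rcases hφ with rfl | rfl
    · exact lintegral_sub_left_eq_self (fun x => H (t • x)) v
    · exact lintegral_sub_right_eq_self (fun x => H (t • x)) v
  calc _ ≤ ENNReal.ofReal (t ^ d) * ∫⁻ x, H (t • x) := by rw [← h2]; gcongr
    _ = ∫⁻ x, H x := lintegral_comp_smul_eq H ht
    _ = _ := lintegral_indicator Metric.isClosed_closedBall.measurableSet _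

lemma IsNonzeroRoughHomogeneous.hasNearlyConstantPairs {K : RSpace d → RSpace d → ℂ}
    (hd : 1 ≤ d) (hK : IsNonzeroRoughHomogeneous K) : HasNearlyConstantPairs K := by
  obtain ⟨Ω, hΩ, hint, hne, hKΩ⟩ := hK
  intro ε γ hε hγ
  have hdpos : (0 : ℝ) < d := by exact_mod_cast hd
  obtain ⟨ζ, hζ1, hζ0, hζ⟩ := exists_lebesguePoint_homogeneousKernel hd hΩ hint hne
  set k := homogeneousKernel Ω with hk
  have hkζ : 0 < ‖k ζ‖ := norm_pos_iff.2 hζ0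
  -- The factor `d ^ d` is returned later, since the ball has radius `R = d * ρ` with `ρ` the
  -- rescaled side length.
  have h1 := hζ (ε * ‖k ζ‖ / d ^ d) (by positivity)
  obtain ⟨R, hR1, hR0, hR2⟩ :=
    (h1.and (Ioo_mem_nhdsGT (show (0 : ℝ) < d / (d * γ + 2 * d) by positivity))).exists
  set ρ : ℝ := R / d with hρ
  have hρ0 : 0 < ρ := by positivity
  have hRρ : R = d * ρ := by rw [hρ]; field_simp
  rw [hRρ] at hR1 hR2
  refine ⟨‖ζ‖ / ρ, ρ ^ d * ‖k ζ‖, by positivity, by positivity, fun z l hl => ?_⟩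
  -- Dilating by `ρ / l` carries `z' - z` to `ζ` and all differences `x - y` into the ball of radius
  -- `d * ρ` about `ζ`.
  set z' := z + (l / ρ) • ζ with hz'
  have hzz : ‖z' - z‖ = ‖ζ‖ / ρ * l := by
    rw [hz', add_sub_cancel_left, norm_smul, Real.norm_of_nonneg (by positivity)]; ring
  have hsep : (d * γ + 2 * d) * l ≤ ‖z' - z‖ := by
    rw [hzz]
    have h2 : (d * γ + 2 * d) * ρ ≤ 1 := by
      rw [lt_div_iff₀ (by positivity)] at hR2
      have h3 : d * ((d * γ + 2 * d) * ρ) ≤ d * 1 := by linarith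
      exact le_of_mul_le_mul_left h3 hdpos
    have h4 : d * γ + 2 * d ≤ ‖ζ‖ / ρ := by rw [le_div_iff₀ hρ0]; linarith
    gcongr
  set t := ρ / l with ht
  have ht0 : 0 < t := by positivity
  set κ : ℂ := (t : ℂ) ^ d * k ζ with hκ
  have hκn : ‖κ‖ = t ^ d * ‖k ζ‖ := by
    rw [hκ, norm_mul, norm_pow, Complex.norm_real, Real.norm_of_nonneg ht0.le]
  have htl : t ^ d * l ^ d = ρ ^ d := by rw [← mul_pow, ht, div_mul_cancel₀ _ hl.ne']
  have hκl : ‖κ‖ * l ^ d = ρ ^ d * ‖k ζ‖ := by rw [hκn, ← htl]; ring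
  have hball : ∀ x ∈ axisCube z' l, ∀ y ∈ axisCube z l,
      t • (x - y) ∈ Metric.closedBall ζ (d * ρ) := by
    intro x hx y hy
    have h5 : t • (x - y) - ζ = t • ((x - z') - (y - z)) := by
      have h6 : t • (z' - z) = ζ := by
        rw [hz', add_sub_cancel_left, smul_smul, ht]
        have : ρ / l * (l / ρ) = 1 := by field_simp
        rw [this, one_smul]
      calc t • (x - y) - ζ = t • (x - y) - t • (z' - z) := by rw [h6]
        _ = _ := by rw [← smul_sub]; congr 1; abel
    have h7 : ‖(x - z') - (y - z)‖ ≤ d * l := by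
      refine norm_le_of_coord_le fun i => ?_
      have h8 := hx i
      have h9 := hy i
      simp only [PiLp.sub_apply]
      rw [abs_le]
      constructor <;> linarith
    rw [Metric.mem_closedBall, dist_eq_norm, h5, norm_smul, Real.norm_of_nonneg ht0.le]
    calc t * ‖(x - z') - (y - z)‖ ≤ t * (d * l) := by gcongr
      _ = d * ρ := by rw [ht]; field_simp
  have hKeq : ∀ x ∈ axisCube z' l, ∀ y ∈ axisCube z l,
      ‖K x y - κ‖ₑ = ENNReal.ofReal (t ^ d) * ‖k (t • (x - y)) - k ζ‖ₑ := by
    intro x hx y hy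
    have hxy : x ≠ y := (disjoint_axisCube hd hγ hl hsep hy hx).symm
    have h10 : K x y - κ = (t : ℂ) ^ d * (k (t • (x - y)) - k ζ) := by
      rw [mul_sub, hk, ← homogeneousKernel_smul hΩ ht0, hKΩ x y hxy, hκ]
      rfl
    rw [h10, enorm_mul]
    congr 1
    rw [← ofReal_norm, norm_pow, Complex.norm_real, Real.norm_of_nonneg ht0.le]
  have hfin : ENNReal.ofReal (ε * ‖k ζ‖ / d ^ d * (d * ρ) ^ d) =
      ENNReal.ofReal (ε * ‖κ‖ * l ^ d) := by
    congr 1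
    rw [mul_assoc ε, hκl, mul_pow]
    field_simp
  rw [hfin] at hR1
  refine ⟨z', κ, isSeparatedCubePair_axisCube hγ hl hsep, hzz.le, hκl.ge, ?_, ?_, ?_⟩
  · have h11 : AEStronglyMeasurable (fun w : RSpace d × RSpace d => k (w.1 - w.2))
        (volume.restrict (axisCube z' l ×ˢ axisCube z l)) := by
      refine AEStronglyMeasurable.restrict ?_
      exact (aestronglyMeasurable_homogeneousKernel hd hΩ hint).comp_quasiMeasurePreserving
        (quasiMeasurePreserving_sub volume volume)
    refine h11.congr ?_
    filter_upwards [ae_restrict_mem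
      ((measurableSet_axisCube z' l).prod (measurableSet_axisCube z l))] with w hw
    exact (hKΩ w.1 w.2 (disjoint_axisCube hd hγ hl hsep hw.2 hw.1).symm).symm
  · intro x hx
    rw [setLIntegral_congr_fun (measurableSet_axisCube z l) (hKeq x hx),
      lintegral_const_mul' _ _ ENNReal.ofReal_ne_top]
    refine le_trans ?_ hR1
    exact lintegral_closedBall_comp_le (f := fun w => ‖k w - k ζ‖ₑ) ht0 (Or.inl rfl)
      (measurableSet_axisCube z l) (hball x hx)
  · intro y hy
    rw [setLIntegral_congr_fun (measurableSet_axisCube z' l) (fun x hx => hKeq x hx y hy),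
      lintegral_const_mul' _ _ ENNReal.ofReal_ne_top]
    refine le_trans ?_ hR1
    exact lintegral_closedBall_comp_le (f := fun w => ‖k w - k ζ‖ₑ) ht0 (Or.inr rfl)
      (measurableSet_axisCube z' l) (fun x hx => hball x hx y hy)

lemma IsNondegenerateCZKernel.hasNearlyConstantPairs {K : RSpace d → RSpace d → ℂ}
    (hd : 1 ≤ d) (hK : IsNondegenerateCZKernel K) : HasNearlyConstantPairs K :=
  hK.elim (fun h => h.hasNearlyConstantPairs hd) fun h => h.hasNearlyConstantPairs hd

end Rough

/-! ### Medians: existence and comparison with arbitrary constants -/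

section Median

variable {X : Type*} [MeasurableSpace X] {μ : Measure X} {b : X → ℝ}

/-- `α` is a median of `b` with respect to `μ`. -/
def IsMedian (μ : Measure X) (b : X → ℝ) (α : ℝ) : Prop :=
  μ univ ≤ 2 * μ {x | b x ≤ α} ∧ μ univ ≤ 2 * μ {x | α ≤ b x}

lemma exists_isMedian (μ : Measure X) [IsFiniteMeasure μ] (hb : Measurable b) :
    ∃ α, IsMedian μ b α := by
  by_cases h0 : μ univ = 0
  · exact ⟨0, by simp [h0], by simp [h0]⟩
  have hlev : ∀ t, MeasurableSet {x | b x ≤ t} := fun t => measurableSet_le hb measurable_const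
  -- The infimum of this set is the median: continuity of the measure from above and from below
  -- gives the two inequalities.
  set S : Set ℝ := {t | μ univ ≤ 2 * μ {x | b x ≤ t}} with hS
  have hne : S.Nonempty := by
    have h1 : Tendsto (fun n : ℕ => 2 * μ {x | b x ≤ n}) atTop (𝓝 (2 * μ univ)) := by
      have h2 : ⋃ n : ℕ, {x | b x ≤ n} = univ :=
        iUnion_eq_univ_iff.2 fun x => (exists_nat_ge (b x)).imp fun n hn => hn
      rw [← h2]
      refine ENNReal.Tendsto.const_mul (tendsto_measure_iUnion_atTop ?_) (Or.inr (by simp))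
      exact fun m n hmn x (hx : b x ≤ m) => hx.trans (by exact_mod_cast hmn)
    have h3 : μ univ < 2 * μ univ := by
      rw [two_mul]
      exact ENNReal.lt_add_right (measure_ne_top _ _) h0
    obtain ⟨n, hn⟩ := (h1.eventually_const_lt h3).exists
    exact ⟨n, hn.le⟩
  have hbdd : BddBelow S := by
    have h1 : Tendsto (fun n : ℕ => 2 * μ {x | b x ≤ -(n : ℝ)}) atTop (𝓝 (2 * μ ∅)) := by
      have h2 : ⋂ n : ℕ, {x | b x ≤ -(n : ℝ)} = ∅ := by
        refine eq_empty_of_forall_notMem fun x hx => ?_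
        obtain ⟨n, hn⟩ := exists_nat_gt (-b x)
        have := mem_iInter.1 hx n
        simp only [mem_ofPred_eq] at this
        linarith
      rw [← h2]
      refine ENNReal.Tendsto.const_mul (tendsto_measure_iInter_atTop
        (fun n => (hlev _).nullMeasurableSet) ?_ ⟨0, measure_ne_top _ _⟩) (Or.inr (by simp))
      intro m n hmn x (hx : b x ≤ _)
      have : (m : ℝ) ≤ n := by exact_mod_cast hmn
      simp only [mem_ofPred_eq]
      linarith
    rw [measure_empty, mul_zero] at h1
    obtain ⟨n, hn⟩ := (h1.eventually_lt_const (pos_iff_ne_zero.2 h0)).exists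
    refine ⟨-(n : ℝ), fun t ht => ?_⟩
    by_contra hlt
    push Not at hlt
    refine absurd (ht.trans ?_) (not_le.2 hn)
    gcongr
  set α := sInf S with hα
  have hlim0 : ∀ n : ℕ, (0 : ℝ) < 1 / ((n : ℝ) + 1) := fun n => by positivity
  refine ⟨α, ?_, ?_⟩
  · have h1 : Tendsto (fun n : ℕ => 2 * μ {x | b x ≤ α + 1 / ((n : ℝ) + 1)}) atTop
        (𝓝 (2 * μ {x | b x ≤ α})) := by
      have h2 : ⋂ n : ℕ, {x | b x ≤ α + 1 / ((n : ℝ) + 1)} = {x | b x ≤ α} := by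
        ext x
        simp only [mem_iInter, mem_ofPred_eq]
        refine ⟨fun h => ?_, fun h n => by linarith [hlim0 n]⟩
        refine le_of_forall_pos_le_add fun ε hε => ?_
        obtain ⟨n, hn⟩ := exists_nat_one_div_lt hε
        linarith [h n]
      rw [← h2]
      refine ENNReal.Tendsto.const_mul (tendsto_measure_iInter_atTop
        (fun n => (hlev _).nullMeasurableSet) ?_ ⟨0, measure_ne_top _ _⟩) (Or.inr (by simp))
      intro m n hmn x (hx : b x ≤ _)
      have : 1 / ((n : ℝ) + 1) ≤ 1 / ((m : ℝ) + 1) := Nat.one_div_le_one_div hmn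
      simp only [mem_ofPred_eq]
      linarith
    refine ge_of_tendsto' h1 fun n => ?_
    obtain ⟨t, htS, ht⟩ := (csInf_lt_iff hbdd hne).1
      (show sInf S < α + 1 / ((n : ℝ) + 1) by linarith [hlim0 n])
    refine le_trans htS ?_
    gcongr
  · have h1 : Tendsto (fun n : ℕ => 2 * μ {x | b x ≤ α - 1 / ((n : ℝ) + 1)}) atTop
        (𝓝 (2 * μ {x | b x < α})) := by
      have h2 : ⋃ n : ℕ, {x | b x ≤ α - 1 / ((n : ℝ) + 1)} = {x | b x < α} := by
        ext x
        simp only [mem_iUnion, mem_ofPred_eq]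
        refine ⟨fun ⟨n, hn⟩ => by linarith [hlim0 n], fun h => ?_⟩
        obtain ⟨n, hn⟩ := exists_nat_one_div_lt (sub_pos.2 h)
        exact ⟨n, by linarith⟩
      rw [← h2]
      refine ENNReal.Tendsto.const_mul (tendsto_measure_iUnion_atTop ?_) (Or.inr (by simp))
      intro m n hmn x (hx : b x ≤ _)
      have : 1 / ((n : ℝ) + 1) ≤ 1 / ((m : ℝ) + 1) := Nat.one_div_le_one_div hmn
      simp only [mem_ofPred_eq]
      linarith
    have h3 : 2 * μ {x | b x < α} ≤ μ univ := by
      refine le_of_tendsto' h1 fun n => ?_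
      by_contra hlt
      push Not at hlt
      have : α ≤ α - 1 / ((n : ℝ) + 1) := csInf_le hbdd hlt.le
      linarith [hlim0 n]
    have h4 : μ {x | b x < α} + μ {x | α ≤ b x} = μ univ := by
      have : {x | α ≤ b x} = {x | b x < α}ᶜ := by ext x; simp
      rw [this]
      exact measure_add_measure_compl (measurableSet_lt hb measurable_const)
    have h5 : μ {x | b x < α} ≠ ⊤ := measure_ne_top _ _
    refine (ENNReal.add_le_add_iff_left (measure_ne_top μ univ)).1 ?_
    calc μ univ + μ univ = 2 * μ {x | b x < α} + 2 * μ {x | α ≤ b x} := by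
          rw [← mul_add, h4, two_mul]
      _ ≤ _ := by gcongr

lemma integrable_abs_sub_pow [IsFiniteMeasure μ] (hb : Measurable b) {k : ℕ}
    (hi : Integrable (fun x => |b x| ^ k) μ) (c : ℝ) : Integrable (fun x => |b x - c| ^ k) μ := by
  refine ((hi.add (integrable_const (|c| ^ k))).const_mul (2 ^ (k - 1))).mono'
    (by fun_prop) (ae_of_all _ fun x => ?_)
  rw [Real.norm_of_nonneg (by positivity)]
  calc |b x - c| ^ k ≤ (|b x| + |c|) ^ k := by gcongr; exact abs_sub _ _
    _ ≤ _ := add_pow_le (abs_nonneg _) (abs_nonneg _) k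

lemma abs_sub_pow_le (x y c : ℝ) (k : ℕ) :
    |x - y| ^ k ≤ 2 ^ k * (|x - c| ^ k + |y - c| ^ k) := by
  calc |x - y| ^ k ≤ (|x - c| + |y - c|) ^ k := by
        gcongr
        have := abs_sub_le x c y
        rwa [abs_sub_comm c y] at this
    _ ≤ 2 ^ (k - 1) * (|x - c| ^ k + |y - c| ^ k) := add_pow_le (abs_nonneg _) (abs_nonneg _) k
    _ ≤ _ := by gcongr <;> first | exact one_le_two | omega

lemma IsMedian.abs_sub_pow_mul_le [IsFiniteMeasure μ] (hb : Measurable b) {k : ℕ}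
    (hi : Integrable (fun x => |b x| ^ k) μ) {α : ℝ} (hα : IsMedian μ b α) (c : ℝ) :
    |α - c| ^ k * μ.real univ ≤ 2 * ∫ x, |b x - c| ^ k ∂μ := by
  -- At least half of the mass lies on the side of `α` away from `c`, where `|b - c|` is at least
  -- `|α - c|`; Chebyshev's inequality finishes.
  have key : ∀ s : Set X, (∀ x ∈ s, |α - c| ≤ |b x - c|) → μ univ ≤ 2 * μ s →
      |α - c| ^ k * μ.real univ ≤ 2 * ∫ x, |b x - c| ^ k ∂μ := by
    intro s hs hle
    have h1 := mul_meas_ge_le_integral_of_nonneg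
      (ae_of_all μ fun x => by positivity : 0 ≤ᵐ[μ] fun x => |b x - c| ^ k)
      (integrable_abs_sub_pow hb hi c) (|α - c| ^ k)
    have h2 : μ.real s ≤ μ.real {x | |α - c| ^ k ≤ |b x - c| ^ k} :=
      measureReal_mono fun x hx => pow_le_pow_left₀ (abs_nonneg _) (hs x hx) k
    have h3 : μ.real univ ≤ 2 * μ.real s := by
      have := ENNReal.toReal_mono (ENNReal.mul_ne_top (by simp) (measure_ne_top μ s)) hle
      simpa [measureReal_def] using this
    have h4 : 0 ≤ |α - c| ^ k := by positivity
    nlinarith [mul_le_mul_of_nonneg_left (h3.trans (mul_le_mul_of_nonneg_left h2 zero_le_two)) h4]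
  rcases le_total c α with h | h
  · refine key {x | α ≤ b x} (fun x hx => ?_) hα.2
    have hx' : α ≤ b x := hx
    rw [abs_of_nonneg (by linarith), abs_of_nonneg (by linarith)]
    linarith
  · refine key {x | b x ≤ α} (fun x hx => ?_) hα.1
    have hx' : b x ≤ α := hx
    rw [abs_of_nonpos (by linarith), abs_of_nonpos (by linarith)]
    linarith

end Median

/-! ### Oscillation on one cube bounded by off-diagonal pairings -/

section LocalOscillation

variable {d : ℕ} {K : RSpace d → RSpace d → ℂ} {b : RSpace d → ℝ} {k : ℕ}

/-- The iterated integral of `(b(x) - b(y))^k K(x,y)` over `x ∈ G`, `y ∈ F`. -/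
noncomputable def commutatorSetForm (K : RSpace d → RSpace d → ℂ) (b : RSpace d → ℝ) (k : ℕ)
    (F G : Set (RSpace d)) : ℂ :=
  ∫ x in G, ∫ y in F, ((b x - b y : ℝ) : ℂ) ^ k * K x y

lemma commutatorForm_indicator {F G : Set (RSpace d)} (hF : MeasurableSet F)
    (hG : MeasurableSet G) (s t : ℂ) :
    commutatorForm K b k (F.indicator fun _ => s) (G.indicator fun _ => t) =
      s * t * commutatorSetForm K b k F G := by
  rw [commutatorForm, commutatorSetForm, ← integral_indicator hG, ← integral_const_mul]
  congr 1
  ext x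
  by_cases hx : x ∈ G
  · rw [indicator_of_mem hx, indicator_of_mem hx, ← integral_indicator hF, ← integral_const_mul]
    congr 1
    ext y
    by_cases hy : y ∈ F
    · rw [indicator_of_mem hy, indicator_of_mem hy]; ring
    · rw [indicator_of_notMem hy, indicator_of_notMem hy]; ring
  · simp [indicator_of_notMem hx]

variable {Q Q' : Set (RSpace d)} {κ : ℂ} {M V : ℝ}

/-- Splitting `|b(x)-b(y)|^k` through `c` leaves weights in one variable each, so integrating `K -
κ` in the other variable first uses only the slice bounds. -/
lemma lintegral_pow_mul_enorm_sub_le (hb : Measurable b) (hM : 0 ≤ M)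
    (hKm : AEStronglyMeasurable (fun w : RSpace d × RSpace d => K w.1 w.2)
      (volume.restrict (Q' ×ˢ Q)))
    (hQm : MeasurableSet Q) (hQm' : MeasurableSet Q')
    (hK1 : ∀ x ∈ Q', ∫⁻ y in Q, ‖K x y - κ‖ₑ ≤ ENNReal.ofReal M)
    (hK2 : ∀ y ∈ Q, ∫⁻ x in Q', ‖K x y - κ‖ₑ ≤ ENNReal.ofReal M)
    (c : ℝ) (hi : IntegrableOn (fun x => |b x - c| ^ k) Q)
    (hi' : IntegrableOn (fun x => |b x - c| ^ k) Q') :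
    ∫⁻ w in Q' ×ˢ Q, ENNReal.ofReal (|b w.1 - b w.2| ^ k) * ‖K w.1 w.2 - κ‖ₑ ≤
      ENNReal.ofReal (2 ^ k * M * ((∫ x in Q', |b x - c| ^ k) + ∫ x in Q, |b x - c| ^ k)) := by
  rw [Measure.volume_eq_prod, ← Measure.prod_restrict] at hKm ⊢
  have hKe : AEMeasurable (fun w : RSpace d × RSpace d => ‖K w.1 w.2 - κ‖ₑ)
      ((volume.restrict Q').prod (volume.restrict Q)) :=
    (hKm.sub aestronglyMeasurable_const).enorm
  have hpos : ∀ x, 0 ≤ |b x - c| ^ k := fun x => by positivity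
  have hA : AEMeasurable (fun w : RSpace d × RSpace d =>
      ENNReal.ofReal (|b w.1 - c| ^ k) * ‖K w.1 w.2 - κ‖ₑ)
      ((volume.restrict Q').prod (volume.restrict Q)) :=
    AEMeasurable.mul (Measurable.aemeasurable (by fun_prop)) hKe
  have hB : AEMeasurable (fun w : RSpace d × RSpace d =>
      ENNReal.ofReal (|b w.2 - c| ^ k) * ‖K w.1 w.2 - κ‖ₑ)
      ((volume.restrict Q').prod (volume.restrict Q)) :=
    AEMeasurable.mul (Measurable.aemeasurable (by fun_prop)) hKe
  have e1 : ∫⁻ w, ENNReal.ofReal (|b w.1 - c| ^ k) * ‖K w.1 w.2 - κ‖ₑ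
      ∂((volume.restrict Q').prod (volume.restrict Q)) ≤
      ENNReal.ofReal ((∫ x in Q', |b x - c| ^ k) * M) := by
    rw [lintegral_prod _ hA, ENNReal.ofReal_mul (integral_nonneg hpos),
      ofReal_integral_eq_lintegral_ofReal hi' (ae_of_all _ hpos),
      ← lintegral_mul_const' _ _ ENNReal.ofReal_ne_top]
    refine setLIntegral_mono' hQm' fun x hx => ?_
    dsimp only
    rw [lintegral_const_mul' _ _ ENNReal.ofReal_ne_top]
    gcongr
    exact hK1 x hx
  have e2 : ∫⁻ w, ENNReal.ofReal (|b w.2 - c| ^ k) * ‖K w.1 w.2 - κ‖ₑ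
      ∂((volume.restrict Q').prod (volume.restrict Q)) ≤
      ENNReal.ofReal ((∫ x in Q, |b x - c| ^ k) * M) := by
    rw [lintegral_prod_symm _ hB, ENNReal.ofReal_mul (integral_nonneg hpos),
      ofReal_integral_eq_lintegral_ofReal hi (ae_of_all _ hpos),
      ← lintegral_mul_const' _ _ ENNReal.ofReal_ne_top]
    refine setLIntegral_mono' hQm fun y hy => ?_
    dsimp only
    rw [lintegral_const_mul' _ _ ENNReal.ofReal_ne_top]
    gcongr
    exact hK2 y hy
  calc ∫⁻ w, ENNReal.ofReal (|b w.1 - b w.2| ^ k) * ‖K w.1 w.2 - κ‖ₑ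
        ∂((volume.restrict Q').prod (volume.restrict Q))
      ≤ ∫⁻ w, ENNReal.ofReal (2 ^ k) * (ENNReal.ofReal (|b w.1 - c| ^ k) * ‖K w.1 w.2 - κ‖ₑ +
          ENNReal.ofReal (|b w.2 - c| ^ k) * ‖K w.1 w.2 - κ‖ₑ)
          ∂((volume.restrict Q').prod (volume.restrict Q)) := by
        refine lintegral_mono fun w => ?_
        rw [← add_mul, ← mul_assoc, ← ENNReal.ofReal_add (hpos _) (hpos _),
          ← ENNReal.ofReal_mul (by positivity)]
        gcongr
        exact abs_sub_pow_le _ _ _ _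
    _ = ENNReal.ofReal (2 ^ k) * _ := by
        rw [lintegral_const_mul' _ _ ENNReal.ofReal_ne_top, lintegral_add_left' hA]
    _ ≤ ENNReal.ofReal (2 ^ k) * (ENNReal.ofReal ((∫ x in Q', |b x - c| ^ k) * M) +
          ENNReal.ofReal ((∫ x in Q, |b x - c| ^ k) * M)) := by gcongr
    _ = _ := by
        rw [← ENNReal.ofReal_add (mul_nonneg (integral_nonneg hpos) hM)
          (mul_nonneg (integral_nonneg hpos) hM), ← ENNReal.ofReal_mul (by positivity)]
        congr 1
        ring

lemma norm_mul_integral_pow_le (hb : Measurable b) (hM : 0 ≤ M)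
    (hKm : AEStronglyMeasurable (fun w : RSpace d × RSpace d => K w.1 w.2)
      (volume.restrict (Q' ×ˢ Q)))
    (hQm : MeasurableSet Q) (hQm' : MeasurableSet Q') (hQ : volume Q ≠ ⊤) (hQ' : volume Q' ≠ ⊤)
    (hK1 : ∀ x ∈ Q', ∫⁻ y in Q, ‖K x y - κ‖ₑ ≤ ENNReal.ofReal M)
    (hK2 : ∀ y ∈ Q, ∫⁻ x in Q', ‖K x y - κ‖ₑ ≤ ENNReal.ofReal M)
    (c : ℝ) (hi : IntegrableOn (fun x => |b x - c| ^ k) Q)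
    (hi' : IntegrableOn (fun x => |b x - c| ^ k) Q')
    {F G : Set (RSpace d)} (hF : F ⊆ Q) (hG : G ⊆ Q') (hFm : MeasurableSet F)
    (hGm : MeasurableSet G)
    (hsign : (∀ x ∈ G, ∀ y ∈ F, b y ≤ b x) ∨ (∀ x ∈ G, ∀ y ∈ F, b x ≤ b y)) :
    IntegrableOn (fun w : RSpace d × RSpace d => |b w.1 - b w.2| ^ k) (G ×ˢ F) ∧
    ‖κ‖ * ∫ w in G ×ˢ F, |b w.1 - b w.2| ^ k ≤ ‖commutatorSetForm K b k F G‖ +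
      2 ^ k * M * ((∫ x in Q', |b x - c| ^ k) + ∫ x in Q, |b x - c| ^ k) := by
  set R : ℝ := 2 ^ k * M * ((∫ x in Q', |b x - c| ^ k) + ∫ x in Q, |b x - c| ^ k) with hR
  have hI0 : 0 ≤ ∫ x in Q', |b x - c| ^ k := integral_nonneg fun x => by positivity
  have hI1 : 0 ≤ ∫ x in Q, |b x - c| ^ k := integral_nonneg fun x => by positivity
  have hR0 : 0 ≤ R := by positivity
  have hsub : G ×ˢ F ⊆ Q' ×ˢ Q := prod_mono hG hF
  have hlint := (lintegral_mono_set hsub).trans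
    (lintegral_pow_mul_enorm_sub_le hb hM hKm hQm hQm' hK1 hK2 c hi hi')
  have hKm' := hKm.mono_measure (Measure.restrict_mono hsub le_rfl)
  set u : RSpace d × RSpace d → ℂ := fun w => ((b w.1 - b w.2 : ℝ) : ℂ) ^ k with hu
  have hum : Measurable u := by
    refine Measurable.pow_const (Complex.measurable_ofReal.comp ?_) k
    fun_prop
  have hun : ∀ w, ‖u w‖ = |b w.1 - b w.2| ^ k := fun w => by
    simp only [hu, norm_pow, Complex.norm_real, Real.norm_eq_abs]
  have hE : IntegrableOn (fun w => u w * (K w.1 w.2 - κ)) (G ×ˢ F) := by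
    refine ⟨hum.aestronglyMeasurable.mul (hKm'.sub aestronglyMeasurable_const), ?_⟩
    refine lt_of_le_of_lt (le_trans (le_of_eq ?_) hlint) ENNReal.ofReal_lt_top
    refine lintegral_congr fun w => ?_
    rw [enorm_mul, ← ofReal_norm, hun]
  have hEn : ‖∫ w in G ×ˢ F, u w * (K w.1 w.2 - κ)‖ ≤ R := by
    have h1 := enorm_integral_le_lintegral_enorm (μ := volume.restrict (G ×ˢ F))
      (fun w => u w * (K w.1 w.2 - κ))
    have h2 : ∫⁻ w in G ×ˢ F, ‖u w * (K w.1 w.2 - κ)‖ₑ ≤ ENNReal.ofReal R := by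
      refine le_trans (le_of_eq ?_) hlint
      refine lintegral_congr fun w => ?_
      rw [enorm_mul, ← ofReal_norm, hun]
    have h3 := h1.trans h2
    rw [← ofReal_norm] at h3
    exact (ENNReal.ofReal_le_ofReal_iff hR0).1 h3
  have hui : IntegrableOn (fun w : RSpace d × RSpace d => |b w.1 - b w.2| ^ k) (G ×ˢ F) := by
    have h1 : IntegrableOn (fun w : RSpace d × RSpace d =>
        2 ^ k * (|b w.1 - c| ^ k + |b w.2 - c| ^ k)) (Q' ×ˢ Q) := by
      have hfin : IsFiniteMeasure (volume.restrict Q) := ⟨by simpa using hQ.lt_top⟩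
      have hfin' : IsFiniteMeasure (volume.restrict Q') := ⟨by simpa using hQ'.lt_top⟩
      rw [IntegrableOn, Measure.volume_eq_prod, ← Measure.prod_restrict]
      exact ((Integrable.comp_fst hi' _).add (Integrable.comp_snd hi _)).const_mul _
    refine (h1.mono_set hsub).mono' (Measurable.aestronglyMeasurable (by fun_prop))
      (ae_of_all _ fun w => ?_)
    rw [Real.norm_of_nonneg (by positivity)]
    exact abs_sub_pow_le _ _ _ _
  have huc : IntegrableOn u (G ×ˢ F) := by
    refine Integrable.mono' hui hum.aestronglyMeasurable (ae_of_all _ fun w => (hun w).le)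
  have hform : commutatorSetForm K b k F G =
      (∫ w in G ×ˢ F, u w * (K w.1 w.2 - κ)) + (∫ w in G ×ˢ F, u w) * κ := by
    rw [← integral_mul_const, ← integral_add hE (huc.mul_const κ)]
    have h1 : IntegrableOn (fun w => u w * K w.1 w.2) (G ×ˢ F) := by
      refine (hE.add (huc.mul_const κ)).congr (ae_of_all _ fun w => ?_)
      simp only [Pi.add_apply]
      ring
    rw [Measure.volume_eq_prod] at h1
    rw [commutatorSetForm, ← setIntegral_prod _ h1]
    refine integral_congr_ae (ae_of_all _ fun w => ?_)
    simp only [hu]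
    ring
  have hnorm : ‖∫ w in G ×ˢ F, u w‖ = ∫ w in G ×ˢ F, |b w.1 - b w.2| ^ k := by
    have hnn : 0 ≤ ∫ w in G ×ˢ F, |b w.1 - b w.2| ^ k := integral_nonneg fun w => by positivity
    -- One sign of `b x - b y` on the product makes the phase constant, `1` or `(-1) ^ k`, so taking
    -- the norm of the integral loses nothing.
    obtain ⟨σ, hσ1, hσ⟩ : ∃ σ : ℂ, ‖σ‖ = 1 ∧
        ∀ w ∈ G ×ˢ F, u w = σ * ((|b w.1 - b w.2| ^ k : ℝ) : ℂ) := by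
      rcases hsign with h | h
      · refine ⟨1, by simp, fun w hw => ?_⟩
        rw [abs_of_nonneg (by linarith [h w.1 hw.1 w.2 hw.2])]
        simp [hu]
      · refine ⟨(-1) ^ k, by simp, fun w hw => ?_⟩
        rw [abs_of_nonpos (by linarith [h w.1 hw.1 w.2 hw.2])]
        simp only [hu]
        push_cast
        rw [← mul_pow]
        ring
    rw [setIntegral_congr_fun (hGm.prod hFm) hσ, integral_const_mul, integral_complex_ofReal,
      norm_mul, hσ1, one_mul, Complex.norm_real, Real.norm_of_nonneg hnn]
  refine ⟨hui, ?_⟩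
  have h5 : (∫ w in G ×ˢ F, u w) * κ =
      commutatorSetForm K b k F G - ∫ w in G ×ˢ F, u w * (K w.1 w.2 - κ) := by
    rw [hform]; ring
  rw [← hnorm, mul_comm, ← norm_mul, h5]
  exact (norm_sub_le _ _).trans (by linarith)

lemma two_mul_measureReal_inter_ge {S : Set (RSpace d)} (hS : MeasurableSet S)
    (hV : volume Q = ENNReal.ofReal V) (hV0 : 0 ≤ V)
    (h : (volume.restrict Q) univ ≤ 2 * (volume.restrict Q) S) :
    V ≤ 2 * (volume : Measure (RSpace d)).real (S ∩ Q) := by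
  rw [Measure.restrict_apply_univ, Measure.restrict_apply hS, hV] at h
  have h1 : volume (S ∩ Q) ≠ ⊤ :=
    ne_top_of_le_ne_top (by rw [hV]; exact ENNReal.ofReal_ne_top) (measure_mono inter_subset_right)
  have h2 := ENNReal.toReal_mono (ENNReal.mul_ne_top (by simp) h1) h
  rw [ENNReal.toReal_ofReal hV0] at h2
  simpa [measureReal_def] using h2

/-- The two sets may overlap, as the two sides of a median do; non-negativity is enough. -/
lemma integral_le_add_of_cover {f : RSpace d → ℝ} (hf0 : ∀ x, 0 ≤ f x) (hf : IntegrableOn f Q)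
    {S T : Set (RSpace d)} (hT : MeasurableSet T) (hST : ∀ x, x ∈ S ∨ x ∈ T) :
    ∫ x in Q, f x ≤ (∫ x in S ∩ Q, f x) + ∫ x in T ∩ Q, f x := by
  rw [← integral_inter_add_sdiff hT hf, add_comm, inter_comm Q T]
  refine add_le_add ?_ le_rfl
  refine setIntegral_mono_set (hf.mono_set inter_subset_right) (ae_of_all _ hf0) ?_
  refine LE.le.eventuallyLE fun x hx => ⟨?_, hx.1⟩
  exact (hST x).resolve_right hx.2

/-- If `K` is nearly equal to `κ` on `Q' × Q`, the oscillation of `b` on `Q` around its median is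
controlled by four off-diagonal pairings. -/
lemma exists_oscillation_le (hb : Measurable b)
    (hbi : IntegrableOn (fun x => |b x| ^ k) Q) (hbi' : IntegrableOn (fun x => |b x| ^ k) Q')
    (hKm : AEStronglyMeasurable (fun w : RSpace d × RSpace d => K w.1 w.2)
      (volume.restrict (Q' ×ˢ Q)))
    (hQm : MeasurableSet Q) (hQm' : MeasurableSet Q') (hV0 : 0 < V)
    (hQ : volume Q = ENNReal.ofReal V) (hQ' : volume Q' = ENNReal.ofReal V)
    (hK1 : ∀ x ∈ Q', ∫⁻ y in Q, ‖K x y - κ‖ₑ ≤ ENNReal.ofReal (1 / (64 * 4 ^ k) * ‖κ‖ * V))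
    (hK2 : ∀ y ∈ Q, ∫⁻ x in Q', ‖K x y - κ‖ₑ ≤ ENNReal.ofReal (1 / (64 * 4 ^ k) * ‖κ‖ * V))
    {α : ℝ} (hα : IsMedian (volume.restrict Q) b α) :
    ∃ F G : Fin 4 → Set (RSpace d), (∀ j, MeasurableSet (F j) ∧ F j ⊆ Q) ∧
      (∀ j, MeasurableSet (G j) ∧ G j ⊆ Q') ∧
      ‖κ‖ * V * ∫ x in Q, |b x - α| ^ k ≤
        8 * 2 ^ k * ∑ j, ‖commutatorSetForm K b k (F j) (G j)‖ := by
  have hfin : IsFiniteMeasure (volume.restrict Q) := ⟨by simp [hQ]⟩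
  have hfin' : IsFiniteMeasure (volume.restrict Q') := ⟨by simp [hQ']⟩
  obtain ⟨β, hβ⟩ := exists_isMedian (volume.restrict Q') hb
  have hi : ∀ c, IntegrableOn (fun x => |b x - c| ^ k) Q := integrable_abs_sub_pow hb hbi
  have hi' : ∀ c, IntegrableOn (fun x => |b x - c| ^ k) Q' := integrable_abs_sub_pow hb hbi'
  set P := ‖κ‖ * V with hP
  have hP0 : 0 ≤ P := by positivity
  have hM : (0 : ℝ) ≤ 1 / (64 * 4 ^ k) * ‖κ‖ * V := by positivity
  set J : ℝ → ℝ := fun c => ∫ x in Q, |b x - c| ^ k with hJ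
  set J' : ℝ → ℝ := fun c => ∫ x in Q', |b x - c| ^ k with hJ'
  have hlo : ∀ c, MeasurableSet {x | b x ≤ c} := fun c => measurableSet_le hb measurable_const
  have hhi : ∀ c, MeasurableSet {x | c ≤ b x} := fun c => measurableSet_le measurable_const hb
  -- The error of replacing `K` by `κ`. The factor `64 * 4 ^ k` is chosen to pay for the splitting
  -- constant `2 ^ k`, for a second `2 ^ k` from changing the centre, and still leave room to
  -- absorb.
  set E : ℝ → ℝ := fun c => 2 ^ k * (1 / (64 * 4 ^ k) * ‖κ‖ * V) * (J' c + J c) with hE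
  have hcover : ∀ (c : ℝ) (x : RSpace d), x ∈ {x | b x ≤ c} ∨ x ∈ {x | c ≤ b x} :=
    fun c x => le_total (b x) c
  have main := fun (c : ℝ) {F G : Set (RSpace d)} (hF : F ⊆ Q) (hG : G ⊆ Q')
    (hFm : MeasurableSet F) (hGm : MeasurableSet G) hsign =>
    norm_mul_integral_pow_le hb hM hKm hQm hQm' (by simp [hQ]) (by simp [hQ']) hK1 hK2 c
      (hi c) (hi' c) hF hG hFm hGm hsign
  -- When `F` is at least half of `Q` and lies across `α` from `G`, the integrand dominates `|b x -
  -- α| ^ k`, and integrating out `y` costs only a factor `2`.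
  have stepG : ∀ {F G : Set (RSpace d)}, F ⊆ Q → G ⊆ Q' → MeasurableSet F → MeasurableSet G →
      ((∀ x ∈ G, ∀ y ∈ F, b y ≤ b x) ∨ (∀ x ∈ G, ∀ y ∈ F, b x ≤ b y)) →
      (∀ x ∈ G, ∀ y ∈ F, |b x - α| ≤ |b x - b y|) →
      V ≤ 2 * (volume : Measure (RSpace d)).real F →
      P * ∫ x in G, |b x - α| ^ k ≤ 2 * (‖commutatorSetForm K b k F G‖ + E α) := by
    intro F G hF hG hFm hGm hs hle hVF
    obtain ⟨hint, h1⟩ := main α hF hG hFm hGm hs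
    have h2 : (∫ x in G, |b x - α| ^ k) * (volume : Measure (RSpace d)).real F ≤
        ∫ w in G ×ˢ F, |b w.1 - b w.2| ^ k := by
      have h3 : (∫ x in G, |b x - α| ^ k) * (volume : Measure (RSpace d)).real F =
          ∫ w in G ×ˢ F, |b w.1 - α| ^ k * 1 := by
        rw [Measure.volume_eq_prod, setIntegral_prod_mul (fun x => |b x - α| ^ k) (fun _ => 1)]
        simp
      rw [h3]
      refine integral_mono_of_nonneg (ae_of_all _ fun w => by positivity) hint ?_
      filter_upwards [ae_restrict_mem (hGm.prod hFm)] with w hw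
      rw [mul_one]
      exact pow_le_pow_left₀ (abs_nonneg _) (hle _ hw.1 _ hw.2) k
    have h4 : 0 ≤ ∫ x in G, |b x - α| ^ k := integral_nonneg fun x => by positivity
    calc P * ∫ x in G, |b x - α| ^ k = ‖κ‖ * ((∫ x in G, |b x - α| ^ k) * V) := by rw [hP]; ring
      _ ≤ ‖κ‖ * ((∫ x in G, |b x - α| ^ k) * (2 * (volume : Measure (RSpace d)).real F)) := by
          gcongr
      _ = 2 * (‖κ‖ * ((∫ x in G, |b x - α| ^ k) * (volume : Measure (RSpace d)).real F)) := by ring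
      _ ≤ 2 * (‖κ‖ * ∫ w in G ×ˢ F, |b w.1 - b w.2| ^ k) := by gcongr
      _ ≤ _ := by gcongr
  have stepF : ∀ {F G : Set (RSpace d)}, F ⊆ Q → G ⊆ Q' → MeasurableSet F → MeasurableSet G →
      ((∀ x ∈ G, ∀ y ∈ F, b y ≤ b x) ∨ (∀ x ∈ G, ∀ y ∈ F, b x ≤ b y)) →
      (∀ x ∈ G, ∀ y ∈ F, |b y - β| ≤ |b x - b y|) →
      V ≤ 2 * (volume : Measure (RSpace d)).real G →
      P * ∫ y in F, |b y - β| ^ k ≤ 2 * (‖commutatorSetForm K b k F G‖ + E β) := by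
    intro F G hF hG hFm hGm hs hle hVG
    obtain ⟨hint, h1⟩ := main β hF hG hFm hGm hs
    have h2 : (volume : Measure (RSpace d)).real G * (∫ y in F, |b y - β| ^ k) ≤
        ∫ w in G ×ˢ F, |b w.1 - b w.2| ^ k := by
      have h3 : (volume : Measure (RSpace d)).real G * (∫ y in F, |b y - β| ^ k) =
          ∫ w in G ×ˢ F, 1 * |b w.2 - β| ^ k := by
        rw [Measure.volume_eq_prod, setIntegral_prod_mul (fun _ => 1) (fun x => |b x - β| ^ k)]
        simp
      rw [h3]
      refine integral_mono_of_nonneg (ae_of_all _ fun w => by positivity) hint ?_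
      filter_upwards [ae_restrict_mem (hGm.prod hFm)] with w hw
      rw [one_mul]
      exact pow_le_pow_left₀ (abs_nonneg _) (hle _ hw.1 _ hw.2) k
    have h4 : 0 ≤ ∫ x in F, |b x - β| ^ k := integral_nonneg fun x => by positivity
    calc P * ∫ x in F, |b x - β| ^ k = ‖κ‖ * (V * (∫ x in F, |b x - β| ^ k)) := by rw [hP]; ring
      _ ≤ ‖κ‖ * ((2 * (volume : Measure (RSpace d)).real G) * (∫ x in F, |b x - β| ^ k)) := by
          gcongr
      _ = 2 * (‖κ‖ * ((volume : Measure (RSpace d)).real G * (∫ x in F, |b x - β| ^ k))) := by ring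
      _ ≤ 2 * (‖κ‖ * ∫ w in G ×ˢ F, |b w.1 - b w.2| ^ k) := by gcongr
      _ ≤ _ := by gcongr
  set S₀ := ‖commutatorSetForm K b k ({x | α ≤ b x} ∩ Q) ({x | b x ≤ α} ∩ Q')‖ with hS₀
  set S₁ := ‖commutatorSetForm K b k ({x | b x ≤ α} ∩ Q) ({x | α ≤ b x} ∩ Q')‖ with hS₁
  set S₂ := ‖commutatorSetForm K b k ({x | b x ≤ β} ∩ Q) ({x | β ≤ b x} ∩ Q')‖ with hS₂
  set S₃ := ‖commutatorSetForm K b k ({x | β ≤ b x} ∩ Q) ({x | b x ≤ β} ∩ Q')‖ with hS₃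
  -- Cutting at the median of `Q` controls the oscillation on `Q'`, because the halves with known
  -- mass lie in `Q`. Cutting at the median `β` of `Q'` then controls the oscillation on `Q`.
  have a0 : P * J' α ≤ 2 * (S₀ + E α) + 2 * (S₁ + E α) := by
    have h1 := stepG (F := {x | α ≤ b x} ∩ Q) (G := {x | b x ≤ α} ∩ Q') inter_subset_right
      inter_subset_right ((hhi _).inter hQm) ((hlo _).inter hQm')
      (Or.inr fun x hx y hy => le_trans hx.1 hy.1)
      (fun x hx y hy => by
        have hx1 : b x ≤ α := hx.1
        have hy1 : α ≤ b y := hy.1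
        rw [abs_of_nonpos (by linarith), abs_of_nonpos (by linarith)]; linarith)
      (two_mul_measureReal_inter_ge (hhi _) hQ hV0.le hα.2)
    have h2 := stepG (F := {x | b x ≤ α} ∩ Q) (G := {x | α ≤ b x} ∩ Q') inter_subset_right
      inter_subset_right ((hlo _).inter hQm) ((hhi _).inter hQm')
      (Or.inl fun x hx y hy => le_trans hy.1 hx.1)
      (fun x hx y hy => by
        have hx1 : α ≤ b x := hx.1
        have hy1 : b y ≤ α := hy.1
        rw [abs_of_nonneg (by linarith), abs_of_nonneg (by linarith)]; linarith)
      (two_mul_measureReal_inter_ge (hlo _) hQ hV0.le hα.1)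
    have h3 := integral_le_add_of_cover (fun x => by positivity) (hi' α) (hhi α) (hcover α)
    have h4 := mul_le_mul_of_nonneg_left h3 hP0
    linarith
  have b0 : P * J β ≤ 2 * (S₂ + E β) + 2 * (S₃ + E β) := by
    have h1 := stepF (F := {x | b x ≤ β} ∩ Q) (G := {x | β ≤ b x} ∩ Q') inter_subset_right
      inter_subset_right ((hlo _).inter hQm) ((hhi _).inter hQm')
      (Or.inl fun x hx y hy => le_trans hy.1 hx.1)
      (fun x hx y hy => by
        have hx1 : β ≤ b x := hx.1
        have hy1 : b y ≤ β := hy.1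
        rw [abs_of_nonpos (by linarith), abs_of_nonneg (by linarith)]; linarith)
      (two_mul_measureReal_inter_ge (hhi _) hQ' hV0.le hβ.2)
    have h2 := stepF (F := {x | β ≤ b x} ∩ Q) (G := {x | b x ≤ β} ∩ Q') inter_subset_right
      inter_subset_right ((hhi _).inter hQm) ((hlo _).inter hQm')
      (Or.inr fun x hx y hy => le_trans hx.1 hy.1)
      (fun x hx y hy => by
        have hx1 : b x ≤ β := hx.1
        have hy1 : β ≤ b y := hy.1
        rw [abs_of_nonneg (by linarith), abs_of_nonpos (by linarith)]; linarith)
      (two_mul_measureReal_inter_ge (hlo _) hQ' hV0.le hβ.1)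
    have h3 := integral_le_add_of_cover (fun x => by positivity) (hi β) (hhi β) (hcover β)
    have h4 := mul_le_mul_of_nonneg_left h3 hP0
    linarith
  set c : ℝ := 2 ^ k with hc
  have hc1 : 1 ≤ c := one_le_pow₀ one_le_two
  have hc4 : (4 : ℝ) ^ k = c ^ 2 := by rw [hc, ← pow_mul, mul_comm, pow_mul]; norm_num
  have hX0 : 0 ≤ J' α := integral_nonneg fun x => by positivity
  have hY0 : 0 ≤ J β := integral_nonneg fun x => by positivity
  -- The two centres are close because `β` is a median on `Q'`, so all errors can be written through
  -- `J' α` and `J β`.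
  have hαβ : |β - α| ^ k * V ≤ 2 * J' α := by
    have h1 := hβ.abs_sub_pow_mul_le hb hbi' α
    rwa [measureReal_restrict_apply_univ, measureReal_def, hQ', ENNReal.toReal_ofReal hV0.le]
      at h1
  have shift : ∀ {S : Set (RSpace d)} (e e' : ℝ), volume S = ENNReal.ofReal V →
      (∀ c, IntegrableOn (fun x => |b x - c| ^ k) S) → |e - e'| = |β - α| →
      ∫ x in S, |b x - e| ^ k ≤ c * ((∫ x in S, |b x - e'| ^ k) + 2 * J' α) := by
    intro S e e' hS hint he
    have hSf : IsFiniteMeasure (volume.restrict S) := ⟨by simp [hS]⟩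
    calc ∫ x in S, |b x - e| ^ k ≤ ∫ x in S, c * (|b x - e'| ^ k + |e - e'| ^ k) :=
          integral_mono (hint e) (((hint e').add (integrable_const _)).const_mul c)
            fun x => abs_sub_pow_le _ _ _ _
      _ = c * ((∫ x in S, |b x - e'| ^ k) + |β - α| ^ k * V) := by
          rw [integral_const_mul, integral_add (hint e') (integrable_const _), integral_const,
            measureReal_restrict_apply_univ, measureReal_def, hS, ENNReal.toReal_ofReal hV0.le, he,
            smul_eq_mul, mul_comm V]
      _ ≤ _ := by gcongr
  have hJα : J α ≤ c * (J β + 2 * J' α) := shift α β hQ hi (abs_sub_comm _ _)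
  have hJβ : J' β ≤ c * (J' α + 2 * J' α) := shift β α hQ' hi' rfl
  have hEe : ∀ e, E e = P * (J' e + J e) / (64 * c) := by
    intro e
    simp only [hE]
    rw [hc4, hP]
    have : c ≠ 0 := by positivity
    field_simp
  have hEα : 4 * E α ≤ P * (J' α + (J β + 2 * J' α)) / 16 := by
    rw [hEe]
    calc 4 * (P * (J' α + J α) / (64 * c)) = P * (J' α + J α) / c / 16 := by field_simp; ring
      _ ≤ P * (c * J' α + c * (J β + 2 * J' α)) / c / 16 := by
          gcongr
          exact le_mul_of_one_le_left hX0 hc1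
      _ = _ := by field_simp
  have hEβ : 4 * E β ≤ P * (3 * J' α + J β) / 16 := by
    rw [hEe]
    calc 4 * (P * (J' β + J β) / (64 * c)) = P * (J' β + J β) / c / 16 := by field_simp; ring
      _ ≤ P * (c * (J' α + 2 * J' α) + c * J β) / c / 16 := by
          gcongr
          exact le_mul_of_one_le_left hY0 hc1
      _ = _ := by field_simp; ring
  have hPX : 0 ≤ P * J' α := by positivity
  have hPY : 0 ≤ P * J β := by positivity
  -- Together the errors amount to at most three eighths of the left side, which is finite, so they
  -- are absorbed.
  have hsum : P * (J' α + J β) ≤ 4 * (S₀ + S₁ + S₂ + S₃) := by linarith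
  have hfinal : P * J α ≤ 8 * c * (S₀ + S₁ + S₂ + S₃) := by
    calc P * J α ≤ P * (c * (J β + 2 * J' α)) := by gcongr
      _ ≤ 2 * c * (P * (J' α + J β)) := by nlinarith
      _ ≤ 2 * c * (4 * (S₀ + S₁ + S₂ + S₃)) := by gcongr
      _ = _ := by ring
  refine ⟨![{x | α ≤ b x} ∩ Q, {x | b x ≤ α} ∩ Q, {x | b x ≤ β} ∩ Q, {x | β ≤ b x} ∩ Q],
    ![{x | b x ≤ α} ∩ Q', {x | α ≤ b x} ∩ Q', {x | β ≤ b x} ∩ Q', {x | b x ≤ β} ∩ Q'],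
    ?_, ?_, ?_⟩
  · intro j
    fin_cases j
    exacts [⟨(hhi _).inter hQm, inter_subset_right⟩, ⟨(hlo _).inter hQm, inter_subset_right⟩,
      ⟨(hlo _).inter hQm, inter_subset_right⟩, ⟨(hhi _).inter hQm, inter_subset_right⟩]
  · intro j
    fin_cases j
    exacts [⟨(hlo _).inter hQm', inter_subset_right⟩, ⟨(hhi _).inter hQm', inter_subset_right⟩,
      ⟨(hhi _).inter hQm', inter_subset_right⟩, ⟨(hlo _).inter hQm', inter_subset_right⟩]
  · rw [Fin.sum_univ_four]
    exact hfinal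

end LocalOscillation

/-! ### `L^s` bounds for sums of indicators under Carleson packing -/

section SparseSum

variable {n : ℕ}

open Classical in
-- Expand the ordered product as `1 + ∑_{j<i} θ 1_{A_j} W_j`. By induction each term costs at most
-- `2 θ μ(A_j)`, and packing sums these to at most `μ(A_i)`.
lemma lintegral_prod_indicator_le {X : Type*} [MeasurableSpace X] {μ : Measure X}
    {A : Fin n → Set X} (hA : ∀ i, MeasurableSet (A i)) {Λ θ : ENNReal}
    (hpack : ∀ i, ∑ j with j < i ∧ (A j ∩ A i).Nonempty, μ (A j) ≤ Λ * μ (A i))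
    (hθ : 2 * θ * Λ ≤ 1) (i : Fin n) :
    ∫⁻ x in A i, ∏ j with j < i, (1 + (A j).indicator (fun _ => θ) x) ∂μ ≤ 2 * μ (A i) := by
  set W : Fin n → X → ENNReal := fun i x => ∏ j with j < i, (1 + (A j).indicator (fun _ => θ) x)
    with hW
  have hWm : ∀ i, Measurable (W i) := fun i => Finset.measurable_prod _ fun j _ =>
    Measurable.add (f := fun _ => (1 : ENNReal)) measurable_const (measurable_const.indicator (hA j))
  have hexp : ∀ i x, W i x = 1 + ∑ j with j < i, (A j).indicator (fun _ => θ) x * W j x := by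
    intro i x
    simp only [hW]
    rw [Finset.prod_one_add_ordered]
    congr 1
    refine Finset.sum_congr rfl fun j hj => ?_
    congr 1
    refine Finset.prod_congr ?_ fun _ _ => rfl
    ext m
    simp only [Finset.mem_filter, Finset.mem_univ, true_and] at hj ⊢
    exact ⟨fun h => h.2, fun h => ⟨h.trans hj, h⟩⟩
  induction i using WellFoundedLT.induction with
  | _ i ih =>
  have hterm : ∀ j, j < i → ∫⁻ x in A i, (A j).indicator (fun _ => θ) x * W j x ∂μ ≤
      if (A j ∩ A i).Nonempty then θ * (2 * μ (A j)) else 0 := by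
    intro j hj
    have e1 : ∀ x, (A j).indicator (fun _ => θ) x * W j x =
        (A j).indicator (fun x => θ * W j x) x := fun x => by
      by_cases hx : x ∈ A j <;> simp [hx]
    simp only [e1]
    rw [lintegral_indicator (hA j), Measure.restrict_restrict (hA j)]
    split_ifs with hne
    · rw [lintegral_const_mul _ (hWm j)]
      gcongr
      exact (lintegral_mono_set inter_subset_left).trans (ih j hj)
    · rw [not_nonempty_iff_eq_empty.1 hne]
      simp
  calc ∫⁻ x in A i, W i x ∂μ
      = μ (A i) + ∑ j with j < i, ∫⁻ x in A i, (A j).indicator (fun _ => θ) x * W j x ∂μ := by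
        simp only [hexp i]
        rw [lintegral_add_left measurable_const, lintegral_finsetSum]
        · simp
        · exact fun j _ => (measurable_const.indicator (hA j)).mul (hWm j)
    _ ≤ μ (A i) + ∑ j with j < i, if (A j ∩ A i).Nonempty then θ * (2 * μ (A j)) else 0 := by
        gcongr with j hj
        exact hterm j (Finset.mem_filter.1 hj).2
    _ = μ (A i) + 2 * θ * ∑ j with j < i ∧ (A j ∩ A i).Nonempty, μ (A j) := by
        rw [← Finset.sum_filter, Finset.filter_filter, Finset.mul_sum]
        congr 1
        refine Finset.sum_congr rfl fun j _ => by ring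
    _ ≤ μ (A i) + 2 * θ * (Λ * μ (A i)) := by gcongr; exact hpack i
    _ = μ (A i) + 2 * θ * Λ * μ (A i) := by ring
    _ ≤ μ (A i) + 1 * μ (A i) := by gcongr
    _ = 2 * μ (A i) := by ring

/-- With `v_i = ∏_{j<i} (1 - η 1_{A_j})`, the sum `∑ η 1_{A_i} v_i` telescopes to at most `1`.
Jensen's inequality with weights `1_{A_i} v_i` applied to `m_i / v_i` moves the power inside, at the
price of `v_i ^ (1 - s)`, the product displayed. -/
lemma rpow_sum_indicator_le {X : Type*} {A : Fin n → Set X} {s η : ℝ} (hs : 1 ≤ s) (hη0 : 0 < η) (hη1 : η < 1)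
    {m : Fin n → ℝ} (hm : ∀ i, 0 ≤ m i) (x : X) :
    (∑ i, (A i).indicator (fun _ => m i) x) ^ s ≤ η ^ (1 - s) *
      ∑ i, (A i).indicator (fun _ => m i ^ s *
        ∏ j with j < i, (1 + (A j).indicator (fun _ => (1 - η) ^ (1 - s) - 1) x)) x := by
  set t : Fin n → ℝ := fun i => (A i).indicator (fun _ => (1 : ℝ)) x with ht
  set v : Fin n → ℝ := fun i => ∏ j with j < i, (1 - η * t j) with hv
  have ht01 : ∀ i, 0 ≤ t i ∧ t i ≤ 1 := fun i => by
    by_cases hx : x ∈ A i <;> simp [ht, hx]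
  have hf0 : ∀ j, 0 < 1 - η * t j := fun j => by nlinarith [(ht01 j).1, (ht01 j).2]
  have hv0 : ∀ i, 0 < v i := fun i => Finset.prod_pos fun j _ => hf0 j
  have hs0 : 0 < s := by linarith
  have hη' : 0 < 1 - η := by linarith
  have hW : ∀ i, v i ^ (1 - s) =
      ∏ j with j < i, (1 + (A j).indicator (fun _ => (1 - η) ^ (1 - s) - 1) x) := by
    intro i
    rw [hv, ← Real.finsetProd_rpow _ _ fun j _ => (hf0 j).le]
    refine Finset.prod_congr rfl fun j _ => ?_
    by_cases hx : x ∈ A j <;> simp [ht, hx]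
  have hsum : ∑ i, t i * v i ≤ η⁻¹ := by
    have h1 := Finset.prod_one_sub_ordered Finset.univ fun i => η * t i
    have h2 : 0 ≤ ∏ i, (1 - η * t i) := Finset.prod_nonneg fun i _ => (hf0 i).le
    have h3 : ∑ i, η * t i * ∏ j with j < i, (1 - η * t j) = η * ∑ i, t i * v i := by
      rw [Finset.mul_sum]
      exact Finset.sum_congr rfl fun i _ => by rw [hv]; ring
    rw [h3] at h1
    rw [← one_div, le_div_iff₀ hη0]
    linarith
  have hsum0 : 0 ≤ ∑ i, t i * v i := Finset.sum_nonneg fun i _ => mul_nonneg (ht01 i).1 (hv0 i).le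
  have hJ := Real.inner_le_weight_mul_Lp_of_nonneg Finset.univ hs (fun i => t i * v i)
    (fun i => m i / v i) (fun i => mul_nonneg (ht01 i).1 (hv0 i).le)
    (fun i => div_nonneg (hm i) (hv0 i).le)
  have e1 : ∑ i, t i * v i * (m i / v i) = ∑ i, (A i).indicator (fun _ => m i) x := by
    refine Finset.sum_congr rfl fun i _ => ?_
    have := (hv0 i).ne'
    by_cases hx : x ∈ A i
    · simp only [ht, indicator_of_mem hx]; field_simp
    · simp only [ht, indicator_of_notMem hx]; ring
  have e2 : ∑ i, t i * v i * (m i / v i) ^ s = ∑ i, (A i).indicator (fun _ => m i ^ s *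
        ∏ j with j < i, (1 + (A j).indicator (fun _ => (1 - η) ^ (1 - s) - 1) x)) x := by
    refine Finset.sum_congr rfl fun i _ => ?_
    by_cases hx : x ∈ A i
    · rw [indicator_of_mem hx, ← hW, Real.div_rpow (hm i) (hv0 i).le, Real.rpow_sub (hv0 i),
        Real.rpow_one]
      simp only [ht, indicator_of_mem hx]
      ring
    · simp only [ht, indicator_of_notMem hx]; ring
  rw [e1, e2] at hJ
  set S := ∑ i, (A i).indicator (fun _ => m i ^ s *
        ∏ j with j < i, (1 + (A j).indicator (fun _ => (1 - η) ^ (1 - s) - 1) x)) x with hS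
  have hS0 : 0 ≤ S := by
    rw [← e2]
    exact Finset.sum_nonneg fun i _ => mul_nonneg (mul_nonneg (ht01 i).1 (hv0 i).le)
      (Real.rpow_nonneg (div_nonneg (hm i) (hv0 i).le) _)
  have hl0 : 0 ≤ ∑ i, (A i).indicator (fun _ => m i) x :=
    Finset.sum_nonneg fun i _ => indicator_nonneg (fun _ _ => hm i) x
  have hexp : 0 ≤ 1 - s⁻¹ := sub_nonneg.2 (inv_le_one_of_one_le₀ hs)
  calc (∑ i, (A i).indicator (fun _ => m i) x) ^ s
      ≤ ((∑ i, t i * v i) ^ (1 - s⁻¹) * S ^ s⁻¹) ^ s := Real.rpow_le_rpow hl0 hJ hs0.le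
    _ ≤ ((η⁻¹) ^ (1 - s⁻¹) * S ^ s⁻¹) ^ s := by
        refine Real.rpow_le_rpow (by positivity) ?_ hs0.le
        gcongr
    _ = η ^ (1 - s) * S := by
        rw [Real.mul_rpow (by positivity) (by positivity), ← Real.rpow_mul hS0,
          inv_mul_cancel₀ hs0.ne', Real.rpow_one, ← Real.rpow_mul (by positivity),
          Real.inv_rpow hη0.le, ← Real.rpow_neg hη0.le]
        congr 2
        field_simp
        ring

lemma exists_sub_rpow_le (s : ℝ) {δ : ℝ} (hδ : 0 < δ) :
    ∃ η : ℝ, 0 < η ∧ η < 1 ∧ (1 - η) ^ (1 - s) - 1 ≤ δ := by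
  have h1 : ContinuousAt (fun η : ℝ => (1 - η) ^ (1 - s) - 1) 0 := by
    refine ContinuousAt.sub (ContinuousAt.rpow_const (by fun_prop) (Or.inl (by norm_num))) ?_
    exact continuousAt_const
  have h2 : Tendsto (fun η : ℝ => (1 - η) ^ (1 - s) - 1) (𝓝[>] 0) (𝓝 0) := by
    have := h1.tendsto
    simp only [sub_zero, Real.one_rpow, sub_self] at this
    exact this.mono_left nhdsWithin_le_nhds
  obtain ⟨η, h3, h4⟩ := ((h2.eventually_lt_const hδ).and
    (Ioo_mem_nhdsGT (show (0 : ℝ) < 1 by norm_num))).exists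
  exact ⟨η, h4.1, h4.2, h3.le⟩

open Classical in
/-- For a family satisfying a Carleson packing condition, `∑ mᵢ 1_{Aᵢ}` behaves in `L^s` like a sum
with disjoint supports. -/
lemma exists_lintegral_sum_indicator_rpow_le {s Λ : ℝ} (hs : 1 ≤ s) (hΛ : 0 < Λ) :
    ∃ C : ℝ, 0 < C ∧ ∀ {X : Type} [MeasurableSpace X] (μ : Measure X) {n : ℕ} (A : Fin n → Set X)
      (m : Fin n → ℝ), (∀ i, MeasurableSet (A i)) → (∀ i, 0 ≤ m i) →
      (∀ i, ∑ j with j < i ∧ (A j ∩ A i).Nonempty, μ (A j) ≤ ENNReal.ofReal Λ * μ (A i)) →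
      ∫⁻ x, ENNReal.ofReal ((∑ i, (A i).indicator (fun _ => m i) x) ^ s) ∂μ ≤
        ENNReal.ofReal C * ∑ i, ENNReal.ofReal (m i ^ s) * μ (A i) := by
  -- This threshold for `θ` yields `2 θ Λ ≤ 1`, as required for the weights to have mean at most `2`
  -- on each `A_i`.
  obtain ⟨η, hη0, hη1, hη⟩ := exists_sub_rpow_le s (show (0 : ℝ) < 1 / (2 * Λ) by positivity)
  refine ⟨η ^ (1 - s) * 2, by positivity, ?_⟩
  intro X _ μ n A m hA hm hpack
  set θ := (1 - η) ^ (1 - s) - 1 with hθ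
  have hθ0 : 0 ≤ θ := by
    have := Real.one_le_rpow_of_pos_of_le_one_of_nonpos (show 0 < 1 - η by linarith)
      (show 1 - η ≤ 1 by linarith) (show 1 - s ≤ 0 by linarith)
    linarith
  have hθΛ : 2 * ENNReal.ofReal θ * ENNReal.ofReal Λ ≤ 1 := by
    rw [← ENNReal.ofReal_ofNat 2, ← ENNReal.ofReal_mul (by norm_num),
      ← ENNReal.ofReal_mul (by positivity), ← ENNReal.ofReal_one]
    refine ENNReal.ofReal_le_ofReal ?_
    rw [le_div_iff₀ (by positivity)] at hη
    linarith
  have hind : ∀ j x, ENNReal.ofReal (1 + (A j).indicator (fun _ => θ) x) =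
      1 + (A j).indicator (fun _ => ENNReal.ofReal θ) x := by
    intro j x
    by_cases hx : x ∈ A j
    · simp [hx, ENNReal.ofReal_add, hθ0]
    · simp [hx]
  have hnn : ∀ j x, 0 ≤ 1 + (A j).indicator (fun _ => θ) x := fun j x =>
    add_nonneg zero_le_one (indicator_nonneg (fun _ _ => hθ0) x)
  set W : Fin n → X → ENNReal := fun i x =>
    ∏ j with j < i, (1 + (A j).indicator (fun _ => ENNReal.ofReal θ) x) with hW
  have hWm : ∀ i, Measurable (W i) := fun i => Finset.measurable_prod _ fun j _ =>
    Measurable.add (f := fun _ => (1 : ENNReal)) measurable_const (measurable_const.indicator (hA j))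
  have hpt : ∀ x, ENNReal.ofReal ((∑ i, (A i).indicator (fun _ => m i) x) ^ s) ≤
      ENNReal.ofReal (η ^ (1 - s)) *
        ∑ i, (A i).indicator (fun x => ENNReal.ofReal (m i ^ s) * W i x) x := by
    intro x
    refine (ENNReal.ofReal_le_ofReal (rpow_sum_indicator_le hs hη0 hη1 hm x)).trans ?_
    rw [ENNReal.ofReal_mul (by positivity), ENNReal.ofReal_sum_of_nonneg]
    · gcongr with i _
      by_cases hx : x ∈ A i
      · rw [indicator_of_mem hx, indicator_of_mem hx,
          ENNReal.ofReal_mul (Real.rpow_nonneg (hm i) _),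
          ENNReal.ofReal_prod_of_nonneg fun j _ => hnn j x]
        simp only [hind]
        exact le_rfl
      · simp [hx]
    · exact fun i _ => indicator_nonneg (fun _ _ => mul_nonneg (Real.rpow_nonneg (hm i) _)
        (Finset.prod_nonneg fun j _ => hnn j x)) x
  calc _ ≤ ∫⁻ x, ENNReal.ofReal (η ^ (1 - s)) *
        ∑ i, (A i).indicator (fun x => ENNReal.ofReal (m i ^ s) * W i x) x ∂μ :=
        lintegral_mono hpt
    _ = ENNReal.ofReal (η ^ (1 - s)) *
        ∑ i, ENNReal.ofReal (m i ^ s) * ∫⁻ x in A i, W i x ∂μ := by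
        rw [lintegral_const_mul' _ _ ENNReal.ofReal_ne_top, lintegral_finsetSum]
        · congr 1
          refine Finset.sum_congr rfl fun i _ => ?_
          rw [lintegral_indicator (hA i), lintegral_const_mul _ (hWm i)]
        · exact fun i _ => ((hWm i).const_mul _).indicator (hA i)
    _ ≤ ENNReal.ofReal (η ^ (1 - s)) * ∑ i, ENNReal.ofReal (m i ^ s) * (2 * μ (A i)) := by
        gcongr with i _
        exact lintegral_prod_indicator_le hA hpack hθΛ i
    _ = _ := by
        rw [ENNReal.ofReal_mul (by positivity), mul_assoc, Finset.mul_sum _ _ (ENNReal.ofReal 2)]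
        congr 1
        refine Finset.sum_congr rfl fun i _ => ?_
        rw [ENNReal.ofReal_ofNat]
        ring

end SparseSum

/-! ### Sparse cubes and their neighbours -/

section SparseCubes

/-- The cubes with corners `z i` and side lengths `l i` are sparse, with disjoint major subsets
`E i`. -/
structure IsSparse {d n : ℕ} (z : Fin n → RSpace d) (l : Fin n → ℝ) (E : Fin n → Set (RSpace d)) :
    Prop where
  pos : ∀ i, 0 < l i
  meas : ∀ i, MeasurableSet (E i)
  subset : ∀ i, E i ⊆ axisCube (z i) (l i)
  disjoint : Pairwise fun i j => Disjoint (E i) (E j)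
  large : ∀ i, ENNReal.ofReal (l i ^ d) ≤ 2 * volume (E i)

open Classical in
-- The sets `A i` may be the cubes themselves or companions at distance comparable to the side:
-- packing is inherited from the disjoint sets `E i`.
lemma IsSparse.exists_lintegral_rpow_le {d : ℕ} {s D : ℝ} (hs : 1 ≤ s) (hD : (d : ℝ) ≤ D)
    (hD0 : 0 < D) :
    ∃ C : ℝ, 0 < C ∧ ∀ {n : ℕ} (z : Fin n → RSpace d) (l : Fin n → ℝ) (E : Fin n → Set (RSpace d))
      (A : Fin n → Set (RSpace d)) (m : Fin n → ℝ), IsSparse z l E →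
      (∀ i, MeasurableSet (A i)) → (∀ i, A i ⊆ Metric.closedBall (z i) (D * l i)) →
      (∀ i, volume (A i) = ENNReal.ofReal (l i ^ d)) → (∀ i, 0 ≤ m i) →
      ∫⁻ x, ENNReal.ofReal ((∑ i, (A i).indicator (fun _ => m i) x) ^ s) ≤
        ENNReal.ofReal (C * ∑ i, m i ^ s * l i ^ d) := by
  set v := (volume : Measure (RSpace d)).real (Metric.ball 0 1) with hv
  have hv0 : 0 < v := ENNReal.toReal_pos (Metric.measure_ball_pos _ _ one_pos).ne'
    measure_ball_lt_top.ne
  set Λ : ℝ := 2 * (3 * D) ^ d * v with hΛ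
  obtain ⟨C, hC, hmain⟩ := exists_lintegral_sum_indicator_rpow_le hs
    (show 0 < Λ by positivity)
  refine ⟨C, hC, ?_⟩
  intro n z l E A m hE hA hAsub hAvol hm
  -- Ordering by side length makes the packing condition count only cubes no larger than the given
  -- one. When their `A`'s meet, their sets `E` fit in a ball of radius `3 * D` sides.
  set σ := Tuple.sort l with hσ
  have hmono : Monotone (l ∘ σ) := Tuple.monotone_sort l
  have h1 := hmain volume (A ∘ σ) (m ∘ σ) (fun i => hA _) (fun i => hm _) ?_
  · have e1 : ∀ x, ∑ i, ((A ∘ σ) i).indicator (fun _ => (m ∘ σ) i) x =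
        ∑ i, (A i).indicator (fun _ => m i) x := fun x =>
      Equiv.sum_comp σ fun i => (A i).indicator (fun _ => m i) x
    have e2 : ∑ i, ENNReal.ofReal ((m ∘ σ) i ^ s) * volume ((A ∘ σ) i) =
        ENNReal.ofReal (∑ i, m i ^ s * l i ^ d) := by
      rw [ENNReal.ofReal_sum_of_nonneg fun i _ =>
        mul_nonneg (Real.rpow_nonneg (hm i) _) (pow_nonneg (hE.pos i).le _)]
      rw [← Equiv.sum_comp σ fun i => ENNReal.ofReal (m i ^ s * l i ^ d)]
      refine Finset.sum_congr rfl fun i _ => ?_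
      simp only [Function.comp]
      rw [hAvol, ENNReal.ofReal_mul (Real.rpow_nonneg (hm _) _)]
    simp only [e1, e2] at h1
    rwa [← ENNReal.ofReal_mul hC.le] at h1
  · intro i
    have hli := hE.pos (σ i)
    set F : Finset (Fin n) :=
      Finset.univ.filter fun j => j < i ∧ ((A ∘ σ) j ∩ (A ∘ σ) i).Nonempty with hF
    calc ∑ j ∈ F, volume ((A ∘ σ) j) ≤ ∑ j ∈ F, 2 * volume (E (σ j)) := by
          refine Finset.sum_le_sum fun j _ => ?_
          simp only [Function.comp, hAvol]
          exact hE.large _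
      _ = 2 * volume (⋃ j ∈ F, E (σ j)) := by
          rw [← Finset.mul_sum, measure_biUnion_finset]
          · exact fun a _ b _ hab => hE.disjoint (σ.injective.ne hab)
          · exact fun j _ => hE.meas _
      _ ≤ 2 * volume (Metric.closedBall (z (σ i)) (3 * D * l (σ i))) := by
          gcongr
          refine iUnion₂_subset fun j hj => ?_
          obtain ⟨-, hji, w, hwj, hwi⟩ := Finset.mem_filter.1 hj
          have hll : l (σ j) ≤ l (σ i) := hmono hji.le
          have h2 := hAsub _ hwj
          have h3 := hAsub _ hwi
          intro y hy
          have h4 := axisCube_subset_closedBall _ (hE.pos (σ j)).le (hE.subset _ hy)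
          rw [Metric.mem_closedBall] at h2 h3 h4 ⊢
          have h5 : dist y (z (σ i)) ≤ dist y (z (σ j)) + dist w (z (σ j)) + dist w (z (σ i)) := by
            rw [dist_comm w (z (σ j))]
            exact dist_triangle4 _ _ _ _
          have h6 : d * l (σ j) ≤ D * l (σ i) := by
            gcongr
            exact (hE.pos _).le
          have h7 : D * l (σ j) ≤ D * l (σ i) := by gcongr
          linarith
      _ = ENNReal.ofReal Λ * volume ((A ∘ σ) i) := by
          rw [Measure.addHaar_closedBall _ _ (by positivity), finrank_euclideanSpace_fin]
          simp only [Function.comp, hAvol]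
          rw [← ENNReal.ofReal_toReal (a := volume (Metric.ball (0 : RSpace d) 1))
            measure_ball_lt_top.ne, ← measureReal_def, ← hv, ← ENNReal.ofReal_ofNat 2,
            ← ENNReal.ofReal_mul (by positivity), ← ENNReal.ofReal_mul (by norm_num),
            ← ENNReal.ofReal_mul (by positivity)]
          congr 1
          rw [hΛ, mul_pow _ (l (σ i))]
          ring

end SparseCubes

/-! ### From the summed testing condition to sparse oscillation sums -/

section SparseBound

variable {d : ℕ}

lemma eLpNorm_le_of_lintegral_le {X : Type*} [MeasurableSpace X] {μ : Measure X} {h : X → ℝ}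
    {s B : ℝ} (hs : 0 < s) (hh : ∀ x, 0 ≤ h x) (hB : 0 ≤ B)
    (hle : ∫⁻ x, ENNReal.ofReal (h x ^ s) ∂μ ≤ ENNReal.ofReal B) :
    eLpNorm h (ENNReal.ofReal s) μ ≤ ENNReal.ofReal (B ^ (1 / s)) := by
  rw [eLpNorm_eq_lintegral_rpow_enorm_toReal (by simpa using hs) ENNReal.ofReal_ne_top,
    ENNReal.toReal_ofReal hs.le, ← ENNReal.ofReal_rpow_of_nonneg hB (by positivity)]
  refine ENNReal.rpow_le_rpow (le_trans (le_of_eq ?_) hle) (by positivity)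
  refine lintegral_congr fun x => ?_
  rw [Real.enorm_eq_ofReal (hh x), ENNReal.ofReal_rpow_of_nonneg (hh x) hs.le]

lemma eLpNorm_supNormSum_le {n : ℕ} {s B : ℝ} (hs : 0 < s) (hB : 0 ≤ B)
    {f : Fin n → RSpace d → ℂ} {Q : Fin n → Set (RSpace d)} {m : Fin n → ℝ}
    (hm : ∀ i, (eLpNorm (f i) ⊤ volume).toReal ≤ m i)
    (hle : ∫⁻ x, ENNReal.ofReal ((∑ i, (Q i).indicator (fun _ => m i) x) ^ s) ≤
      ENNReal.ofReal B) :
    eLpNorm (supNormSum f Q) (ENNReal.ofReal s) volume ≤ ENNReal.ofReal (B ^ (1 / s)) := by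
  have h0 : ∀ x, 0 ≤ supNormSum f Q x := fun x =>
    Finset.sum_nonneg fun i _ => indicator_nonneg (fun _ _ => ENNReal.toReal_nonneg) x
  refine eLpNorm_le_of_lintegral_le hs h0 hB (le_trans (lintegral_mono fun x => ?_) hle)
  refine ENNReal.ofReal_le_ofReal (Real.rpow_le_rpow (h0 x) ?_ hs.le)
  exact Finset.sum_le_sum fun i _ => indicator_le_indicator (hm i)

lemma toReal_eLpNorm_top_indicator_const_le (F : Set (RSpace d)) {t : ℝ} (ht : 0 ≤ t) :
    (eLpNorm (F.indicator fun _ => (t : ℂ)) ⊤ volume).toReal ≤ t := by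
  refine ENNReal.toReal_le_of_le_ofReal ht ?_
  rw [eLpNorm_exponent_top]
  refine (eLpNormEssSup_indicator_const_le F (t : ℂ)).trans (le_of_eq ?_)
  rw [← ofReal_norm, Complex.norm_real, Real.norm_of_nonneg ht]

lemma memLinftyOn_indicator {F Q : Set (RSpace d)} (hF : MeasurableSet F) (hFQ : F ⊆ Q)
    (t : ℂ) : MemLinftyOn (F.indicator fun _ => t) Q := by
  refine ⟨MemLp.indicator hF (memLp_top_const t), fun x hx => ?_⟩
  exact indicator_of_notMem (fun h => hx (hFQ h)) _

/-- The mean oscillation `⨍_Q |b - α|^k` over the cube `Q` with corner `z` and side length `l`. -/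
noncomputable def meanOsc (b : RSpace d → ℝ) (k : ℕ) (z : RSpace d) (l α : ℝ) : ℝ :=
  (∫ x in axisCube z l, |b x - α| ^ k) / l ^ d

lemma meanOsc_nonneg (b : RSpace d → ℝ) (k : ℕ) (z : RSpace d) {l : ℝ} (hl : 0 < l) (α : ℝ) :
    0 ≤ meanOsc b k z l α :=
  div_nonneg (integral_nonneg fun x => by positivity) (by positivity)

lemma HasNearlyConstantPairs.exists_sum_meanOsc_rpow_le {K : RSpace d → RSpace d → ℂ}
    (hK : HasNearlyConstantPairs K) (k : ℕ) {p q r γ : ℝ}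
    (hq : 1 < q) (hqp : q < p) (hr : r = p * q / (p - q)) (hγ : 0 < γ) :
    ∃ C : ℝ, 0 < C ∧ ∀ (b : RSpace d → ℝ) (Θ : ℝ), Measurable b →
      (∀ z l, IntegrableOn (fun x => |b x| ^ k) (axisCube z l)) → 0 ≤ Θ →
      OffSupportSummedBound K b k p q γ Θ →
      ∀ {n : ℕ} (z : Fin n → RSpace d) (l : Fin n → ℝ) (E : Fin n → Set (RSpace d))
        (α : Fin n → ℝ), IsSparse z l E →
        (∀ i, IsMedian (volume.restrict (axisCube (z i) (l i))) b (α i)) →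
        ∑ i, meanOsc b k (z i) (l i) (α i) ^ r * l i ^ d ≤ (C * Θ) ^ r := by
  have hp : 1 < p := hq.trans hqp
  have hq1 : 0 < q - 1 := by linarith
  have hpq : 0 < p - q := by linarith
  set q' := q.conjExponent with hq'
  have hq'e : q' = q / (q - 1) := rfl
  have hq'1 : 1 < q' := by rw [hq'e, lt_div_iff₀ hq1]; linarith
  have hr1 : 1 < r := by rw [hr, lt_div_iff₀ hpq]; nlinarith
  have hr0 : 0 < r := by linarith
  have hexp : 1 / p + 1 / q' = 1 - 1 / r := by
    rw [hq'e, hr]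
    have : p ≠ 0 := by linarith
    have : q ≠ 0 := by linarith
    field_simp
    ring
  -- The tolerance is the one required by `exists_oscillation_le`.
  obtain ⟨A, c, hA, hc, hpairs⟩ := hK (1 / (64 * 4 ^ k)) γ (by positivity) hγ
  obtain ⟨Cp, hCp, hSp⟩ := IsSparse.exists_lintegral_rpow_le (d := d) hp.le
    (show (d : ℝ) ≤ A + d by linarith) (by positivity)
  obtain ⟨Cq, hCq, hSq⟩ := IsSparse.exists_lintegral_rpow_le (d := d) hq'1.le
    (show (d : ℝ) ≤ A + d by linarith) (by positivity)
  set C := 32 * 2 ^ k / c * (Cp ^ (1 / p) * Cq ^ (1 / q')) with hC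
  refine ⟨C, by positivity, ?_⟩
  intro b Θ hb hbi hΘ hoff n z l E α hE hα
  choose z' κ hsep hz' hκ hKm hK1 hK2 using fun i => hpairs (z i) (l i) (hE.pos i)
  have hl : ∀ i, 0 < l i ^ d := fun i => pow_pos (hE.pos i) d
  have hosc := fun i => exists_oscillation_le hb (hbi (z i) (l i)) (hbi (z' i) (l i)) (hKm i)
    (measurableSet_axisCube _ _) (measurableSet_axisCube _ _) (hl i)
    (volume_axisCube _ (hE.pos i).le) (volume_axisCube _ (hE.pos i).le) (hK1 i) (hK2 i) (hα i)
  choose F G hF hG hFG using hosc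
  set a : Fin n → ℝ := fun i => meanOsc b k (z i) (l i) (α i) with ha
  have ha0 : ∀ i, 0 ≤ a i := fun i => meanOsc_nonneg b k (z i) (hE.pos i) (α i)
  have hal : ∀ i, c * (a i * l i ^ d) ≤
      8 * 2 ^ k * ∑ j, ‖commutatorSetForm K b k (F i j) (G i j)‖ := by
    intro i
    have h1 : a i * l i ^ d = ∫ x in axisCube (z i) (l i), |b x - α i| ^ k :=
      div_mul_cancel₀ _ (hl i).ne'
    refine le_trans ?_ (hFG i)
    rw [← h1]
    exact mul_le_mul_of_nonneg_right (hκ i) (mul_nonneg (ha0 i) (hl i).le)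
  set S := ∑ i, a i ^ r * l i ^ d with hS
  have hS0 : 0 ≤ S := Finset.sum_nonneg fun i _ =>
    mul_nonneg (Real.rpow_nonneg (ha0 i) _) (hl i).le
  have hpow : ∀ (s : ℝ), 0 < s → ∑ i, (a i ^ (r / s)) ^ s * l i ^ d = S := fun s hs =>
    Finset.sum_congr rfl fun i _ => by
      rw [← Real.rpow_mul (ha0 i), div_mul_cancel₀ _ hs.ne']
  have hQp := hSp z l E (fun i => axisCube (z i) (l i)) (fun i => a i ^ (r / p)) hE
    (fun i => measurableSet_axisCube _ _)
    (fun i => (axisCube_subset_closedBall _ (hE.pos i).le).trans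
      (Metric.closedBall_subset_closedBall (by gcongr; exacts [(hE.pos i).le, by linarith])))
    (fun i => volume_axisCube _ (hE.pos i).le) (fun i => Real.rpow_nonneg (ha0 i) _)
  have hQq := hSq z l E (fun i => axisCube (z' i) (l i)) (fun i => a i ^ (r / q')) hE
    (fun i => measurableSet_axisCube _ _)
    (fun i => (axisCube_subset_closedBall _ (hE.pos i).le).trans
      (Metric.closedBall_subset_closedBall' (by
        rw [dist_eq_norm]
        linarith [hz' i])))
    (fun i => volume_axisCube _ (hE.pos i).le) (fun i => Real.rpow_nonneg (ha0 i) _)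
  rw [hpow p (by linarith)] at hQp
  rw [hpow q' (by linarith)] at hQq
  have hj : ∀ j : Fin 4, ∑ i, a i ^ (r - 1) * ‖commutatorSetForm K b k (F i j) (G i j)‖ ≤
      Θ * ((Cp * S) ^ (1 / p) * (Cq * S) ^ (1 / q')) := by
    intro j
    -- The heights are chosen so that their `p`-th and `q'`-th powers both equal `a i ^ r`, while
    -- their product is `a i ^ (r - 1)`.
    have h1 := hoff n (fun i => axisCube (z i) (l i)) (fun i => axisCube (z' i) (l i))
      (fun i => (F i j).indicator fun _ => ((a i ^ (r / p) : ℝ) : ℂ))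
      (fun i => (G i j).indicator fun _ => ((a i ^ (r / q') : ℝ) : ℂ)) hsep
      (fun i => memLinftyOn_indicator (hF i j).1 (hF i j).2 _)
      (fun i => memLinftyOn_indicator (hG i j).1 (hG i j).2 _)
    have h2 := eLpNorm_supNormSum_le (by linarith) (by positivity)
      (fun i => toReal_eLpNorm_top_indicator_const_le (F i j) (Real.rpow_nonneg (ha0 i) (r / p)))
      hQp
    have h3 := eLpNorm_supNormSum_le (by linarith) (by positivity)
      (fun i => toReal_eLpNorm_top_indicator_const_le (G i j) (Real.rpow_nonneg (ha0 i) (r / q')))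
      hQq
    have h4 := h1.trans (mul_le_mul' (mul_le_mul_right h2 _) h3)
    rw [← ENNReal.ofReal_mul hΘ, ← ENNReal.ofReal_mul (by positivity),
      ENNReal.ofReal_le_ofReal_iff (by positivity), mul_assoc] at h4
    refine le_trans (le_of_eq (Finset.sum_congr rfl fun i _ => ?_)) h4
    rw [commutatorForm_indicator (hF i j).1 (hG i j).1, norm_mul, norm_mul, Complex.norm_real,
      Complex.norm_real, Real.norm_of_nonneg (Real.rpow_nonneg (ha0 i) _),
      Real.norm_of_nonneg (Real.rpow_nonneg (ha0 i) _),
      ← Real.rpow_add_of_nonneg (ha0 i) (by positivity) (by positivity)]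
    congr 2
    have : r / p + r / q' = r * (1 / p + 1 / q') := by ring
    rw [this, hexp]
    field_simp
  have hcS : c * S ≤ 32 * 2 ^ k * (Θ * ((Cp * S) ^ (1 / p) * (Cq * S) ^ (1 / q'))) := by
    calc c * S = ∑ i, a i ^ (r - 1) * (c * (a i * l i ^ d)) := by
          rw [hS, Finset.mul_sum]
          refine Finset.sum_congr rfl fun i _ => ?_
          have : a i ^ r = a i ^ (r - 1) * a i := by
            rw [← Real.rpow_add_one' (ha0 i) (by linarith), sub_add_cancel]
          rw [this]
          ring
      _ ≤ ∑ i, a i ^ (r - 1) *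
            (8 * 2 ^ k * ∑ j, ‖commutatorSetForm K b k (F i j) (G i j)‖) :=
          Finset.sum_le_sum fun i _ =>
            mul_le_mul_of_nonneg_left (hal i) (Real.rpow_nonneg (ha0 i) _)
      _ = 8 * 2 ^ k *
            ∑ j, ∑ i, a i ^ (r - 1) * ‖commutatorSetForm K b k (F i j) (G i j)‖ := by
          rw [Finset.sum_comm, Finset.mul_sum]
          refine Finset.sum_congr rfl fun i _ => ?_
          rw [← Finset.mul_sum]
          ring
      _ ≤ 8 * 2 ^ k * ∑ _j : Fin 4, Θ * ((Cp * S) ^ (1 / p) * (Cq * S) ^ (1 / q')) := by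
          gcongr with j _
          exact hj j
      _ = _ := by
          rw [Finset.sum_const, Finset.card_univ, Fintype.card_fin, nsmul_eq_mul]
          push_cast
          ring
  rcases hS0.eq_or_lt with h0 | hSpos
  · rw [← h0]
    positivity
  -- `S` is a finite positive number, so its power can be divided out.
  have h5 : S ≤ C * Θ * S ^ (1 - 1 / r) := by
    rw [Real.mul_rpow hCp.le hS0, Real.mul_rpow hCq.le hS0] at hcS
    rw [← hexp, Real.rpow_add hSpos, hC]
    rw [← mul_le_mul_iff_right₀ hc]
    refine hcS.trans (le_of_eq ?_)
    field_simp
  have h6 : S ^ (1 / r) ≤ C * Θ := by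
    rw [Real.rpow_sub hSpos, Real.rpow_one, mul_div_assoc', le_div_iff₀ (by positivity)] at h5
    rw [mul_comm S] at h5
    exact le_of_mul_le_mul_right h5 hSpos
  calc S = (S ^ (1 / r)) ^ r := by
        rw [← Real.rpow_mul hS0, one_div_mul_cancel hr0.ne', Real.rpow_one]
    _ ≤ _ := Real.rpow_le_rpow (by positivity) h6 hr0.le

end SparseBound

/-! ### Dyadic cubes and the dyadic maximal inequality -/

section Dyadic

variable {d : ℕ}

/-- The index of the dyadic cube of generation `m` below the cube with corner `z` and side `L`
containing `x`. -/
noncomputable def dyadicIndex (z : RSpace d) (L : ℝ) (m : ℕ) (x : RSpace d) : Fin d → ℤ :=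
  fun i => ⌊(x i - z i) * 2 ^ m / L⌋

/-- The corner of a dyadic cube. -/
noncomputable def dyadicCorner (z : RSpace d) (L : ℝ) (m : ℕ) (n : Fin d → ℤ) : RSpace d :=
  WithLp.toLp 2 fun i => z i + L / 2 ^ m * n i

/-- The half-open dyadic cube of generation `m` and index `n`. -/
noncomputable def dyadicCell (z : RSpace d) (L : ℝ) (m : ℕ) (n : Fin d → ℤ) : Set (RSpace d) :=
  halfOpenCube (dyadicCorner z L m n) (L / 2 ^ m)

/-- The closed dyadic cube of generation `m` and index `n`. -/
noncomputable def dyadicCube (z : RSpace d) (L : ℝ) (m : ℕ) (n : Fin d → ℤ) : Set (RSpace d) :=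
  axisCube (dyadicCorner z L m n) (L / 2 ^ m)

variable {z : RSpace d} {L : ℝ}

lemma mem_dyadicCell (hL : 0 < L) {m : ℕ} {n : Fin d → ℤ} {x : RSpace d} :
    x ∈ dyadicCell z L m n ↔ dyadicIndex z L m x = n := by
  rw [funext_iff]
  refine forall_congr' fun i => ?_
  rw [dyadicIndex, Int.floor_eq_iff]
  have h2 : (0 : ℝ) < 2 ^ m := by positivity
  simp only [dyadicCorner]
  rw [le_div_iff₀ hL, div_lt_iff₀ hL]
  have e1 : L / 2 ^ m * (n i : ℝ) * 2 ^ m = n i * L := by field_simp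
  have e2 : L / 2 ^ m * 2 ^ m = L := by field_simp
  constructor
  · rintro ⟨h3, h4⟩
    constructor <;> nlinarith
  · rintro ⟨h3, h4⟩
    constructor
    · refine le_of_mul_le_mul_right ?_ h2
      nlinarith
    · refine lt_of_mul_lt_mul_right ?_ h2.le
      nlinarith

lemma dyadicIndex_succ_div (m : ℕ) (x : RSpace d) :
    dyadicIndex z L m x = fun i => dyadicIndex z L (m + 1) x i / 2 := by
  ext i
  simp only [dyadicIndex]
  have h := Int.floor_div_natCast ((x i - z i) * 2 ^ (m + 1) / L) 2
  rw [Nat.cast_ofNat, Nat.cast_ofNat] at h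
  rw [← h]
  congr 1
  rw [pow_succ]
  ring

lemma dyadicIndex_congr {m j : ℕ} (hj : j ≤ m) {x y : RSpace d}
    (h : dyadicIndex z L m x = dyadicIndex z L m y) :
    dyadicIndex z L j x = dyadicIndex z L j y := by
  induction m, hj using Nat.le_induction with
  | base => exact h
  | succ m _ ih =>
    refine ih ?_
    rw [dyadicIndex_succ_div, dyadicIndex_succ_div m y, h]

lemma dyadicCell_subset (hL : 0 < L) {m j : ℕ} (hj : j ≤ m) (x : RSpace d) :
    dyadicCell z L m (dyadicIndex z L m x) ⊆ dyadicCell z L j (dyadicIndex z L j x) :=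
  fun _ hy => (mem_dyadicCell hL).2 (dyadicIndex_congr hj ((mem_dyadicCell hL).1 hy))

lemma measurable_dyadicIndex (m : ℕ) : Measurable (dyadicIndex z L m) := by
  refine measurable_pi_lambda _ fun i => Int.measurable_floor.comp ?_
  fun_prop

lemma measurableSet_dyadicCell (m : ℕ) (n : Fin d → ℤ) : MeasurableSet (dyadicCell z L m n) :=
  measurableSet_halfOpenCube _ _

lemma dyadicCell_ae_eq (m : ℕ) (n : Fin d → ℤ) :
    dyadicCell z L m n =ᵐ[volume] dyadicCube z L m n := halfOpenCube_ae_eq _ _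

lemma volume_dyadicCell (hL : 0 < L) (m : ℕ) (n : Fin d → ℤ) :
    volume (dyadicCell z L m n) = ENNReal.ofReal ((L / 2 ^ m) ^ d) :=
  volume_halfOpenCube _ (by positivity)

lemma tsum_measure_inter_dyadicCell (hL : 0 < L) (μ : Measure (RSpace d)) (m : ℕ)
    {S : Set (RSpace d)} (hS : MeasurableSet S) :
    ∑' n, μ (S ∩ dyadicCell z L m n) = μ S := by
  rw [← measure_iUnion]
  · rw [← inter_iUnion]
    congr 1
    rw [inter_eq_left]
    exact fun x _ => mem_iUnion.2 ⟨_, (mem_dyadicCell hL).2 rfl⟩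
  · intro n n' hn
    refine disjoint_left.2 fun x hx hx' => hn ?_
    rw [← (mem_dyadicCell hL).1 hx.2, ← (mem_dyadicCell hL).1 hx'.2]
  · exact fun n => hS.inter (measurableSet_dyadicCell m n)

/-- The points of a dyadic cube for which some dyadic mean of `h`, over at most `N` further
generations, exceeds `t`. -/
def dyadicLevelSet (z : RSpace d) (L : ℝ) (h : RSpace d → ENNReal) (t : ENNReal) (N m : ℕ)
    (n : Fin d → ℤ) : Set (RSpace d) :=
  {x | x ∈ dyadicCell z L m n ∧ ∃ i ≤ N,
    t * volume (dyadicCell z L (m + i) (dyadicIndex z L (m + i) x)) <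
      ∫⁻ y in dyadicCell z L (m + i) (dyadicIndex z L (m + i) x), h y}

/-- Such a set is a union of cells of generation `N`, of which there are countably many. -/
lemma measurableSet_of_dyadicIndex {S : Set (RSpace d)} {N : ℕ}
    (hS : ∀ x y, dyadicIndex z L N x = dyadicIndex z L N y → x ∈ S → y ∈ S) :
    MeasurableSet S := by
  have : S = dyadicIndex z L N ⁻¹' (dyadicIndex z L N '' S) := by
    refine (subset_preimage_image _ _).antisymm ?_
    rintro y ⟨x, hx, hxy⟩
    exact hS x y hxy hx
  rw [this]
  exact measurable_dyadicIndex N (Set.to_countable _).measurableSet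

lemma measurableSet_dyadicLevelSet (hL : 0 < L) (h : RSpace d → ENNReal) (t : ENNReal) (N m : ℕ)
    (n : Fin d → ℤ) : MeasurableSet (dyadicLevelSet z L h t N m n) := by
  refine measurableSet_of_dyadicIndex (z := z) (L := L) (N := m + N) fun x y hxy hx => ?_
  obtain ⟨h1, i, hi, h2⟩ := hx
  rw [mem_dyadicCell hL] at h1
  refine ⟨(mem_dyadicCell hL).2 ?_, i, hi, ?_⟩
  · rw [← h1, dyadicIndex_congr (by omega : m ≤ m + N) hxy]
  · rwa [← dyadicIndex_congr (by omega : m + i ≤ m + N) hxy]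

/-- The weak type `(1,1)` inequality for the dyadic maximal function. -/
lemma mul_volume_dyadicLevelSet_le (hL : 0 < L) (h : RSpace d → ENNReal) (t : ENNReal) (N m : ℕ)
    (n : Fin d → ℤ) :
    t * volume (dyadicLevelSet z L h t N m n) ≤ ∫⁻ y in dyadicCell z L m n, h y := by
  induction N generalizing m n with
  | zero =>
    by_cases hne : (dyadicLevelSet z L h t 0 m n).Nonempty
    · obtain ⟨x, hx, i, hi, hlt⟩ := hne
      obtain rfl : i = 0 := by omega
      rw [add_zero, (mem_dyadicCell hL).1 hx] at hlt
      refine le_trans ?_ hlt.le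
      gcongr
      exact fun y hy => hy.1
    · rw [not_nonempty_iff_eq_empty.1 hne]
      simp
  | succ N ih =>
    -- If the top cell already exceeds the threshold it pays for everything. Otherwise the exceeding
    -- cube is strictly smaller, and the bounds on the children add up.
    by_cases htop : t * volume (dyadicCell z L m n) < ∫⁻ y in dyadicCell z L m n, h y
    · refine le_trans ?_ htop.le
      gcongr
      exact fun y hy => hy.1
    have hsub : ∀ n', dyadicLevelSet z L h t (N + 1) m n ∩ dyadicCell z L (m + 1) n' ⊆
        dyadicLevelSet z L h t N (m + 1) n' := by
      rintro n' x ⟨⟨hx, i, hi, hlt⟩, hx'⟩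
      refine ⟨hx', ?_⟩
      rcases i with _ | i
      · rw [add_zero, (mem_dyadicCell hL).1 hx] at hlt
        exact absurd hlt htop
      · refine ⟨i, by omega, ?_⟩
        rwa [show m + 1 + i = m + (i + 1) by omega]
    have hcell : ∀ n', (dyadicLevelSet z L h t (N + 1) m n ∩ dyadicCell z L (m + 1) n').Nonempty →
        dyadicCell z L (m + 1) n' ⊆ dyadicCell z L m n := by
      rintro n' ⟨x, ⟨hx, -⟩, hx'⟩
      rw [← (mem_dyadicCell hL).1 hx, ← (mem_dyadicCell hL).1 hx']
      exact dyadicCell_subset hL (by omega) x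
    have hterm : ∀ n', t * volume (dyadicLevelSet z L h t (N + 1) m n ∩ dyadicCell z L (m + 1) n') ≤
        (volume.withDensity h) (dyadicCell z L m n ∩ dyadicCell z L (m + 1) n') := by
      intro n'
      by_cases hne : (dyadicLevelSet z L h t (N + 1) m n ∩ dyadicCell z L (m + 1) n').Nonempty
      · rw [inter_eq_right.2 (hcell n' hne), withDensity_apply _ (measurableSet_dyadicCell _ _)]
        refine le_trans ?_ (ih (m + 1) n')
        gcongr
        exact hsub n'
      · rw [not_nonempty_iff_eq_empty.1 hne]
        simp
    calc t * volume (dyadicLevelSet z L h t (N + 1) m n)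
        = ∑' n', t * volume (dyadicLevelSet z L h t (N + 1) m n ∩ dyadicCell z L (m + 1) n') := by
          rw [ENNReal.tsum_mul_left, tsum_measure_inter_dyadicCell hL _ _
            (measurableSet_dyadicLevelSet hL _ _ _ _ _)]
      _ ≤ ∑' n', (volume.withDensity h) (dyadicCell z L m n ∩ dyadicCell z L (m + 1) n') :=
          ENNReal.tsum_le_tsum hterm
      _ = ∫⁻ y in dyadicCell z L m n, h y := by
          rw [tsum_measure_inter_dyadicCell hL _ _ (measurableSet_dyadicCell _ _),
            withDensity_apply _ (measurableSet_dyadicCell _ _)]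

end Dyadic

/-! ### The stopping time on dyadic oscillations -/

section Stopping

variable {d : ℕ} {z : RSpace d} {L : ℝ} {b : RSpace d → ℝ} {k : ℕ} {α : ℕ → (Fin d → ℤ) → ℝ}

/-- The mean oscillation of `b` on the dyadic cube of generation `m` containing `x`. -/
noncomputable def dyadicOsc (z : RSpace d) (L : ℝ) (b : RSpace d → ℝ) (k : ℕ)
    (α : ℕ → (Fin d → ℤ) → ℝ) (m : ℕ) (n : Fin d → ℤ) : ℝ :=
  meanOsc b k (dyadicCorner z L m n) (L / 2 ^ m) (α m n)

open Classical in
/-- The generation of the last stopping cube, among the dyadic cubes containing `x` of generation at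
most `m`. A cube stops if the mean of `|b - α_P|^k` over it exceeds twice that over the previous
stopping cube `P`. -/
noncomputable def stoppingLevel (z : RSpace d) (L : ℝ) (b : RSpace d → ℝ) (k : ℕ)
    (α : ℕ → (Fin d → ℤ) → ℝ) : ℕ → RSpace d → ℕ
  | 0, _ => 0
  | m + 1, x =>
    let j := stoppingLevel z L b k α m x
    if 2 * dyadicOsc z L b k α j (dyadicIndex z L j x) * (L / 2 ^ (m + 1)) ^ d <
        ∫ y in dyadicCube z L (m + 1) (dyadicIndex z L (m + 1) x),
          |b y - α j (dyadicIndex z L j x)| ^ k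
    then m + 1 else j

/-- The stopping condition relative to a cube of generation `j`. -/
def StopsBelow (z : RSpace d) (L : ℝ) (b : RSpace d → ℝ) (k : ℕ)
    (α : ℕ → (Fin d → ℤ) → ℝ) (j m : ℕ) (x : RSpace d) : Prop :=
  2 * dyadicOsc z L b k α j (dyadicIndex z L j x) * (L / 2 ^ m) ^ d <
    ∫ y in dyadicCube z L m (dyadicIndex z L m x), |b y - α j (dyadicIndex z L j x)| ^ k

lemma stoppingLevel_succ_of_stopsBelow {m : ℕ} {x : RSpace d}
    (h : StopsBelow z L b k α (stoppingLevel z L b k α m x) (m + 1) x) :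
    stoppingLevel z L b k α (m + 1) x = m + 1 := if_pos h

lemma stoppingLevel_succ_of_not_stopsBelow {m : ℕ} {x : RSpace d}
    (h : ¬ StopsBelow z L b k α (stoppingLevel z L b k α m x) (m + 1) x) :
    stoppingLevel z L b k α (m + 1) x = stoppingLevel z L b k α m x := if_neg h

lemma stoppingLevel_le (m : ℕ) (x : RSpace d) : stoppingLevel z L b k α m x ≤ m := by
  induction m with
  | zero => exact le_rfl
  | succ m ih =>
    by_cases h : StopsBelow z L b k α (stoppingLevel z L b k α m x) (m + 1) x
    · rw [stoppingLevel_succ_of_stopsBelow h]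
    · rw [stoppingLevel_succ_of_not_stopsBelow h]
      omega

lemma stoppingLevel_congr {m : ℕ} {x y : RSpace d}
    (h : dyadicIndex z L m x = dyadicIndex z L m y) :
    stoppingLevel z L b k α m x = stoppingLevel z L b k α m y := by
  induction m with
  | zero => rfl
  | succ m ih =>
    have h1 := ih (dyadicIndex_congr (by omega) h)
    have h2 : StopsBelow z L b k α (stoppingLevel z L b k α m x) (m + 1) x ↔
        StopsBelow z L b k α (stoppingLevel z L b k α m y) (m + 1) y := by
      rw [StopsBelow, StopsBelow, h, h1,
        dyadicIndex_congr ((stoppingLevel_le m y).trans (Nat.le_succ m)) h]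
    by_cases h3 : StopsBelow z L b k α (stoppingLevel z L b k α m x) (m + 1) x
    · rw [stoppingLevel_succ_of_stopsBelow h3, stoppingLevel_succ_of_stopsBelow (h2.1 h3)]
    · rw [stoppingLevel_succ_of_not_stopsBelow h3,
        stoppingLevel_succ_of_not_stopsBelow (mt h2.2 h3), h1]

lemma stoppingLevel_eq_of_le {m N : ℕ} (hmN : m ≤ N) {x : RSpace d}
    (hm : stoppingLevel z L b k α N x ≤ m) :
    stoppingLevel z L b k α m x = stoppingLevel z L b k α N x := by
  induction N, hmN using Nat.le_induction with
  | base => rfl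
  | succ N hN ih =>
    by_cases h : StopsBelow z L b k α (stoppingLevel z L b k α N x) (N + 1) x
    · rw [stoppingLevel_succ_of_stopsBelow h] at hm
      omega
    · rw [stoppingLevel_succ_of_not_stopsBelow h] at hm ⊢
      exact ih hm

lemma dyadicOsc_nonneg (hL : 0 < L) (m : ℕ) (n : Fin d → ℤ) : 0 ≤ dyadicOsc z L b k α m n :=
  meanOsc_nonneg _ _ _ (by positivity) _

lemma dyadicOsc_mul (hL : 0 < L) (m : ℕ) (n : Fin d → ℤ) :
    dyadicOsc z L b k α m n * (L / 2 ^ m) ^ d = ∫ y in dyadicCube z L m n, |b y - α m n| ^ k :=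
  div_mul_cancel₀ _ (by positivity)

/-- Either the cube has just stopped and is compared with itself, or the stopping condition failed
on it. -/
lemma integral_stopping_le (hL : 0 < L) (m : ℕ) (x : RSpace d) :
    ∫ y in dyadicCube z L m (dyadicIndex z L m x), |b y - α (stoppingLevel z L b k α m x)
        (dyadicIndex z L (stoppingLevel z L b k α m x) x)| ^ k ≤
      2 * dyadicOsc z L b k α (stoppingLevel z L b k α m x)
        (dyadicIndex z L (stoppingLevel z L b k α m x) x) * (L / 2 ^ m) ^ d := by
  have hself : ∀ m, ∫ y in dyadicCube z L m (dyadicIndex z L m x),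
      |b y - α m (dyadicIndex z L m x)| ^ k ≤
      2 * dyadicOsc z L b k α m (dyadicIndex z L m x) * (L / 2 ^ m) ^ d := by
    intro m
    rw [← dyadicOsc_mul hL]
    have : 0 ≤ dyadicOsc z L b k α m (dyadicIndex z L m x) * (L / 2 ^ m) ^ d :=
      mul_nonneg (dyadicOsc_nonneg hL _ _) (by positivity)
    linarith
  cases m with
  | zero => exact hself 0
  | succ m =>
    by_cases h : StopsBelow z L b k α (stoppingLevel z L b k α m x) (m + 1) x
    · rw [stoppingLevel_succ_of_stopsBelow h]
      exact hself (m + 1)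
    · rw [stoppingLevel_succ_of_not_stopsBelow h]
      exact not_lt.1 h

lemma setIntegral_dyadicCube_mono (hL : 0 < L) {f : RSpace d → ℝ} (hf0 : ∀ x, 0 ≤ f x)
    {j m : ℕ} (hj : j ≤ m) (x : RSpace d)
    (hf : IntegrableOn f (dyadicCube z L j (dyadicIndex z L j x))) :
    ∫ y in dyadicCube z L m (dyadicIndex z L m x), f y ≤
      ∫ y in dyadicCube z L j (dyadicIndex z L j x), f y := by
  refine setIntegral_mono_set hf (ae_of_all _ hf0) ?_
  exact (dyadicCell_ae_eq m _).symm.le.trans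
    ((LE.le.eventuallyLE (dyadicCell_subset hL hj x)).trans (dyadicCell_ae_eq j _).le)

end Stopping

/-! ### Sparse domination of dyadic medians -/

section SparseDomination

variable {d : ℕ} {z : RSpace d} {L : ℝ} {b : RSpace d → ℝ} {k : ℕ} {α : ℕ → (Fin d → ℤ) → ℝ}

lemma integrableOn_abs_sub_pow_axisCube (hb : Measurable b)
    (hbi : ∀ z l, IntegrableOn (fun x => |b x| ^ k) (axisCube z l)) (z : RSpace d) (l c : ℝ) :
    IntegrableOn (fun x => |b x - c| ^ k) (axisCube z l) := by
  have : IsFiniteMeasure (volume.restrict (axisCube z l)) :=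
    ⟨by simpa using (isCompact_axisCube z l).measure_lt_top⟩
  exact integrable_abs_sub_pow hb (hbi z l) c

lemma IsMedian.abs_sub_pow_mul_le_axisCube (hb : Measurable b)
    (hbi : ∀ z l, IntegrableOn (fun x => |b x| ^ k) (axisCube z l)) {z : RSpace d} {l β : ℝ}
    (hl : 0 ≤ l) (hβ : IsMedian (volume.restrict (axisCube z l)) b β) (c : ℝ) :
    |β - c| ^ k * l ^ d ≤ 2 * ∫ x in axisCube z l, |b x - c| ^ k := by
  have : IsFiniteMeasure (volume.restrict (axisCube z l)) :=
    ⟨by simpa using (isCompact_axisCube z l).measure_lt_top⟩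
  have h := hβ.abs_sub_pow_mul_le hb (hbi z l) c
  rwa [measureReal_restrict_apply_univ, measureReal_def, volume_axisCube z hl,
    ENNReal.toReal_ofReal (by positivity)] at h

/-- Using `M ^ (1 / k) ≤ M` keeps the constant free of `k`. -/
lemma le_mul_rpow_of_pow_le {t M a : ℝ} (ht : 0 ≤ t) (hM : 1 ≤ M) (ha : 0 ≤ a) (hk : 1 ≤ k)
    (h : t ^ k ≤ M * a) : t ≤ M * a ^ (1 / (k : ℝ)) := by
  have hk0 : (k : ℝ) ≠ 0 := by positivity
  calc t = (t ^ k) ^ (1 / (k : ℝ)) := by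
        rw [← Real.rpow_natCast, ← Real.rpow_mul ht, mul_one_div_cancel hk0, Real.rpow_one]
    _ ≤ (M * a) ^ (1 / (k : ℝ)) := Real.rpow_le_rpow (by positivity) h (by positivity)
    _ = M ^ (1 / (k : ℝ)) * a ^ (1 / (k : ℝ)) := Real.mul_rpow (by linarith) ha
    _ ≤ M * a ^ (1 / (k : ℝ)) := by
        gcongr
        refine Real.rpow_le_self_of_one_le hM ?_
        rw [div_le_one (by positivity)]
        exact_mod_cast hk

lemma abs_median_sub_le (hb : Measurable b)
    (hbi : ∀ z l, IntegrableOn (fun x => |b x| ^ k) (axisCube z l)) (hk : 1 ≤ k) (hL : 0 < L)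
    (hα : ∀ m n, IsMedian (volume.restrict (dyadicCube z L m n)) b (α m n)) (N : ℕ)
    (x : RSpace d) :
    |α N (dyadicIndex z L N x) - α 0 (dyadicIndex z L 0 x)| ≤
      4 * 2 ^ d * ∑ j ∈ Finset.range (N + 1) with stoppingLevel z L b k α j x = j,
        dyadicOsc z L b k α j (dyadicIndex z L j x) ^ (1 / (k : ℝ)) := by
  set A : ℕ → ℝ := fun j => α j (dyadicIndex z L j x) with hA
  set s : ℕ → ℕ := fun j => stoppingLevel z L b k α j x with hs
  set a : ℕ → ℝ := fun j => dyadicOsc z L b k α j (dyadicIndex z L j x) with ha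
  set u : ℕ → ℝ := fun j => a j ^ (1 / (k : ℝ)) with hu
  have ha0 : ∀ j, 0 ≤ a j := fun j => dyadicOsc_nonneg hL _ _
  have hu0 : ∀ j, 0 ≤ u j := fun j => Real.rpow_nonneg (ha0 j) _
  have h2d : (1 : ℝ) ≤ 2 ^ d := one_le_pow₀ one_le_two
  have hmed : ∀ m c, |A m - c| ^ k * (L / 2 ^ m) ^ d ≤
      2 * ∫ y in dyadicCube z L m (dyadicIndex z L m x), |b y - c| ^ k := fun m c =>
    (hα m _).abs_sub_pow_mul_le_axisCube hb hbi (by positivity) c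
  have hmean : ∀ m, ∫ y in dyadicCube z L m (dyadicIndex z L m x), |b y - A (s m)| ^ k ≤
      2 * a (s m) * (L / 2 ^ m) ^ d := fun m => integral_stopping_le hL m x
  have hsame : ∀ m, |A m - A (s m)| ≤ 4 * 2 ^ d * u (s m) := by
    intro m
    refine le_mul_rpow_of_pow_le (abs_nonneg _) (by linarith) (ha0 _) hk ?_
    have hpos : (0 : ℝ) < (L / 2 ^ m) ^ d := by positivity
    refine le_of_mul_le_mul_right ?_ hpos
    have h1 := hmed m (A (s m))
    have h2 := hmean m
    have h3 : 0 ≤ a (s m) * (L / 2 ^ m) ^ d := mul_nonneg (ha0 _) hpos.le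
    nlinarith
  -- The next cube may have stopped, but its parent still satisfies the non-stopping bound; passing
  -- to the child costs `2 ^ d`.
  have hnext : ∀ m, |A (m + 1) - A (s m)| ≤ 4 * 2 ^ d * u (s m) := by
    intro m
    refine le_mul_rpow_of_pow_le (abs_nonneg _) (by linarith) (ha0 _) hk ?_
    have hpos : (0 : ℝ) < (L / 2 ^ (m + 1)) ^ d := by positivity
    refine le_of_mul_le_mul_right ?_ hpos
    have h1 := hmed (m + 1) (A (s m))
    have h2 := hmean m
    have h3 := setIntegral_dyadicCube_mono (z := z) hL (f := fun y => |b y - A (s m)| ^ k)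
      (fun y => by positivity) (Nat.le_succ m) x
      (integrableOn_abs_sub_pow_axisCube hb hbi _ _ _)
    have h4 : (L / 2 ^ m) ^ d = 2 ^ d * (L / 2 ^ (m + 1)) ^ d := by
      rw [← mul_pow]
      congr 1
      rw [pow_succ]
      field_simp
    rw [h4] at h2
    calc |A (m + 1) - A (s m)| ^ k * (L / 2 ^ (m + 1)) ^ d
        ≤ 2 * (2 * a (s m) * (2 ^ d * (L / 2 ^ (m + 1)) ^ d)) := by linarith
      _ = _ := by ring
  -- The spare term on the left pays for the jump to the next stopping cube, or at the end for the
  -- jump from the last stopping cube to generation `N`.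
  have hind : ∀ m, |A (s m) - A 0| + 4 * 2 ^ d * u (s m) ≤
      4 * 2 ^ d * ∑ j ∈ Finset.range (m + 1) with s j = j, u j := by
    intro m
    induction m with
    | zero =>
      have h0 : s 0 = 0 := rfl
      simp [Finset.sum_filter, h0]
    | succ m ih =>
      rw [Finset.range_add_one, Finset.filter_insert]
      by_cases h : StopsBelow z L b k α (stoppingLevel z L b k α m x) (m + 1) x
      · have h1 : s (m + 1) = m + 1 := stoppingLevel_succ_of_stopsBelow h
        rw [if_pos h1, h1, Finset.sum_insert (by simp), mul_add]
        have h2 := abs_sub_le (A (m + 1)) (A (s m)) (A 0)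
        linarith [hnext m]
      · have h1 : s (m + 1) = s m := stoppingLevel_succ_of_not_stopsBelow h
        have h2 : s m ≤ m := stoppingLevel_le m x
        rw [h1, if_neg (by omega)]
        exact ih
  have h1 := abs_sub_le (A N) (A (s N)) (A 0)
  linarith [hind N, hsame N]

/-- The part of a stopping cube that is not covered by later stopping cubes. -/
def stoppingMajorSet (z : RSpace d) (L : ℝ) (b : RSpace d → ℝ) (k : ℕ)
    (α : ℕ → (Fin d → ℤ) → ℝ) (N j : ℕ) (n : Fin d → ℤ) : Set (RSpace d) :=
  {x | x ∈ dyadicCell z L j n ∧ stoppingLevel z L b k α N x = j}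

lemma measurableSet_stoppingMajorSet (hL : 0 < L) {N j : ℕ} (hj : j ≤ N) (n : Fin d → ℤ) :
    MeasurableSet (stoppingMajorSet z L b k α N j n) := by
  refine measurableSet_of_dyadicIndex (z := z) (L := L) (N := N) fun x y hxy hx => ?_
  refine ⟨(mem_dyadicCell hL).2 ?_, ?_⟩
  · rw [← (mem_dyadicCell hL).1 hx.1, dyadicIndex_congr hj hxy]
  · rw [← hx.2, stoppingLevel_congr hxy]

/-- Leaving the stopping cube requires a dyadic mean above twice its own mean; by the weak type
inequality this happens on at most half of it. -/
lemma volume_le_two_mul_stoppingMajorSet (hb : Measurable b)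
    (hbi : ∀ z l, IntegrableOn (fun x => |b x| ^ k) (axisCube z l)) (hL : 0 < L)
    {N j : ℕ} (hj : j ≤ N) {n : Fin d → ℤ} {x₀ : RSpace d} (hx₀ : dyadicIndex z L j x₀ = n)
    (hs : stoppingLevel z L b k α j x₀ = j) :
    volume (dyadicCell z L j n) ≤ 2 * volume (stoppingMajorSet z L b k α N j n) := by
  set a := dyadicOsc z L b k α j n with ha
  have ha0 : 0 ≤ a := dyadicOsc_nonneg hL _ _
  set h : RSpace d → ENNReal := fun y => ENNReal.ofReal (|b y - α j n| ^ k) with hh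
  have hlint : ∀ m n', ∫⁻ y in dyadicCell z L m n', h y =
      ENNReal.ofReal (∫ y in dyadicCube z L m n', |b y - α j n| ^ k) := by
    intro m n'
    have hi : IntegrableOn (fun y => |b y - α j n| ^ k) (dyadicCube z L m n') :=
      integrableOn_abs_sub_pow_axisCube hb hbi _ _ _
    rw [Measure.restrict_congr_set (dyadicCell_ae_eq m n'),
      ofReal_integral_eq_lintegral_ofReal hi (ae_of_all _ fun y => by positivity)]
  set B := dyadicLevelSet z L h (ENNReal.ofReal (2 * a)) (N - j) j n with hB
  have hlevel : ∀ x ∈ dyadicCell z L j n, ∀ m, j ≤ m → m ≤ N → StopsBelow z L b k α j m x →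
      x ∈ B := by
    intro x hx m hjm hmN hst
    refine ⟨hx, m - j, by omega, ?_⟩
    rw [Nat.add_sub_cancel' hjm, hlint, volume_dyadicCell hL,
      ← ENNReal.ofReal_mul (by positivity)]
    rw [StopsBelow, (mem_dyadicCell hL).1 hx] at hst
    exact (ENNReal.ofReal_lt_ofReal_iff_of_nonneg
      (mul_nonneg (by linarith) (by positivity))).2 hst
  have hcover : dyadicCell z L j n ⊆ B ∪ stoppingMajorSet z L b k α N j n := by
    intro x hx
    by_cases hxs : stoppingLevel z L b k α N x = j
    · exact Or.inr ⟨hx, hxs⟩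
    left
    have hxj : stoppingLevel z L b k α j x = j := by
      rw [stoppingLevel_congr (((mem_dyadicCell hL).1 hx).trans hx₀.symm), hs]
    by_contra hxB
    apply hxs
    clear hxs
    have key : ∀ m, j ≤ m → m ≤ N → stoppingLevel z L b k α m x = j := by
      intro m hjm
      induction m, hjm using Nat.le_induction with
      | base => exact fun _ => hxj
      | succ m hjm ih =>
        intro hmN
        have h1 := ih (by omega)
        rw [stoppingLevel_succ_of_not_stopsBelow, h1]
        rw [h1]
        exact fun hst => hxB (hlevel x hx (m + 1) (by omega) hmN hst)
    exact key N hj le_rfl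
  have hBvol : 2 * volume B ≤ volume (dyadicCell z L j n) := by
    have hweak := mul_volume_dyadicLevelSet_le (z := z) hL h (ENNReal.ofReal (2 * a)) (N - j) j n
    have hfull : ∫⁻ y in dyadicCell z L j n, h y =
        ENNReal.ofReal a * volume (dyadicCell z L j n) := by
      rw [hlint, ← dyadicOsc_mul hL, ENNReal.ofReal_mul ha0, volume_dyadicCell hL]
    rw [← hB, hfull] at hweak
    rcases ha0.eq_or_lt with h0 | hpos
    -- At threshold zero the weak type inequality says nothing, but then the integrand has zero
    -- integral on the whole cube and no mean exceeds zero.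
    · have : B = ∅ := by
        refine eq_empty_of_forall_notMem fun x hx => ?_
        obtain ⟨hx1, i, -, hlt⟩ := hx
        have h1 : ∫⁻ y in dyadicCell z L (j + i) (dyadicIndex z L (j + i) x), h y ≤
            ∫⁻ y in dyadicCell z L j n, h y := by
          refine lintegral_mono_set ?_
          rw [← (mem_dyadicCell hL).1 hx1]
          exact dyadicCell_subset hL (by omega) x
        rw [hfull, ← h0] at h1
        rw [← h0] at hlt
        simp at h1 hlt
        exact hlt.ne' h1
      rw [this]
      simp
    · rw [mul_comm 2 a, ENNReal.ofReal_mul ha0, mul_assoc, ENNReal.ofReal_ofNat] at hweak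
      exact (ENNReal.mul_le_mul_iff_right (by simpa using hpos) ENNReal.ofReal_ne_top).1 hweak
  have hfin : volume (dyadicCell z L j n) ≠ ⊤ := by
    rw [volume_dyadicCell hL]; exact ENNReal.ofReal_ne_top
  have h1 := (measure_mono hcover).trans (measure_union_le (μ := volume) _ _)
  refine (ENNReal.add_le_add_iff_left hfin).1 ?_
  calc volume (dyadicCell z L j n) + volume (dyadicCell z L j n)
      = 2 * volume (dyadicCell z L j n) := (two_mul _).symm
    _ ≤ 2 * (volume B + volume (stoppingMajorSet z L b k α N j n)) := by gcongr
    _ = 2 * volume B + 2 * volume (stoppingMajorSet z L b k α N j n) := mul_add _ _ _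
    _ ≤ _ := by gcongr

/-- The differences of dyadic medians are dominated by a sparse sum of mean oscillations. -/
lemma exists_sparse_domination (hb : Measurable b)
    (hbi : ∀ z l, IntegrableOn (fun x => |b x| ^ k) (axisCube z l)) (hk : 1 ≤ k) (hL : 0 < L)
    (hα : ∀ m n, IsMedian (volume.restrict (dyadicCube z L m n)) b (α m n)) (N : ℕ) :
    ∃ (M : ℕ) (w : Fin M → RSpace d) (l : Fin M → ℝ) (E : Fin M → Set (RSpace d)) (β : Fin M → ℝ),
      IsSparse w l E ∧ (∀ i, IsMedian (volume.restrict (axisCube (w i) (l i))) b (β i)) ∧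
      ∀ x ∈ dyadicCell z L 0 0, |α N (dyadicIndex z L N x) - α 0 0| ≤
        4 * 2 ^ d * ∑ i, (axisCube (w i) (l i)).indicator
          (fun _ => meanOsc b k (w i) (l i) (β i) ^ (1 / (k : ℝ))) x := by
  classical
  -- All stopping cubes of generation at most `N` inside the initial cube; truncating the
  -- generations keeps the family finite.
  set T : Set (ℕ × (Fin d → ℤ)) := {t | t.1 ≤ N ∧ ∃ x ∈ dyadicCell z L 0 0,
    dyadicIndex z L t.1 x = t.2 ∧ stoppingLevel z L b k α t.1 x = t.1} with hT
  have hTfin : T.Finite := by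
    refine ((finite_Iic N).prod (finite_Icc (0 : Fin d → ℤ) fun _ => 2 ^ N)).subset ?_
    rintro ⟨j, n⟩ ⟨hj, x, hx, hn, -⟩
    have hj' : j ≤ N := hj
    refine ⟨hj', ?_⟩
    dsimp only at hn ⊢
    have hx0 : ∀ i, 0 ≤ x i - z i ∧ x i - z i < L := by
      intro i
      have := hx i
      simp only [dyadicCorner, Pi.zero_apply, Int.cast_zero, mul_zero, add_zero, pow_zero,
        div_one] at this
      constructor <;> linarith
    rw [← hn]
    have h2 : (0 : ℝ) < 2 ^ j := by positivity
    constructor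
    · intro i
      refine Int.floor_nonneg.2 ?_
      have := (hx0 i).1
      positivity
    · intro i
      have h3 : (x i - z i) * 2 ^ j / L ≤ ((2 ^ j : ℤ) : ℝ) := by
        rw [div_le_iff₀ hL]
        push_cast
        nlinarith [(hx0 i).2]
      have h4 : dyadicIndex z L j x i ≤ 2 ^ j := by
        have := Int.floor_le_floor h3
        rwa [Int.floor_intCast] at this
      exact h4.trans (pow_le_pow_right₀ (by norm_num) hj')
  set e := hTfin.toFinset.equivFin with he
  set M := hTfin.toFinset.card with hM
  set τ : Fin M → ℕ × (Fin d → ℤ) := fun i => (e.symm i).1 with hτ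
  have hτT : ∀ i, τ i ∈ T := fun i => hTfin.mem_toFinset.1 (e.symm i).2
  have hτinj : Function.Injective τ := Subtype.val_injective.comp e.symm.injective
  refine ⟨M, fun i => dyadicCorner z L (τ i).1 (τ i).2, fun i => L / 2 ^ (τ i).1,
    fun i => stoppingMajorSet z L b k α N (τ i).1 (τ i).2, fun i => α (τ i).1 (τ i).2,
    ⟨fun i => by positivity, fun i => measurableSet_stoppingMajorSet hL (hτT i).1 _, ?_, ?_, ?_⟩,
    fun i => hα _ _, ?_⟩
  · exact fun i x hx => halfOpenCube_subset _ _ hx.1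
  · intro i j hij
    refine disjoint_left.2 fun x hx hx' => hij (hτinj ?_)
    have h1 : (τ i).1 = (τ j).1 := by rw [← hx.2, ← hx'.2]
    refine Prod.ext h1 ?_
    rw [← (mem_dyadicCell hL).1 hx.1, ← (mem_dyadicCell hL).1 hx'.1, h1]
  · intro i
    obtain ⟨h1, x, -, h2, h3⟩ := hτT i
    rw [← volume_dyadicCell hL (z := z) (τ i).1 (τ i).2]
    exact volume_le_two_mul_stoppingMajorSet hb hbi hL h1 h2 h3
  · intro x hx
    have h0 : dyadicIndex z L 0 x = 0 := (mem_dyadicCell hL).1 hx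
    have hmain := abs_median_sub_le hb hbi hk hL hα N x
    rw [h0] at hmain
    refine hmain.trans ?_
    gcongr
    set v : ℕ × (Fin d → ℤ) → ℝ := fun t => (dyadicCube z L t.1 t.2).indicator
      (fun _ => dyadicOsc z L b k α t.1 t.2 ^ (1 / (k : ℝ))) x with hv
    have hv0 : ∀ t, 0 ≤ v t := fun t =>
      indicator_nonneg (fun _ _ => Real.rpow_nonneg (dyadicOsc_nonneg hL _ _) _) x
    have hR : ∑ i, v (τ i) = ∑ t ∈ hTfin.toFinset, v t := by
      rw [← Finset.sum_coe_sort hTfin.toFinset]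
      exact Equiv.sum_comp e.symm fun t : hTfin.toFinset => v t.1
    set I := (Finset.range (N + 1)).filter fun j => stoppingLevel z L b k α j x = j with hI
    have hL' : ∑ j ∈ I, dyadicOsc z L b k α j (dyadicIndex z L j x) ^ (1 / (k : ℝ)) =
        ∑ t ∈ I.image fun j => (j, dyadicIndex z L j x), v t := by
      rw [Finset.sum_image fun a _ c _ hac => (Prod.ext_iff.1 hac).1]
      refine Finset.sum_congr rfl fun j _ => ?_
      simp only [hv]
      rw [indicator_of_mem]
      exact halfOpenCube_subset _ _ ((mem_dyadicCell hL).2 rfl)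
    rw [hL']
    refine le_trans (Finset.sum_le_sum_of_subset_of_nonneg ?_ fun t _ _ => hv0 t) hR.ge
    intro t ht
    obtain ⟨j, hj, rfl⟩ := Finset.mem_image.1 ht
    obtain ⟨hj1, hj2⟩ := Finset.mem_filter.1 hj
    exact hTfin.mem_toFinset.2 ⟨by simpa [Nat.lt_succ_iff] using hj1, x, hx, rfl, hj2⟩

end SparseDomination

/-! ### Passage to the limit and to the whole space -/

section Global

variable {d : ℕ} {b : RSpace d → ℝ} {k : ℕ}

lemma commutatorForm_congr_ae {K : RSpace d → RSpace d → ℂ} {b' : RSpace d → ℝ}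
    (h : b =ᵐ[volume] b') (f g : RSpace d → ℂ) :
    commutatorForm K b k f g = commutatorForm K b' k f g := by
  refine integral_congr_ae ?_
  filter_upwards [h] with x hx
  refine integral_congr_ae ?_
  filter_upwards [h] with y hy
  simp only [hx, hy]

lemma OffSupportSummedBound.congr_ae {K : RSpace d → RSpace d → ℂ} {b' : RSpace d → ℝ}
    {p q γ Θ : ℝ} (hoff : OffSupportSummedBound K b k p q γ Θ) (h : b =ᵐ[volume] b') :
    OffSupportSummedBound K b' k p q γ Θ := by
  intro N Q Q' f g hQ hf hg
  have := hoff N Q Q' f g hQ hf hg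
  simpa only [commutatorForm_congr_ae h] using this

lemma MemLkLoc.congr_ae {b' : RSpace d → ℝ} (hb : MemLkLoc b k) (h : b =ᵐ[volume] b') :
    MemLkLoc b' k :=
  fun s hs => (hb s hs).ae_eq (ae_restrict_of_ae h)

lemma MemLkLoc.integrableOn_abs_pow (hb : MemLkLoc b k) (hk : 1 ≤ k) (z : RSpace d) (l : ℝ) :
    IntegrableOn (fun x => |b x| ^ k) (axisCube z l) :=
  (hb _ (isCompact_axisCube z l)).integrable_norm_pow (by omega)

lemma MemLkLoc.locallyIntegrable (hb : MemLkLoc b k) (hk : 1 ≤ k) :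
    LocallyIntegrable b volume := by
  refine (locallyIntegrable_iff).2 fun s hs => ?_
  have : IsFiniteMeasure (volume.restrict s) := ⟨by simpa using hs.measure_lt_top⟩
  exact memLp_one_iff_integrable.1 ((hb s hs).mono_exponent (by exact_mod_cast hk))

/-- By the median inequality with exponent `1`, the distance from the median to `b x` is at most
twice the mean of `|b - b x|` over the cube, which tends to zero at Lebesgue points. -/
lemma ae_tendsto_dyadic_median (hd : 1 ≤ d) (hb : Measurable b)
    (hbi : LocallyIntegrable b volume) {z : RSpace d} {L : ℝ} (hL : 0 < L)
    {α : ℕ → (Fin d → ℤ) → ℝ}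
    (hα : ∀ m n, IsMedian (volume.restrict (dyadicCube z L m n)) b (α m n)) :
    ∀ᵐ x, Tendsto (fun N => α N (dyadicIndex z L N x)) atTop (𝓝 (b x)) := by
  have hdpos : (0 : ℝ) < d := by exact_mod_cast hd
  set v := (volume : Measure (RSpace d)).real (Metric.ball 0 1) with hv
  have hδ : Tendsto (fun N : ℕ => d * (L / 2 ^ N)) atTop (𝓝[>] 0) := by
    refine tendsto_nhdsWithin_iff.2 ⟨?_, Eventually.of_forall fun N => ?_⟩
    · have h1 : Tendsto (fun N : ℕ => d * L * (1 / 2) ^ N) atTop (𝓝 (d * L * 0)) :=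
        (tendsto_pow_atTop_nhds_zero_of_lt_one (by norm_num) (by norm_num)).const_mul _
      rw [mul_zero] at h1
      refine h1.congr fun N => ?_
      rw [one_div, inv_pow]
      ring
    · simp only [mem_Ioi]
      positivity
  have hb1 : ∀ z l, IntegrableOn (fun x => |b x| ^ 1) (axisCube z l) := fun z l => by
    simp only [pow_one]
    exact (hbi.integrableOn_isCompact (isCompact_axisCube z l)).abs
  filter_upwards [IsUnifLocDoublingMeasure.ae_tendsto_average_norm_sub
    (volume : Measure (RSpace d)) hbi 1] with x hx
  have hx' := hx (fun _ : ℕ => x) _ hδ (Eventually.of_forall fun N => by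
    simp only [one_mul]
    exact Metric.mem_closedBall_self (by positivity))
  rw [tendsto_iff_norm_sub_tendsto_zero]
  have hlim := hx'.const_mul (2 * (d ^ d * v))
  rw [mul_zero] at hlim
  refine squeeze_zero (fun _ => norm_nonneg _) (fun N => ?_) hlim
  set l := L / 2 ^ N with hl
  have hl0 : 0 < l := by positivity
  have hvol : (volume : Measure (RSpace d)).real (Metric.closedBall x (d * l)) =
      d ^ d * v * l ^ d := by
    rw [measureReal_def, Measure.addHaar_closedBall _ _ (by positivity), finrank_euclideanSpace_fin,
      ENNReal.toReal_mul, ENNReal.toReal_ofReal (by positivity), hv, measureReal_def, mul_pow]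
    ring
  have hball : IntegrableOn (fun y => ‖b y - b x‖) (Metric.closedBall x (d * l)) :=
    ((hbi.integrableOn_isCompact (isCompact_closedBall x (d * l))).sub
      (integrableOn_const measure_closedBall_lt_top.ne)).norm
  have hsub : dyadicCube z L N (dyadicIndex z L N x) ⊆ Metric.closedBall x (d * l) := by
    intro y hy
    rw [Metric.mem_closedBall, dist_eq_norm]
    exact norm_sub_le_of_mem_axisCube hy (halfOpenCube_subset _ _ ((mem_dyadicCell hL).2 rfl))
  have h1 := (hα N (dyadicIndex z L N x)).abs_sub_pow_mul_le_axisCube (k := 1) hb hb1 hl0.le (b x)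
  simp only [pow_one] at h1
  have h2 : ∫ y in dyadicCube z L N (dyadicIndex z L N x), |b y - b x| ≤
      ∫ y in Metric.closedBall x (d * l), ‖b y - b x‖ :=
    setIntegral_mono_set hball (ae_of_all _ fun y => norm_nonneg (b y - b x))
      (LE.le.eventuallyLE hsub)
  rw [Real.norm_eq_abs, setAverage_eq, hvol, smul_eq_mul]
  have hld : 0 < l ^ d := by positivity
  refine le_of_mul_le_mul_right ?_ hld
  have hv0 : 0 < v := ENNReal.toReal_pos (Metric.measure_ball_pos _ _ one_pos).ne'
    measure_ball_lt_top.ne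
  calc |α N (dyadicIndex z L N x) - b x| * l ^ d
      ≤ 2 * ∫ y in dyadicCube z L N (dyadicIndex z L N x), |b y - b x| := h1
    _ ≤ 2 * ∫ y in Metric.closedBall x (d * l), ‖b y - b x‖ := by linarith
    _ = _ := by field_simp

/-- Uniform `L^{rk}` control of `b` modulo constants on all cubes. -/
lemma HasNearlyConstantPairs.exists_lintegral_cube_le {K : RSpace d → RSpace d → ℂ}
    (hK : HasNearlyConstantPairs K) (hd : 1 ≤ d) (hk : 1 ≤ k) {p q r γ : ℝ}
    (hq : 1 < q) (hqp : q < p) (hr : r = p * q / (p - q)) (hγ : 0 < γ) :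
    ∃ C : ℝ, 0 < C ∧ ∀ (b : RSpace d → ℝ) (Θ : ℝ), Measurable b → MemLkLoc b k → 0 ≤ Θ →
      OffSupportSummedBound K b k p q γ Θ → ∀ (z : RSpace d) (L : ℝ), 0 < L →
      ∃ c : ℝ, ∫⁻ x in halfOpenCube z L, ENNReal.ofReal (|b x - c| ^ (r * k)) ≤
        ENNReal.ofReal ((C * Θ) ^ r) := by
  have hr1 : 1 < r := by rw [hr, lt_div_iff₀ (by linarith)]; nlinarith
  have hk1 : (1 : ℝ) ≤ k := by exact_mod_cast hk
  have hs1 : 1 ≤ r * k := by nlinarith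
  have hs0 : 0 < r * k := by linarith
  obtain ⟨C₁, hC₁, hosc⟩ := hK.exists_sum_meanOsc_rpow_le k hq hqp hr hγ
  obtain ⟨C₂, hC₂, hsum⟩ := IsSparse.exists_lintegral_rpow_le (d := d) hs1 le_rfl
    (by positivity)
  set C₃ : ℝ := (4 * 2 ^ d) ^ (r * k) * C₂ with hC₃
  have hC₃0 : 0 < C₃ := by positivity
  refine ⟨C₃ ^ (1 / r) * C₁, by positivity, ?_⟩
  intro b Θ hb hbk hΘ hoff z L hL
  have hbi := hbk.integrableOn_abs_pow hk
  have hmed : ∀ m n, ∃ β, IsMedian (volume.restrict (dyadicCube z L m n)) b β := fun m n => by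
    have : IsFiniteMeasure (volume.restrict (dyadicCube z L m n)) :=
      ⟨by rw [Measure.restrict_apply_univ]; exact (isCompact_axisCube _ _).measure_lt_top⟩
    exact exists_isMedian _ hb
  choose α hα using hmed
  have hcell : dyadicCell z L 0 0 = halfOpenCube z L := by
    have : dyadicCorner z L 0 0 = z := by ext i; simp [dyadicCorner]
    rw [dyadicCell, this, pow_zero, div_one]
  have hconst : C₃ * (C₁ * Θ) ^ r = (C₃ ^ (1 / r) * C₁ * Θ) ^ r := by
    rw [mul_assoc (C₃ ^ _), Real.mul_rpow (x := C₃ ^ (1 / r)) (by positivity) (by positivity),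
      ← Real.rpow_mul hC₃0.le,
      one_div_mul_cancel (by linarith), Real.rpow_one]
  have hN : ∀ N, ∫⁻ x in halfOpenCube z L,
      ENNReal.ofReal (|α N (dyadicIndex z L N x) - α 0 0| ^ (r * k)) ≤
        ENNReal.ofReal ((C₃ ^ (1 / r) * C₁ * Θ) ^ r) := by
    intro N
    obtain ⟨M, w, l, E, β, hE, hβ, hdom⟩ := exists_sparse_domination hb hbi hk hL hα N
    set m : Fin M → ℝ := fun i => meanOsc b k (w i) (l i) (β i) ^ (1 / (k : ℝ)) with hm
    have ha0 : ∀ i, 0 ≤ meanOsc b k (w i) (l i) (β i) := fun i =>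
      meanOsc_nonneg _ _ _ (hE.pos i) _
    have hm0 : ∀ i, 0 ≤ m i := fun i => Real.rpow_nonneg (ha0 i) _
    have h1 := hsum w l E (fun i => axisCube (w i) (l i)) m hE (fun i => measurableSet_axisCube _ _)
      (fun i => axisCube_subset_closedBall _ (hE.pos i).le)
      (fun i => volume_axisCube _ (hE.pos i).le) hm0
    -- Since `m i` is the `k`-th root of the mean oscillation, its power `r * k` is the `r`-th power
    -- bounded by the testing condition.
    have h2 : ∑ i, m i ^ (r * k) * l i ^ d ≤ (C₁ * Θ) ^ r := by
      refine le_trans (le_of_eq (Finset.sum_congr rfl fun i _ => ?_))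
        (hosc b Θ hb hbi hΘ hoff w l E β hE hβ)
      rw [hm, ← Real.rpow_mul (ha0 i)]
      congr 2
      field_simp
    rw [hcell] at hdom
    calc ∫⁻ x in halfOpenCube z L,
          ENNReal.ofReal (|α N (dyadicIndex z L N x) - α 0 0| ^ (r * k))
        ≤ ∫⁻ x in halfOpenCube z L, ENNReal.ofReal ((4 * 2 ^ d) ^ (r * k)) * ENNReal.ofReal
            ((∑ i, (axisCube (w i) (l i)).indicator (fun _ => m i) x) ^ (r * k)) := by
          refine setLIntegral_mono' (measurableSet_halfOpenCube _ _) fun x hx => ?_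
          have h3 : 0 ≤ ∑ i, (axisCube (w i) (l i)).indicator (fun _ => m i) x :=
            Finset.sum_nonneg fun i _ => indicator_nonneg (fun _ _ => hm0 i) x
          rw [← ENNReal.ofReal_mul (by positivity), ← Real.mul_rpow (by positivity) h3]
          exact ENNReal.ofReal_le_ofReal
            (Real.rpow_le_rpow (abs_nonneg _) (hdom x hx) hs0.le)
      _ ≤ ENNReal.ofReal ((4 * 2 ^ d) ^ (r * k)) * ∫⁻ x, ENNReal.ofReal
            ((∑ i, (axisCube (w i) (l i)).indicator (fun _ => m i) x) ^ (r * k)) := by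
          rw [lintegral_const_mul' _ _ ENNReal.ofReal_ne_top]
          gcongr
          exact Measure.restrict_le_self
      _ ≤ ENNReal.ofReal ((4 * 2 ^ d) ^ (r * k)) * ENNReal.ofReal (C₂ * (C₁ * Θ) ^ r) := by
          gcongr
          exact h1.trans (ENNReal.ofReal_le_ofReal (by gcongr))
      _ = _ := by
          rw [← ENNReal.ofReal_mul (by positivity), ← mul_assoc, hconst]
  refine ⟨α 0 0, ?_⟩
  have hlim := ae_tendsto_dyadic_median hd hb (hbk.locallyIntegrable hk) hL hα
  calc ∫⁻ x in halfOpenCube z L, ENNReal.ofReal (|b x - α 0 0| ^ (r * k))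
      = ∫⁻ x in halfOpenCube z L, liminf (fun N =>
          ENNReal.ofReal (|α N (dyadicIndex z L N x) - α 0 0| ^ (r * k))) atTop := by
        refine lintegral_congr_ae (ae_restrict_of_ae ?_)
        filter_upwards [hlim] with x hx
        refine (Tendsto.liminf_eq ?_).symm
        refine (ENNReal.continuous_ofReal.tendsto _).comp ?_
        exact ((hx.sub_const _).abs).rpow_const (Or.inr hs0.le)
    _ ≤ liminf (fun N => ∫⁻ x in halfOpenCube z L,
          ENNReal.ofReal (|α N (dyadicIndex z L N x) - α 0 0| ^ (r * k))) atTop := by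
        refine lintegral_liminf_le fun N => ?_
        have h4 : Measurable fun x => α N (dyadicIndex z L N x) :=
          (Measurable.of_discrete (f := α N)).comp (measurable_dyadicIndex N)
        exact ((h4.sub_const _).abs.pow_const _).ennreal_ofReal
    _ ≤ _ := by
        refine liminf_le_of_le (by isBoundedDefault) fun B hB => ?_
        obtain ⟨N, hN'⟩ := hB.exists
        exact hN'.trans (hN N)

lemma abs_sub_rpow_le_two_rpow_mul {s : ℝ} (hs : 0 ≤ s) (x y c : ℝ) :
    |x - y| ^ s ≤ 2 ^ s * (|c - x| ^ s + |c - y| ^ s) := by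
  have h1 : |x - y| ≤ 2 * max |c - x| |c - y| := by
    have := abs_sub_le x c y
    rw [abs_sub_comm x c] at this
    linarith [le_max_left |c - x| |c - y|, le_max_right |c - x| |c - y|]
  calc |x - y| ^ s ≤ (2 * max |c - x| |c - y|) ^ s := Real.rpow_le_rpow (abs_nonneg _) h1 hs
    _ = 2 ^ s * max |c - x| |c - y| ^ s := Real.mul_rpow zero_le_two (by positivity)
    _ ≤ _ := by
        gcongr
        rcases max_choice |c - x| |c - y| with h | h <;> rw [h]
        · linarith [Real.rpow_nonneg (abs_nonneg (c - y)) s]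
        · linarith [Real.rpow_nonneg (abs_nonneg (c - x)) s]

/-- Uniform control modulo constants on all cubes gives control modulo a constant on `ℝ^d`. -/
lemma exists_lintegral_sub_const_le (hb : Measurable b) {s B : ℝ} (hs : 0 < s) (hB : 0 ≤ B)
    (h : ∀ (z : RSpace d) (L : ℝ), 0 < L → ∃ c : ℝ,
      ∫⁻ x in halfOpenCube z L, ENNReal.ofReal (|b x - c| ^ s) ≤ ENNReal.ofReal B) :
    ∃ c : ℝ, ∫⁻ x, ENNReal.ofReal (|b x - c| ^ s) ≤ ENNReal.ofReal B := by
  set Q : ℕ → Set (RSpace d) := fun M =>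
    halfOpenCube (WithLp.toLp 2 fun _ => -((M : ℝ) + 1)) (2 * ((M : ℝ) + 1)) with hQ
  have hQm : ∀ M, MeasurableSet (Q M) := fun M => measurableSet_halfOpenCube _ _
  have hmem : ∀ M x, x ∈ Q M ↔ ∀ i, -((M : ℝ) + 1) ≤ x i ∧ x i < M + 1 := by
    intro M x
    refine forall_congr' fun i => and_congr Iff.rfl ?_
    dsimp only
    rw [show -((M : ℝ) + 1) + 2 * (M + 1) = M + 1 by ring]
  choose c hc using fun M : ℕ => h (WithLp.toLp 2 fun _ => -((M : ℝ) + 1)) (2 * ((M : ℝ) + 1))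
    (by positivity)
  -- Compare `c M` and `c 0` on the smallest cube, whose volume is at least `1`; the bound is
  -- uniform in `M`, so a subsequence of the constants converges.
  have hbdd : ∀ M, c M ∈ Metric.closedBall (c 0) ((2 ^ s * (B + B)) ^ (1 / s)) := by
    intro M
    rw [Metric.mem_closedBall, Real.dist_eq]
    have hsub : Q 0 ⊆ Q M := fun x hx => (hmem M x).2 fun i => by
      have h1 := (hmem 0 x).1 hx i
      have h2 : (0 : ℝ) ≤ M := by positivity
      simp only [Nat.cast_zero] at h1
      constructor <;> linarith
    have hmeas : ∀ e, Measurable fun x => ENNReal.ofReal (|b x - e| ^ s) := fun e => by fun_prop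
    have h1 : ENNReal.ofReal (|c M - c 0| ^ s) * 1 ≤ ENNReal.ofReal (2 ^ s * (B + B)) := by
      calc ENNReal.ofReal (|c M - c 0| ^ s) * 1
          ≤ ENNReal.ofReal (|c M - c 0| ^ s) * volume (Q 0) := by
            gcongr
            rw [hQ]
            simp only
            rw [volume_halfOpenCube _ (by positivity)]
            refine ENNReal.one_le_ofReal.2 (one_le_pow₀ ?_)
            norm_num
        _ = ∫⁻ _ in Q 0, ENNReal.ofReal (|c M - c 0| ^ s) := (setLIntegral_const _ _).symm
        _ ≤ ∫⁻ x in Q 0, ENNReal.ofReal (2 ^ s) *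
              (ENNReal.ofReal (|b x - c M| ^ s) + ENNReal.ofReal (|b x - c 0| ^ s)) := by
            refine lintegral_mono fun x => ?_
            rw [← ENNReal.ofReal_add (by positivity) (by positivity),
              ← ENNReal.ofReal_mul (by positivity)]
            exact ENNReal.ofReal_le_ofReal (abs_sub_rpow_le_two_rpow_mul hs.le _ _ _)
        _ = ENNReal.ofReal (2 ^ s) * ((∫⁻ x in Q 0, ENNReal.ofReal (|b x - c M| ^ s)) +
              ∫⁻ x in Q 0, ENNReal.ofReal (|b x - c 0| ^ s)) := by
            rw [lintegral_const_mul' _ _ ENNReal.ofReal_ne_top, lintegral_add_left (hmeas _)]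
        _ ≤ ENNReal.ofReal (2 ^ s) * (ENNReal.ofReal B + ENNReal.ofReal B) := by
            gcongr
            · exact (lintegral_mono_set hsub).trans (hc M)
            · exact hc 0
        _ = _ := by rw [← ENNReal.ofReal_add hB hB, ← ENNReal.ofReal_mul (by positivity)]
    rw [mul_one, ENNReal.ofReal_le_ofReal_iff (by positivity)] at h1
    calc |c M - c 0| = (|c M - c 0| ^ s) ^ (1 / s) := by
          rw [← Real.rpow_mul (abs_nonneg _), mul_one_div_cancel hs.ne', Real.rpow_one]
      _ ≤ _ := Real.rpow_le_rpow (by positivity) h1 (by positivity)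
  obtain ⟨e, -, φ, hφ, hlim⟩ := tendsto_subseq_of_bounded Metric.isBounded_closedBall hbdd
  refine ⟨e, ?_⟩
  calc ∫⁻ x, ENNReal.ofReal (|b x - e| ^ s)
      = ∫⁻ x, liminf (fun j => (Q (φ j)).indicator
          (fun x => ENNReal.ofReal (|b x - c (φ j)| ^ s)) x) atTop := by
        refine lintegral_congr fun x => (Tendsto.liminf_eq ?_).symm
        have h1 : Tendsto (fun j => ENNReal.ofReal (|b x - c (φ j)| ^ s)) atTop
            (𝓝 (ENNReal.ofReal (|b x - e| ^ s))) := by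
          refine (ENNReal.continuous_ofReal.tendsto _).comp ?_
          exact ((hlim.const_sub _).abs).rpow_const (Or.inr hs.le)
        refine h1.congr' ?_
        obtain ⟨M, hM⟩ := exists_nat_gt ‖x‖
        filter_upwards [eventually_ge_atTop M] with j hj
        have h2 : (M : ℝ) ≤ φ j := by exact_mod_cast hj.trans hφ.le_apply
        rw [indicator_of_mem]
        refine (hmem _ _).2 fun i => ?_
        have h3 := PiLp.norm_apply_le x i
        rw [Real.norm_eq_abs] at h3
        have h4 := abs_le.1 h3
        constructor <;> linarith
    _ ≤ liminf (fun j => ∫⁻ x, (Q (φ j)).indicator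
          (fun x => ENNReal.ofReal (|b x - c (φ j)| ^ s)) x) atTop :=
        lintegral_liminf_le fun j => Measurable.indicator (by fun_prop) (hQm _)
    _ ≤ _ := by
        refine liminf_le_of_le (by isBoundedDefault) fun B' hB' => ?_
        obtain ⟨j, hj⟩ := hB'.exists
        refine hj.trans ?_
        rw [lintegral_indicator (hQm _)]
        exact hc _

end Global

theorem theorem4p6 {d : ℕ} (hd : 1 ≤ d) (K : RSpace d → RSpace d → ℂ)
    (hK : IsNondegenerateCZKernel K) (k : ℕ) (hk : 1 ≤ k) (p q r : ℝ)
    (hq : 1 < q) (hqp : q < p) (hr : r = p * q / (p - q)) (γ : ℝ) (hγ : 0 < γ) :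
    ∃ C : ℝ, 0 < C ∧ ∀ (b : RSpace d → ℝ) (Θ : ℝ), MemLkLoc b k → 0 ≤ Θ →
      OffSupportSummedBound K b k p q γ Θ →
      ∃ (a : RSpace d → ℝ) (c : ℝ), (∀ x, b x = a x + c) ∧
        MemLp a (ENNReal.ofReal (r * k)) volume ∧
        eLpNorm a (ENNReal.ofReal (r * k)) volume ≤
          ENNReal.ofReal (C * Θ ^ (1 / (k : ℝ))) := by
  have hr1 : 1 < r := by rw [hr, lt_div_iff₀ (by linarith)]; nlinarith
  have hr0 : 0 < r := by linarith
  have hk0 : (0 : ℝ) < k := by exact_mod_cast hk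
  have hs0 : 0 < r * k := by positivity
  obtain ⟨C, hC, hmain⟩ :=
    (hK.hasNearlyConstantPairs hd).exists_lintegral_cube_le hd hk hq hqp hr hγ
  refine ⟨C ^ (1 / (k : ℝ)), by positivity, fun b Θ hb hΘ hoff => ?_⟩
  have hbm : AEStronglyMeasurable b volume := (hb.locallyIntegrable hk).aestronglyMeasurable
  -- A Borel representative makes all level sets measurable; hypothesis and conclusion depend only
  -- on the almost everywhere class.
  obtain ⟨b', hb'm, hbb'⟩ := hbm.aemeasurable
  obtain ⟨c, hc⟩ := exists_lintegral_sub_const_le hb'm hs0 (by positivity)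
    (hmain b' Θ hb'm (hb.congr_ae hbb') hΘ (hoff.congr_ae hbb'))
  have hnorm : eLpNorm (fun x => b x - c) (ENNReal.ofReal (r * k)) volume ≤
      ENNReal.ofReal (C ^ (1 / (k : ℝ)) * Θ ^ (1 / (k : ℝ))) := by
    have h1 : eLpNorm (fun x => b x - c) (ENNReal.ofReal (r * k)) volume =
        eLpNorm (fun x => |b' x - c|) (ENNReal.ofReal (r * k)) volume := by
      rw [← eLpNorm_norm (fun x => b x - c)]
      refine eLpNorm_congr_ae ?_
      filter_upwards [hbb'] with x hx
      rw [hx, Real.norm_eq_abs]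
    rw [h1]
    refine (eLpNorm_le_of_lintegral_le hs0 (fun x => abs_nonneg _) (by positivity) hc).trans
      (le_of_eq ?_)
    congr 1
    rw [← Real.rpow_mul (by positivity), ← Real.mul_rpow hC.le hΘ]
    congr 1
    field_simp
  exact ⟨fun x => b x - c, c, fun x => by ring,
    ⟨hbm.sub aestronglyMeasurable_const, hnorm.trans_lt ENNReal.ofReal_lt_top⟩, hnorm⟩
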